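/- Let $f_2,g_2,h_2\in\mathbb C[X_0,X_1,X_2]$ be homogeneous of degree $2$ and let $C\subset\mathbb P^2(\mathbb C)$ be the sextic of semi-torus type $F=0$, $F:=f_2^3+g_2^2h_2$. A singular point $P$ of $C$ is called *wild* if $f_2(P)=g_2(P)=h_2(P)=0$, *inner* if $f_2(P)=g_2(P)=0$ and $P$ is not wild, and *outer* if $f_2(P)\neq0$. The sextic $C$ is *nice* if it has no wild singularity. A sextic $F=0$ is of *non-torus type* if there are no integers $p,q\ge2$ dividing $6$ and no forms $a,b$ of degrees $6/p$, $6/q$ with $F=a^p+b^q$. Assume that $C$ is nice and that its inner singularities are finite in number and simple (of type ADE); let $\Sigma_{inner}$ be the multiset of their types. For a point $P$ of the plane with a fixed representative in $\mathbb C^3$ put $t=f_2(P)$, $s=g_2(P)$ (none of the conditions below depends on the representative). (a) Let $P\ne Q$ be two outer $A_2$ singularities of $C$, with values $t_1=f_2(P)$, $s_1=g_2(P)$, $t_2=f_2(Q)$, $s_2=g_2(Q)$, and assume that every singularity of $C$ other than $P$, $Q$ and the inner ones is simple and is neither $E_6$ nor of type $A_{3k-1}$, $k\ge1$. If $t_1,s_1,t_2,s_2\neq0$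 and $t_1s_2-t_2s_1\neq0$, then $C$ is of non-torus type and its configuration of singularities contains $\Sigma_{inner}\cup\{2A_2\}$. (b) Let $P$ be an outer $A_5$ singularity of $C$, with values $t_1=f_2(P)$, $s_1=g_2(P)$, and assume that every singularity of $C$ other than $P$ and the inner ones is simple and is neither $E_6$ nor of type $A_{3k-1}$, $k\ge1$. If $t_1,s_1\neq0$ and the tangent cone of $C$ at $P$ is not the tangent line at $P$ of the conic $s_1f_2-t_1g_2=0$ (which passes through $P$; the condition is taken to hold if this conic has no tangent line at $P$, being singular there or the zero form), then $C$ is of non-torus type and its configuration of singularities contains $\Sigma_{inner}\cup\{A_5\}$. -/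

import Mathlib

noncomputable section

namespace SemiTorus

open MvPolynomial

/-- Polynomials in three homogeneous coordinates over `ℂ`. -/
abbrev Form := MvPolynomial (Fin 3) ℂ

/-- The complex projective plane. -/
abbrev Plane := Projectivization ℂ (Fin 3 → ℂ)

/-- The value of a form at the chosen representative of a point. Replacing the representative
multiplies the values of all forms of degree `d` by the same nonzero `d`-th power. -/
def value (F : Form) (P : Plane) : ℂ := eval P.rep F

/-- `P` is a singular point of the curve `F = 0`. -/
def IsSingularAt (F : Form) (P : Plane) : Prop :=
  value F P = 0 ∧ ∀ i, value (pderiv i F) P = 0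

/-! ### Simple singularities -/

/-- Labels of the simple (ADE) singularities. -/
inductive SimpleType where
  | A (n : ℕ)
  | D (n : ℕ)
  | E6
  | E7
  | E8

namespace SimpleType

/-- The admissible labels: `A n` for `n ≥ 1`, `D n` for `n ≥ 4`, `E6`, `E7`, `E8`. -/
def Valid : SimpleType → Prop
  | A n => 1 ≤ n
  | D n => 4 ≤ n
  | _ => True

/-- The normal form of a simple plane curve germ, in the coordinates `u = X 0`, `v = X 1`. -/
def normalForm : SimpleType → MvPowerSeries (Fin 2) ℂ
  | A n => MvPowerSeries.X 0 ^ 2 + MvPowerSeries.X 1 ^ (n + 1)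
  | D n => MvPowerSeries.X 0 ^ 2 * MvPowerSeries.X 1 + MvPowerSeries.X 1 ^ (n - 1)
  | E6 => MvPowerSeries.X 0 ^ 3 + MvPowerSeries.X 1 ^ 4
  | E7 => MvPowerSeries.X 0 ^ 3 + MvPowerSeries.X 0 * MvPowerSeries.X 1 ^ 3
  | E8 => MvPowerSeries.X 0 ^ 3 + MvPowerSeries.X 1 ^ 5

/-- The types `A_{3k-1}` and `E6`. -/
def IsCuspidal : SimpleType → Prop
  | A n => 3 ∣ n + 1
  | E6 => True
  | _ => False

end SimpleType

/-- `Φ(u, v)` is a system of (formal) local coordinates of the plane at `P`: it takes the value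
`P` at the origin, and its first partial derivatives there span, with `P`, the whole of `ℂ³`. -/
def IsLocalParam (P : Plane) (Φ : Fin 3 → MvPowerSeries (Fin 2) ℂ) : Prop :=
  (∀ i, MvPowerSeries.constantCoeff (Φ i) = P.rep i) ∧
    (Matrix.of ![P.rep,
      fun i => MvPowerSeries.coeff (Finsupp.single 0 1) (Φ i),
      fun i => MvPowerSeries.coeff (Finsupp.single 1 1) (Φ i)]).det ≠ 0

/-- The germ of the curve `F = 0` at `P` is a simple singularity of type `τ`: in suitable local
coordinates, the equation is a unit times the normal form. -/
def HasType (F : Form) (P : Plane) (τ : SimpleType) : Prop :=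
  τ.Valid ∧ ∃ Φ : Fin 3 → MvPowerSeries (Fin 2) ℂ, IsLocalParam P Φ ∧
    ∃ e : MvPowerSeries (Fin 2) ℂ, IsUnit e ∧ aeval Φ F = e * τ.normalForm

/-- The curve `F = 0` has at least the configuration `S` of simple singularities: there are
distinct singular points whose types make up the multiset `S`. -/
def ContainsConfiguration (F : Form) (S : Multiset SimpleType) : Prop :=
  ∃ (T : Finset Plane) (type : Plane → SimpleType),
    (∀ P ∈ T, IsSingularAt F P ∧ HasType F P (type P)) ∧ T.val.map type = S

/-! ### Torus type -/

/-- The curve `F = 0` of degree `d` is a `(p, q)`-torus curve. -/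
def IsTorusCurve (d : ℕ) (F : Form) (p q : ℕ) : Prop :=
  2 ≤ p ∧ 2 ≤ q ∧ p ∣ d ∧ q ∣ d ∧
    ∃ a b : Form, a.IsHomogeneous (d / p) ∧ b.IsHomogeneous (d / q) ∧ F = a ^ p + b ^ q

/-- The curve `F = 0` of degree `d` is of non-torus type. -/
def IsNonTorus (d : ℕ) (F : Form) : Prop :=
  ∀ p q, ¬ IsTorusCurve d F p q

/-! ### Sextics of semi-torus type -/

/-- The equation of a sextic of semi-torus type. -/
def sextic (f g h : Form) : Form := f ^ 3 + g ^ 2 * h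

/-- Wild singularities. -/
def IsWild (f g h : Form) (P : Plane) : Prop :=
  IsSingularAt (sextic f g h) P ∧ value f P = 0 ∧ value g P = 0 ∧ value h P = 0

/-- The sextic has no wild singularity. -/
def IsNice (f g h : Form) : Prop := ∀ P, ¬ IsWild f g h P

/-- Inner singularities. -/
def IsInner (f g h : Form) (P : Plane) : Prop :=
  IsSingularAt (sextic f g h) P ∧ value f P = 0 ∧ value g P = 0 ∧ ¬ IsWild f g h P

/-- Outer singularities. -/
def IsOuter (f g h : Form) (P : Plane) : Prop :=
  IsSingularAt (sextic f g h) P ∧ value f P ≠ 0 ∧ ¬ IsWild f g h P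

/-- The inner singularities are finite in number and simple, and `S` is the multiset of
their types. -/
def IsInnerConfiguration (f g h : Form) (S : Multiset SimpleType) : Prop :=
  ∃ (T : Finset Plane) (type : Plane → SimpleType),
    (∀ P, P ∈ T ↔ IsInner f g h P) ∧
      (∀ P ∈ T, HasType (sextic f g h) P (type P)) ∧ T.val.map type = S

/-- Apart from the inner singularities and the points of `E`, the sextic has only simple
singularities, none of them of type `A_{3k-1}` or `E6`. -/
def NoFurtherCusps (f g h : Form) (E : Set Plane) : Prop :=
  ∀ R, IsSingularAt (sextic f g h) R → ¬ IsInner f g h R → R ∉ E →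
    ∃ τ : SimpleType, HasType (sextic f g h) R τ ∧ ¬ τ.IsCuspidal

/-! ### Tangent cones -/

/-- The polynomial `F (P + T w)` in `T`. -/
def alongLine (F : Form) (P : Plane) (w : Fin 3 → ℂ) : Polynomial ℂ :=
  aeval (fun i => Polynomial.C (P.rep i) + Polynomial.X * Polynomial.C (w i)) F

/-- The tangent cone of the curve `F = 0` at `P`, as a set of vectors in `ℂ³`: the zero set of the
nonzero homogeneous part of lowest degree, in `w`, of `F (P + w)`. -/
def tangentCone (F : Form) (P : Plane) : Set (Fin 3 → ℂ) :=
  {w | ∀ k, (∀ j < k, ∀ u, (alongLine F P u).coeff j = 0) → (alongLine F P w).coeff k = 0}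

/-- `J = 0` is smooth at `P`, and its tangent line at `P` is the tangent cone of `F = 0`. -/
def TangentConeIsTangentOf (F J : Form) (P : Plane) : Prop :=
  value J P = 0 ∧ ¬ IsSingularAt J P ∧ tangentCone F P = tangentCone J P

end SemiTorus

end

/-! ### Germs in two variables, restricted to the coordinate axes -/

namespace SemiTorus
open MvPolynomial

/-! A torus decomposition of a sextic has one of three shapes: $F=AB$ with $A,B$ cubics (since
$a^2+b^2=(a+ib)(a-ib)$), $F=a^2+b^3$, or $F=a^3+b^3$ (`isNonTorus_six`). Each shape is excluded
separately. The configuration is immediate, because outer points differ from inner ones.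

Square plus cube. If a simple germ equals $b^3+\varepsilon a^2$ with $\varepsilon$ a unit and $a,b$
vanishing at the point, its type is $A_{3k-1}$ or $E_6$, and in normal coordinates the ideal $(a,b)$
is $(u,v^k)$, with $k=2$ for $E_6$. The ideal thus depends only on the germ
(`cube_add_sq_eq_normalForm`). Hence if $f^3+g^2h=a^2+b^3$, the common zeros of $a,b$ are inner or
exceptional points, and at the inner ones $(a,b)$ and $(g,f)$ agree locally. If a linear form $w$
lies in $(a,b)$ locally at the exceptional points, Noether's theorem (`mem_span_of_local`) gives
$wf,wg\in(a,b)$. By degrees $wf=ca+nb$ and $wg=c'a+n'b$, and eliminating $a$ puts $b$ in the pencil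
of $f$ and $g$ (`pencil_of_mul_mem`); two independent such $w$ cannot exist. For two cusps $w$ is
the line $PQ$, and $b(P)=b(Q)=0$ contradicts $t_1s_2-t_2s_1\neq0$. For $A_5$, $w$ is the tangent at
$P$ and $b$ is proportional to $s_1f-t_1g$; comparing both expressions of $F$ shows that $w$ divides
$b$, which the tangent condition forbids.

Two cubes. The sextic is a product of three conics, and conics carry no $A_n$ with $n\ge2$
(`not_cube_add_cube`).

Two cubics. A component which alone carries a cusp is projectively $X_0X_1^2=X_2^3$, parametrized by
$(t^3:1:t)$. On it $f^3=-g^2h$, and the absence of wild points gives $g=D^3$, $f=D^2E$, $h=-E^3$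
with $\deg D,\deg E\le2$ (`exists_cuspParam_eq`). Restricted conics have no $t^5$ term, which makes
everything explicit. With two outer cusps, each is a cusp of exactly one component, and the
computation shows that the other component has no cusp. With an $A_5$, both components pass through
$P$ with contact three. If some inner point lies on one component only, a polynomial acquires a
triple root, which `not_triple_root` excludes. Otherwise Noether's theorem expresses both components
through $g$ and two linear forms (`IsGood.exists_linear_of_mul`), and both must contain the tangent
line at $P$, which is impossible. -/

/-- Formal power series in the local coordinates `u = X 0` and `v = X 1`. -/
abbrev Series := MvPowerSeries (Fin 2) ℂ

/-- The restriction of a power series to the `i`-th coordinate axis. -/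
noncomputable def axis (i : Fin 2) : Series →+* PowerSeries ℂ where
  toFun F := PowerSeries.mk fun n => MvPowerSeries.coeff (Finsupp.single i n) F
  map_one' := by
    classical
    ext n
    simp [MvPowerSeries.coeff_one, PowerSeries.coeff_one]
  map_mul' F G := by
    classical
    ext n
    simp [MvPowerSeries.coeff_mul, PowerSeries.coeff_mul, Finsupp.antidiagonal_single]
  map_zero' := by ext n; simp
  map_add' F G := by ext n; simp

@[simp] lemma coeff_axis (i : Fin 2) (F : Series) (n : ℕ) :
    PowerSeries.coeff n (axis i F) = MvPowerSeries.coeff (Finsupp.single i n) F := by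
  simp [axis]

@[simp] lemma constantCoeff_axis (i : Fin 2) (F : Series) :
    PowerSeries.constantCoeff (axis i F) = MvPowerSeries.constantCoeff F := by
  rw [← PowerSeries.coeff_zero_eq_constantCoeff_apply, coeff_axis]
  simp

@[simp] lemma axis_X_self (i : Fin 2) : axis i (MvPowerSeries.X i) = PowerSeries.X := by
  classical
  ext n
  simp [MvPowerSeries.coeff_X, PowerSeries.coeff_X, (Finsupp.single_injective i).eq_iff]

lemma axis_X_of_ne {i j : Fin 2} (h : j ≠ i) : axis i (MvPowerSeries.X j) = 0 := by
  classical
  ext n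
  simp only [coeff_axis, MvPowerSeries.coeff_X, map_zero, ite_eq_right_iff, one_ne_zero, imp_false]
  intro hh
  have := DFunLike.congr_fun hh j
  simp [h.symm] at this

@[simp] lemma axis_zero_X_one : axis 0 (MvPowerSeries.X 1) = 0 := axis_X_of_ne (by decide)
@[simp] lemma axis_one_X_zero : axis 1 (MvPowerSeries.X 0) = 0 := axis_X_of_ne (by decide)

/-- The derivative in the direction of the other coordinate, along the `i`-th axis. -/
noncomputable def normalDeriv (i : Fin 2) (F : Series) : PowerSeries ℂ :=
  axis i (MvPowerSeries.pderiv ℂ i.rev F)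

lemma normalDeriv_mul (i : Fin 2) (F G : Series) :
    normalDeriv i (F * G) = normalDeriv i F * axis i G + axis i F * normalDeriv i G := by
  simp only [normalDeriv, Derivation.leibniz, smul_eq_mul, map_add, map_mul]
  ring

lemma normalDeriv_add (i : Fin 2) (F G : Series) :
    normalDeriv i (F + G) = normalDeriv i F + normalDeriv i G := by
  simp [normalDeriv]

lemma normalDeriv_pow_two (i : Fin 2) (F : Series) :
    normalDeriv i (F ^ 2) = 2 * axis i F * normalDeriv i F := by
  rw [pow_two, normalDeriv_mul]; ring

lemma normalDeriv_pow_three (i : Fin 2) (F : Series) :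
    normalDeriv i (F ^ 3) = 3 * axis i F ^ 2 * normalDeriv i F := by
  rw [pow_succ, normalDeriv_mul, normalDeriv_pow_two, map_pow]; ring

@[simp] lemma normalDeriv_zero_X_one : normalDeriv 0 (MvPowerSeries.X 1) = 1 := by
  simp [normalDeriv, show (Fin.rev 0 : Fin 2) = 1 from rfl]

@[simp] lemma normalDeriv_one_X_zero : normalDeriv 1 (MvPowerSeries.X 0) = 1 := by
  simp [normalDeriv, show (Fin.rev 1 : Fin 2) = 0 from rfl]

lemma normalDeriv_X_self_pow (i : Fin 2) (n : ℕ) : normalDeriv i (MvPowerSeries.X i ^ n) = 0 := by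
  fin_cases i <;> simp [normalDeriv, Derivation.leibniz_pow, MvPowerSeries.pderiv_X_of_ne]

/-- Both sides are the coefficient of the other variable; this carries linear terms from one axis to
the other. -/
lemma constantCoeff_normalDeriv (i : Fin 2) (F : Series) :
    PowerSeries.constantCoeff (normalDeriv i F) = PowerSeries.coeff 1 (axis i.rev F) := by
  simp [normalDeriv, ← MvPowerSeries.coeff_zero_eq_constantCoeff_apply,
    MvPowerSeries.coeff_pderiv]

lemma X_dvd_of_axis_one_eq_zero {F : Series} (h : axis 1 F = 0) :
    (MvPowerSeries.X 0 : Series) ∣ F := by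
  rw [MvPowerSeries.X_dvd_iff]
  intro m hm
  have h1 : m = Finsupp.single 1 (m 1) := by
    ext i; fin_cases i <;> simp [hm]
  have := congrArg (PowerSeries.coeff (m 1)) h
  rw [coeff_axis, map_zero, ← h1] at this
  exact this

/-- A power series whose restriction to `u = 0` is divisible by `v ^ k` lies in `(u, v ^ k)`. -/
lemma exists_eq_of_X_pow_dvd_axis {F : Series} {k : ℕ} (h : PowerSeries.X ^ k ∣ axis 1 F) :
    ∃ F₁ F₂ : Series, F = MvPowerSeries.X 0 * F₁ + MvPowerSeries.X 1 ^ k * F₂ := by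
  obtain ⟨φ, hφ⟩ := h
  have key : ∀ ψ : PowerSeries ℂ, ∃ G : Series, axis 1 G = ψ := by
    intro ψ
    -- The exponent of $u$ is ignored, so this lift of $\psi$ is $\psi(v)/(1-u)$.
    let G : Series := fun m => PowerSeries.coeff (m 1) ψ
    refine ⟨G, ?_⟩
    ext n
    rw [coeff_axis]
    change PowerSeries.coeff ((Finsupp.single (1 : Fin 2) n) 1) ψ = _
    simp
  obtain ⟨G, hG⟩ := key φ
  obtain ⟨F₁, hF₁⟩ := X_dvd_of_axis_one_eq_zero
    (F := F - MvPowerSeries.X 1 ^ k * G) (by simp [hφ, hG])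
  exact ⟨F₁, G, by rw [← hF₁]; ring⟩

lemma isUnit_iff_constantCoeff_ne_zero {F : Series} :
    IsUnit F ↔ MvPowerSeries.constantCoeff F ≠ 0 := by
  rw [MvPowerSeries.isUnit_iff_constantCoeff, isUnit_iff_ne_zero]

/-- A Jacobian criterion for two power series to generate the ideal `(u, v ^ k)`. -/
lemma mem_span_pair_of_jacobian {x y : Series} {k : ℕ} (hk : 1 ≤ k)
    (hx : PowerSeries.X ^ k ∣ axis 1 x) (hy : PowerSeries.X ^ k ∣ axis 1 y)
    (hdet : PowerSeries.constantCoeff (normalDeriv 1 x) * PowerSeries.coeff k (axis 1 y)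
      - PowerSeries.coeff k (axis 1 x) * PowerSeries.constantCoeff (normalDeriv 1 y) ≠ 0)
    {F : Series} (hF : PowerSeries.X ^ k ∣ axis 1 F) : F ∈ Ideal.span {x, y} := by
  obtain ⟨x₁, x₂, ex⟩ := exists_eq_of_X_pow_dvd_axis hx
  obtain ⟨y₁, y₂, ey⟩ := exists_eq_of_X_pow_dvd_axis hy
  obtain ⟨F₁, F₂, eF⟩ := exists_eq_of_X_pow_dvd_axis hF
  have key : ∀ z z₁ z₂ : Series, z = MvPowerSeries.X 0 * z₁ + MvPowerSeries.X 1 ^ k * z₂ →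
      PowerSeries.constantCoeff (normalDeriv 1 z) = MvPowerSeries.constantCoeff z₁ ∧
      PowerSeries.coeff k (axis 1 z) = MvPowerSeries.constantCoeff z₂ := by
    intro z z₁ z₂ ez
    constructor
    · rw [ez, normalDeriv_add, normalDeriv_mul, normalDeriv_mul, normalDeriv_X_self_pow]
      simp [show k ≠ 0 by omega]
    · rw [ez]
      simp only [map_add, map_mul, map_pow, axis_X_self, axis_one_X_zero, zero_mul, zero_add]
      simpa using PowerSeries.coeff_X_pow_mul (axis 1 z₂) k 0
  rw [(key x x₁ x₂ ex).1, (key x x₁ x₂ ex).2, (key y y₁ y₂ ey).1, (key y y₁ y₂ ey).2,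
    ← map_mul, ← map_mul, ← map_sub] at hdet
  -- Cramer's rule: the matrix expressing $x,y$ through $u,v^k$ has invertible determinant.
  obtain ⟨w, hw⟩ := isUnit_iff_constantCoeff_ne_zero.mpr hdet
  have hw' : (↑w⁻¹ : Series) * (x₁ * y₂ - x₂ * y₁) = 1 := by rw [← hw]; simp
  rw [Ideal.mem_span_pair]
  refine ⟨(↑w⁻¹ : Series) * (F₁ * y₂ - F₂ * y₁), (↑w⁻¹ : Series) * (F₂ * x₁ - F₁ * x₂), ?_⟩
  rw [eF, ex, ey]
  linear_combination (MvPowerSeries.X 0 * F₁ + MvPowerSeries.X 1 ^ k * F₂) * hw'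

lemma X_pow_dvd_axis_of_mem_span {x y F : Series} {k : ℕ}
    (hx : PowerSeries.X ^ k ∣ axis 1 x) (hy : PowerSeries.X ^ k ∣ axis 1 y)
    (hF : F ∈ Ideal.span {x, y}) : PowerSeries.X ^ k ∣ axis 1 F := by
  obtain ⟨p, q, rfl⟩ := Ideal.mem_span_pair.mp hF
  rw [map_add, map_mul, map_mul]
  exact dvd_add (hx.mul_left _) (hy.mul_left _)
end SemiTorus

/-! ### Simple germs written as a cube plus a unit times a square -/

namespace SemiTorus
open MvPolynomial

section PowerSeriesOrders

variable {K : Type*} [Field K]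

lemma exists_eq_X_pow_mul {x : PowerSeries K} (hx : x ≠ 0) :
    ∃ (n : ℕ) (w : PowerSeries K), x = PowerSeries.X ^ n * w ∧
      PowerSeries.constantCoeff w ≠ 0 := by
  refine ⟨x.order.toNat, x.divXPowOrder, PowerSeries.X_pow_order_mul_divXPowOrder.symm, ?_⟩
  rwa [Ne, PowerSeries.constantCoeff_divXPowOrder_eq_zero_iff]

lemma le_of_X_pow_dvd {m n : ℕ} {w : PowerSeries K} (hw : PowerSeries.constantCoeff w ≠ 0)
    (h : PowerSeries.X ^ m ∣ PowerSeries.X ^ n * w) : m ≤ n := by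
  by_contra hlt
  apply hw
  have := PowerSeries.X_pow_dvd_iff.mp h n (by omega)
  simpa using (PowerSeries.coeff_X_pow_mul w n 0).symm.trans (by simpa using this)

lemma X_pow_mul_inj {m n : ℕ} {w w' : PowerSeries K} (hw : PowerSeries.constantCoeff w ≠ 0)
    (hw' : PowerSeries.constantCoeff w' ≠ 0)
    (h : PowerSeries.X ^ m * w = PowerSeries.X ^ n * w') : m = n :=
  le_antisymm (le_of_X_pow_dvd hw' ⟨w, h.symm⟩) (le_of_X_pow_dvd hw ⟨w', h⟩)

lemma X_pow_succ_dvd {m : ℕ} {w : PowerSeries K} (h : PowerSeries.X ^ (m + 1) ∣ PowerSeries.X ^ m * w) :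
    PowerSeries.X ∣ w := by
  rw [pow_succ] at h
  exact (mul_dvd_mul_iff_left (pow_ne_zero m PowerSeries.X_ne_zero)).mp h

lemma coeff_X_pow_mul_self (m : ℕ) (w : PowerSeries K) :
    PowerSeries.coeff m (PowerSeries.X ^ m * w) = PowerSeries.constantCoeff w := by
  simpa using PowerSeries.coeff_X_pow_mul w m 0

/-- The cube already has order at least $3$, so $\alpha^2$ does too, and its order is even. The next
two lemmas continue this alternation between $\alpha$ and $\beta$. -/
lemma X_sq_dvd_of_cube_add_sq {α β ε : PowerSeries K} (hε : PowerSeries.constantCoeff ε ≠ 0)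
    (hα : PowerSeries.X ∣ α) (hβ : PowerSeries.X ∣ β)
    (h : PowerSeries.X ^ 3 ∣ β ^ 3 + ε * α ^ 2) : PowerSeries.X ^ 2 ∣ α := by
  obtain ⟨α', rfl⟩ := hα
  obtain ⟨β', rfl⟩ := hβ
  have h1 : PowerSeries.X ^ (2 + 1) ∣ PowerSeries.X ^ 2 * (ε * α' ^ 2) := by
    have := dvd_sub h (Dvd.intro (β' ^ 3) rfl)
    convert this using 1; ring
  have h2 := PowerSeries.X_dvd_iff.mp (X_pow_succ_dvd h1)
  have h3 : PowerSeries.X ∣ α' := by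
    rw [PowerSeries.X_dvd_iff]; simpa [hε] using h2
  rw [pow_two]; exact mul_dvd_mul_left _ h3

lemma X_sq_dvd_of_cube_add_sq' {α β ε : PowerSeries K} (hε : PowerSeries.constantCoeff ε ≠ 0)
    (hα : PowerSeries.X ∣ α) (hβ : PowerSeries.X ∣ β)
    (h : PowerSeries.X ^ 4 ∣ β ^ 3 + ε * α ^ 2) : PowerSeries.X ^ 2 ∣ β := by
  obtain ⟨α', rfl⟩ := X_sq_dvd_of_cube_add_sq hε hα hβ ((pow_dvd_pow _ (by norm_num)).trans h)
  obtain ⟨β', rfl⟩ := hβ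
  have h1 : PowerSeries.X ^ (3 + 1) ∣ PowerSeries.X ^ 3 * (β' ^ 3) := by
    have := dvd_sub h (Dvd.intro (ε * α' ^ 2) rfl)
    convert this using 1; ring
  have h2 := PowerSeries.X_dvd_iff.mp (X_pow_succ_dvd h1)
  have h3 : PowerSeries.X ∣ β' := by
    rw [PowerSeries.X_dvd_iff]; simpa using h2
  rw [pow_two]; exact mul_dvd_mul_left _ h3

lemma X_cube_dvd_of_cube_add_sq {α β ε : PowerSeries K} (hε : PowerSeries.constantCoeff ε ≠ 0)
    (hα : PowerSeries.X ∣ α) (hβ : PowerSeries.X ∣ β)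
    (h : PowerSeries.X ^ 5 ∣ β ^ 3 + ε * α ^ 2) : PowerSeries.X ^ 3 ∣ α := by
  obtain ⟨β', rfl⟩ := X_sq_dvd_of_cube_add_sq' hε hα hβ ((pow_dvd_pow _ (by norm_num)).trans h)
  obtain ⟨α', rfl⟩ := X_sq_dvd_of_cube_add_sq hε hα hβ ((pow_dvd_pow _ (by norm_num)).trans h)
  have h1 : PowerSeries.X ^ (4 + 1) ∣ PowerSeries.X ^ 4 * (ε * α' ^ 2) := by
    have := dvd_sub h (Dvd.intro (PowerSeries.X * β' ^ 3) rfl)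
    convert this using 1; ring
  have h2 := PowerSeries.X_dvd_iff.mp (X_pow_succ_dvd h1)
  have h3 : PowerSeries.X ∣ α' := by
    rw [PowerSeries.X_dvd_iff]; simpa [hε] using h2
  rw [pow_succ]; exact mul_dvd_mul_left _ h3

end PowerSeriesOrders

lemma X_dvd_axis {F : Series} (i : Fin 2) (h : MvPowerSeries.constantCoeff F = 0) :
    PowerSeries.X ∣ axis i F := by
  rwa [PowerSeries.X_dvd_iff, constantCoeff_axis]

lemma normalDeriv_cube_add_sq (i : Fin 2) (a b ε : Series) :
    normalDeriv i (b ^ 3 + ε * a ^ 2) = 3 * axis i b ^ 2 * normalDeriv i b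
      + (normalDeriv i ε * axis i a ^ 2 + 2 * axis i ε * axis i a * normalDeriv i a) := by
  rw [normalDeriv_add, normalDeriv_mul, normalDeriv_pow_three, normalDeriv_pow_two, map_pow]
  ring

/-- If a germ of type `A_{N-1}` is written as `b ^ 3 + ε a ^ 2` with `a`, `b` vanishing at the
point, then `N = 3 k`, where `k` is the order of `b` along `u = 0`. -/
lemma cube_add_sq_eq_A {a b e ε : Series} (ha : MvPowerSeries.constantCoeff a = 0)
    (hb : MvPowerSeries.constantCoeff b = 0) (he : MvPowerSeries.constantCoeff e ≠ 0)
    (hε : MvPowerSeries.constantCoeff ε ≠ 0) {N : ℕ} (hN : 1 ≤ N)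
    (h : b ^ 3 + ε * a ^ 2 = e * (MvPowerSeries.X 0 ^ 2 + MvPowerSeries.X 1 ^ N)) :
    ∃ k, 1 ≤ k ∧ N = 3 * k ∧ PowerSeries.X ^ (2 * k) ∣ axis 1 a ∧ PowerSeries.X ^ k ∣ axis 1 b ∧
      PowerSeries.coeff k (axis 1 b) ≠ 0 ∧ PowerSeries.constantCoeff (normalDeriv 1 a) ≠ 0 := by
  -- Along $v=0$ the germ is a unit times $u^2$ while $b^3$ has order at least three, so $a$ has a
  -- linear term in $u$.
  have hda : PowerSeries.constantCoeff (normalDeriv 1 a) ≠ 0 := by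
    have h0 := congrArg (axis 0) h
    obtain ⟨α, hα⟩ := X_dvd_axis 0 ha
    obtain ⟨β, hβ⟩ := X_dvd_axis 0 hb
    simp only [map_add, map_mul, map_pow, axis_X_self, axis_zero_X_one, hα, hβ,
      zero_pow (show N ≠ 0 by omega), add_zero] at h0
    have h1 : PowerSeries.X ^ 2 * (PowerSeries.X * β ^ 3 + axis 0 ε * α ^ 2)
        = PowerSeries.X ^ 2 * axis 0 e := by linear_combination h0
    have h2 := congrArg PowerSeries.constantCoeff
      (mul_left_cancel₀ (pow_ne_zero 2 PowerSeries.X_ne_zero) h1)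
    rw [constantCoeff_normalDeriv, show (Fin.rev 1 : Fin 2) = 0 from rfl, hα]
    intro h3
    rw [show (1 : ℕ) = 0 + 1 from rfl, PowerSeries.coeff_succ_X_mul,
      PowerSeries.coeff_zero_eq_constantCoeff_apply] at h3
    simp [h3] at h2
    exact he h2.symm
  have h1 : axis 1 b ^ 3 + axis 1 ε * axis 1 a ^ 2 = axis 1 e * PowerSeries.X ^ N := by
    simpa using congrArg (axis 1) h
  -- Besides the restriction to $u=0$, the $u$-derivative there is also divisible by $v^N$, as
  -- $\partial_u(u^2)$ vanishes on the axis.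
  have h2 := congrArg (normalDeriv 1) h
  rw [normalDeriv_cube_add_sq, normalDeriv_mul, normalDeriv_add, normalDeriv_pow_two,
    normalDeriv_X_self_pow] at h2
  simp only [map_add, map_pow, axis_X_self, axis_one_X_zero, mul_zero, zero_mul, add_zero,
    zero_pow two_ne_zero, zero_add] at h2
  have ha' : PowerSeries.constantCoeff (axis 1 a) = 0 := by simpa using ha
  have hb' : PowerSeries.constantCoeff (axis 1 b) = 0 := by simpa using hb
  have hε' : PowerSeries.constantCoeff (axis 1 ε) ≠ 0 := by simpa using hε
  have he' : PowerSeries.constantCoeff (axis 1 e) ≠ 0 := by simpa using he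
  set α := axis 1 a
  set β := axis 1 b
  set da := normalDeriv 1 a
  have hunit : PowerSeries.constantCoeff (normalDeriv 1 ε * α + 2 * axis 1 ε * da) ≠ 0 := by
    have h2 : PowerSeries.constantCoeff (2 : PowerSeries ℂ) = 2 := map_ofNat _ 2
    simpa [ha', h2] using ⟨hε, hda⟩
  -- If $\beta=0$, the derivative gives $\alpha$ order at least $N$, while the restriction gives it
  -- order $N/2$.
  by_cases hβ0 : β = 0
  · exfalso
    have hα0 : α ≠ 0 := by
      rintro h3
      have := congrArg (PowerSeries.coeff N) h1
      rw [mul_comm (axis 1 e), coeff_X_pow_mul_self] at this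
      simp [h3, hβ0] at this
      exact he this.symm
    obtain ⟨i, w, hw, hw0⟩ := exists_eq_X_pow_mul hα0
    have e1 : N ≤ i := by
      refine le_of_X_pow_dvd (w := w * (normalDeriv 1 ε * α + 2 * axis 1 ε * da))
        (by rw [map_mul]; exact mul_ne_zero hw0 hunit) ⟨normalDeriv 1 e, ?_⟩
      rw [← mul_assoc, ← hw]
      rw [hβ0] at h2
      linear_combination h2
    have e2 : 2 * i = N := by
      refine X_pow_mul_inj (w := axis 1 ε * w ^ 2) (w' := axis 1 e)
        (by rw [map_mul, map_pow]; exact mul_ne_zero hε' (pow_ne_zero _ hw0)) he' ?_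
      rw [hw, hβ0] at h1
      rw [mul_comm (PowerSeries.X ^ N), ← h1]
      ring
    omega
  · obtain ⟨j, w, hw, hw0⟩ := exists_eq_X_pow_mul hβ0
    have hj : 1 ≤ j := by
      by_contra hj
      obtain rfl : j = 0 := by omega
      rw [pow_zero, one_mul] at hw
      exact hw0 (hw ▸ hb')
    have hjβ : PowerSeries.coeff j β ≠ 0 := by rwa [hw, coeff_X_pow_mul_self]
    refine ⟨j, hj, ?_⟩
    suffices hs : N = 3 * j ∧ PowerSeries.X ^ (2 * j) ∣ α from
      ⟨hs.1, hs.2, Dvd.intro _ hw.symm, hjβ, hda⟩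
    by_cases hdvd : PowerSeries.X ^ N ∣ α
    · have hN3 : N = 3 * j := by
        obtain ⟨α', hα'⟩ := hdvd
        refine X_pow_mul_inj (w := axis 1 e - axis 1 ε * α * α') (w' := w ^ 3)
          (by simpa [ha'] using he) (by simpa using hw0) ?_
        rw [mul_comm 3 j, pow_mul, ← mul_pow, ← hw]
        linear_combination (-h1) + (axis 1 ε * α) * hα'
      exact ⟨hN3, (pow_dvd_pow _ (by omega)).trans hdvd⟩
    · have hα0 : α ≠ 0 := by rintro h3; rw [h3] at hdvd; exact hdvd (dvd_zero _)
      obtain ⟨i, w', hw', hw0'⟩ := exists_eq_X_pow_mul hα0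
      have hiN : i < N := by
        by_contra hcon
        exact hdvd ((pow_dvd_pow _ (by omega)).trans (Dvd.intro _ hw'.symm))
      -- In the derivative, $\alpha$ occurs with a unit factor and $\beta$ through $\beta^2$; a
      -- lower order of $\alpha$ could not cancel. Then $\alpha^2$ has order at least $4j$ and
      -- $\beta^3$ alone determines $N=3j$.
      have hij : 2 * j ≤ i := by
        by_contra hcon
        have : i + 1 ≤ i := by
          refine le_of_X_pow_dvd (w := w' * (normalDeriv 1 ε * α + 2 * axis 1 ε * da))
            (by rw [map_mul]; exact mul_ne_zero hw0' hunit) ?_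
          rw [← mul_assoc, ← hw']
          have e3 : α * (normalDeriv 1 ε * α + 2 * axis 1 ε * da)
              = normalDeriv 1 e * PowerSeries.X ^ N - 3 * β ^ 2 * normalDeriv 1 b := by
            linear_combination h2
          rw [e3]
          refine dvd_sub ((pow_dvd_pow _ (by omega)).mul_left _) ?_
          refine Dvd.dvd.mul_right (Dvd.dvd.mul_left ?_ _) _
          rw [hw, mul_pow, ← pow_mul]
          exact (pow_dvd_pow _ (by omega)).mul_right _
        omega
      refine ⟨?_, (pow_dvd_pow _ hij).trans (Dvd.intro _ hw'.symm)⟩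
      obtain ⟨r, rfl⟩ : ∃ r, i = 2 * j + r := ⟨i - 2 * j, by omega⟩
      refine X_pow_mul_inj (w := axis 1 e)
        (w' := w ^ 3 + axis 1 ε * PowerSeries.X ^ (j + 2 * r) * w' ^ 2)
        he' (by simpa [show j ≠ 0 by omega] using hw0) ?_
      rw [mul_comm (PowerSeries.X ^ N), ← h1, hw, hw']
      ring

/-- The number `k` such that, when a cuspidal germ of the given type is written in normal
coordinates as `b ^ 3 + ε a ^ 2`, the ideal `(a, b)` is `(u, v ^ k)`. -/
def SimpleType.cuspOrder : SimpleType → ℕ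
  | A n => (n + 1) / 3
  | E6 => 2
  | _ => 0

/-- Decompositions `b ^ 3 + ε a ^ 2` of simple germs: the type is cuspidal, and the ideal `(a, b)`
depends only on the germ. -/
lemma cube_add_sq_eq_normalForm {τ : SimpleType} (hτ : τ.Valid) {a b e ε : Series}
    (ha : MvPowerSeries.constantCoeff a = 0) (hb : MvPowerSeries.constantCoeff b = 0)
    (he : MvPowerSeries.constantCoeff e ≠ 0) (hε : MvPowerSeries.constantCoeff ε ≠ 0)
    (h : b ^ 3 + ε * a ^ 2 = e * τ.normalForm) :
    τ.IsCuspidal ∧ 1 ≤ τ.cuspOrder ∧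
      ∀ F, F ∈ Ideal.span {a, b} ↔ PowerSeries.X ^ τ.cuspOrder ∣ axis 1 F := by
  have hε' : ∀ i, PowerSeries.constantCoeff (axis i ε) ≠ 0 := fun _ => by simpa using hε
  have he' : ∀ i, PowerSeries.constantCoeff (axis i e) ≠ 0 := fun _ => by simpa using he
  have hax : ∀ i, axis i b ^ 3 + axis i ε * axis i a ^ 2 = axis i e * axis i τ.normalForm := by
    intro i; simpa using congrArg (axis i) h
  -- For the germs with $u^3$ along $v=0$ the roles are exchanged: $b$, not $a$, carries the linear
  -- term in $u$.
  have hE : axis 0 τ.normalForm = PowerSeries.X ^ 3 →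
      PowerSeries.constantCoeff (normalDeriv 1 a) = 0 ∧
      PowerSeries.constantCoeff (normalDeriv 1 b) ≠ 0 := by
    intro h3
    have h0 := hax 0
    rw [h3] at h0
    obtain ⟨α, hα⟩ := X_sq_dvd_of_cube_add_sq (hε' 0) (X_dvd_axis 0 ha) (X_dvd_axis 0 hb)
      (by rw [h0]; exact dvd_mul_left _ _)
    obtain ⟨β, hβ⟩ := X_dvd_axis 0 hb
    rw [constantCoeff_normalDeriv, constantCoeff_normalDeriv, show (Fin.rev 1 : Fin 2) = 0 from rfl,
      hα, hβ]
    refine ⟨PowerSeries.X_pow_dvd_iff.mp (Dvd.intro _ rfl) 1 (by norm_num), ?_⟩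
    rw [show (1 : ℕ) = 0 + 1 from rfl, PowerSeries.coeff_succ_X_mul,
      PowerSeries.coeff_zero_eq_constantCoeff_apply]
    intro h4
    rw [hα, hβ] at h0
    have h1 : PowerSeries.X ^ 3 * (β ^ 3 + PowerSeries.X * axis 0 ε * α ^ 2)
        = PowerSeries.X ^ 3 * axis 0 e := by linear_combination h0
    have h2 := congrArg PowerSeries.constantCoeff
      (mul_left_cancel₀ (pow_ne_zero 3 PowerSeries.X_ne_zero) h1)
    simp [h4] at h2
    exact he h2.symm
  cases τ with
  | A n =>
    obtain ⟨k, hk, hNk, hα, hβ, hβk, hda⟩ := cube_add_sq_eq_A ha hb he hε (by omega) h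
    have hk' : (SimpleType.A n).cuspOrder = k := by simp only [SimpleType.cuspOrder]; omega
    refine ⟨⟨k, hNk⟩, hk' ▸ hk, fun F => ?_⟩
    rw [hk']
    have hα' : PowerSeries.X ^ k ∣ axis 1 a := (pow_dvd_pow _ (by omega)).trans hα
    refine ⟨X_pow_dvd_axis_of_mem_span hα' hβ, mem_span_pair_of_jacobian hk hα' hβ ?_⟩
    -- The order of $a$ along $u=0$ is at least $2k>k$, so the Jacobian is $a_u$ times the
    -- $v^k$-coefficient of $b$.
    rw [PowerSeries.X_pow_dvd_iff.mp hα k (by omega), zero_mul, sub_zero]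
    exact mul_ne_zero hda hβk
  | D n =>
    exfalso
    have hn : 4 ≤ n := hτ
    -- The form $D_n$ vanishes along $v=0$, so $a,b$ have orders at least $3,2$ there. The
    -- $v$-derivative then has order at least $3$, but it is a unit times $u^2$.
    have h0 := hax 0
    simp only [SimpleType.normalForm, map_add, map_mul, map_pow, axis_X_self, axis_zero_X_one,
      mul_zero, zero_pow (show n - 1 ≠ 0 by omega), add_zero] at h0
    obtain ⟨α, hα⟩ := X_cube_dvd_of_cube_add_sq (hε' 0) (X_dvd_axis 0 ha) (X_dvd_axis 0 hb)
      (by rw [h0]; exact dvd_zero _)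
    obtain ⟨β, hβ⟩ := X_sq_dvd_of_cube_add_sq' (hε' 0) (X_dvd_axis 0 ha) (X_dvd_axis 0 hb)
      (by rw [h0]; exact dvd_zero _)
    have h2 := congrArg (normalDeriv 0) h
    obtain ⟨m, rfl⟩ : ∃ m, n = m + 3 := ⟨n - 3, by omega⟩
    rw [normalDeriv_cube_add_sq, SimpleType.normalForm, show m + 3 - 1 = m + 1 + 1 by omega,
      normalDeriv_mul, normalDeriv_add, normalDeriv_mul, pow_succ (MvPowerSeries.X 1),
      normalDeriv_mul, hα, hβ] at h2
    simp only [map_add, map_mul, map_pow, axis_X_self, axis_zero_X_one, mul_zero,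
      normalDeriv_zero_X_one, zero_pow (show m + 1 ≠ 0 by omega), normalDeriv_X_self_pow,
      zero_add, add_zero, mul_one] at h2
    have h3 : PowerSeries.X ^ (2 + 1) ∣ PowerSeries.X ^ 2 * axis 0 e := by
      rw [mul_comm, ← h2]
      exact ⟨3 * PowerSeries.X * β ^ 2 * normalDeriv 0 b + normalDeriv 0 ε * PowerSeries.X ^ 3
        * α ^ 2 + 2 * axis 0 ε * α * normalDeriv 0 a, by ring⟩
    have := le_of_X_pow_dvd (he' 0) h3
    omega
  | E6 =>
    obtain ⟨hda, hdb⟩ := hE (by simp [SimpleType.normalForm])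
    have h1 := hax 1
    simp only [SimpleType.normalForm, map_add, map_pow, axis_X_self, axis_one_X_zero,
      zero_pow three_ne_zero, zero_add] at h1
    have hα := X_sq_dvd_of_cube_add_sq (hε' 1) (X_dvd_axis 1 ha) (X_dvd_axis 1 hb)
      (by rw [h1]; exact (pow_dvd_pow _ (by norm_num)).mul_left _)
    have hβ := X_sq_dvd_of_cube_add_sq' (hε' 1) (X_dvd_axis 1 ha) (X_dvd_axis 1 hb)
      (by rw [h1]; exact (pow_dvd_pow _ (by norm_num)).mul_left _)
    refine ⟨trivial, by simp [SimpleType.cuspOrder], fun F => ⟨X_pow_dvd_axis_of_mem_span hα hβ,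
      mem_span_pair_of_jacobian (by simp) hα hβ ?_⟩⟩
    rw [hda, zero_mul, zero_sub, neg_ne_zero]
    refine mul_ne_zero ?_ hdb
    obtain ⟨α, hα⟩ := hα
    obtain ⟨β, hβ⟩ := hβ
    change PowerSeries.coeff 2 (axis 1 a) ≠ 0
    rw [hα, coeff_X_pow_mul_self]
    intro h4
    rw [hα, hβ] at h1
    have h5 : PowerSeries.X ^ 4 * (PowerSeries.X ^ 2 * β ^ 3 + axis 1 ε * α ^ 2)
        = PowerSeries.X ^ 4 * axis 1 e := by linear_combination h1
    have h2 := congrArg PowerSeries.constantCoeff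
      (mul_left_cancel₀ (pow_ne_zero 4 PowerSeries.X_ne_zero) h5)
    simp [h4] at h2
    exact he h2.symm
  | E7 =>
    exfalso
    obtain ⟨hda, -⟩ := hE (by simp [SimpleType.normalForm])
    have h1 := hax 1
    simp only [SimpleType.normalForm, map_add, map_mul, map_pow, axis_X_self, axis_one_X_zero,
      zero_mul, zero_pow three_ne_zero, add_zero, mul_zero] at h1
    obtain ⟨α, hα⟩ := X_cube_dvd_of_cube_add_sq (hε' 1) (X_dvd_axis 1 ha) (X_dvd_axis 1 hb)
      (by rw [h1]; exact dvd_zero _)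
    obtain ⟨β, hβ⟩ := X_sq_dvd_of_cube_add_sq' (hε' 1) (X_dvd_axis 1 ha) (X_dvd_axis 1 hb)
      (by rw [h1]; exact dvd_zero _)
    -- As for $D_n$, along $u=0$: since $a_u$ vanishes at the point, the $u$-derivative has order at
    -- least $4$, against $uv^3$.
    obtain ⟨δ, hδ⟩ := PowerSeries.X_dvd_iff.mpr hda
    have h2 := congrArg (normalDeriv 1) h
    rw [normalDeriv_cube_add_sq, SimpleType.normalForm, normalDeriv_mul, normalDeriv_add,
      normalDeriv_mul, normalDeriv_pow_three, hα, hβ, hδ] at h2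
    simp only [map_add, map_mul, map_pow, axis_X_self, axis_one_X_zero, mul_zero, zero_mul,
      normalDeriv_one_X_zero, zero_pow three_ne_zero, zero_pow two_ne_zero,
      zero_add, add_zero, mul_one, one_mul] at h2
    have h3 : PowerSeries.X ^ (3 + 1) ∣ PowerSeries.X ^ 3 * axis 1 e := by
      rw [mul_comm, ← h2]
      exact ⟨3 * β ^ 2 * normalDeriv 1 b + normalDeriv 1 ε * PowerSeries.X ^ 2
        * α ^ 2 + 2 * axis 1 ε * α * δ, by ring⟩
    have := le_of_X_pow_dvd (he' 1) h3
    omega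
  | E8 =>
    exfalso
    have h1 := hax 1
    simp only [SimpleType.normalForm, map_add, map_pow, axis_X_self, axis_one_X_zero,
      zero_pow three_ne_zero, zero_add] at h1
    obtain ⟨α, hα⟩ := X_cube_dvd_of_cube_add_sq (hε' 1) (X_dvd_axis 1 ha) (X_dvd_axis 1 hb)
      (by rw [h1]; exact (pow_dvd_pow _ (by norm_num)).mul_left _)
    obtain ⟨β, hβ⟩ := X_sq_dvd_of_cube_add_sq' (hε' 1) (X_dvd_axis 1 ha) (X_dvd_axis 1 hb)
      (by rw [h1]; exact (pow_dvd_pow _ (by norm_num)).mul_left _)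
    -- Cube and square have order at least $6$ along $u=0$, against $v^5$.
    have h3 : PowerSeries.X ^ (5 + 1) ∣ PowerSeries.X ^ 5 * axis 1 e := by
      rw [mul_comm, ← h1, hα, hβ]
      exact ⟨β ^ 3 + axis 1 ε * α ^ 2, by ring⟩
    have := le_of_X_pow_dvd (he' 1) h3
    omega
end SemiTorus

/-! ### Factorizations of germs of type $A_n$ and $E_6$ -/

namespace SemiTorus
open MvPolynomial

/-- A factorization of a germ of type `A_{N-1}`: both factors are smooth and tangent to `u = 0`,
and have contact `N / 2` with each other and with `u = 0`. -/
lemma mul_eq_A {x y e : Series} (hx : MvPowerSeries.constantCoeff x = 0)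
    (hy : MvPowerSeries.constantCoeff y = 0) (he : MvPowerSeries.constantCoeff e ≠ 0)
    {N : ℕ} (hN : 1 ≤ N)
    (h : x * y = e * (MvPowerSeries.X 0 ^ 2 + MvPowerSeries.X 1 ^ N)) :
    ∃ i, 1 ≤ i ∧ N = 2 * i ∧ PowerSeries.X ^ i ∣ axis 1 x ∧ PowerSeries.X ^ i ∣ axis 1 y ∧
      PowerSeries.coeff i (axis 1 x) ≠ 0 ∧ PowerSeries.coeff i (axis 1 y) ≠ 0 ∧
      PowerSeries.constantCoeff (normalDeriv 1 x) ≠ 0 ∧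
      PowerSeries.constantCoeff (normalDeriv 1 y) ≠ 0 ∧
      PowerSeries.constantCoeff (normalDeriv 1 x) * PowerSeries.coeff i (axis 1 y)
        + PowerSeries.coeff i (axis 1 x) * PowerSeries.constantCoeff (normalDeriv 1 y) = 0 := by
  -- Along $v=0$ the product has order exactly two, so each factor has order one.
  have hd : PowerSeries.constantCoeff (normalDeriv 1 x) ≠ 0 ∧
      PowerSeries.constantCoeff (normalDeriv 1 y) ≠ 0 := by
    have h0 := congrArg (axis 0) h
    obtain ⟨α, hα⟩ := X_dvd_axis 0 hx
    obtain ⟨β, hβ⟩ := X_dvd_axis 0 hy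
    simp only [map_add, map_mul, map_pow, axis_X_self, axis_zero_X_one, hα, hβ,
      zero_pow (show N ≠ 0 by omega), add_zero] at h0
    have h1 : PowerSeries.X ^ 2 * (α * β) = PowerSeries.X ^ 2 * axis 0 e := by
      linear_combination h0
    have h2 := congrArg PowerSeries.constantCoeff
      (mul_left_cancel₀ (pow_ne_zero 2 PowerSeries.X_ne_zero) h1)
    rw [map_mul, constantCoeff_axis] at h2
    have h3 := h2.trans_ne he
    rw [constantCoeff_normalDeriv, constantCoeff_normalDeriv, show (Fin.rev 1 : Fin 2) = 0 from rfl,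
      hα, hβ, show (1 : ℕ) = 0 + 1 from rfl, PowerSeries.coeff_succ_X_mul,
      PowerSeries.coeff_succ_X_mul, PowerSeries.coeff_zero_eq_constantCoeff_apply,
      PowerSeries.coeff_zero_eq_constantCoeff_apply]
    exact ⟨left_ne_zero_of_mul h3, right_ne_zero_of_mul h3⟩
  obtain ⟨hdx, hdy⟩ := hd
  have h1 : axis 1 x * axis 1 y = axis 1 e * PowerSeries.X ^ N := by
    simpa using congrArg (axis 1) h
  have h2 := congrArg (normalDeriv 1) h
  rw [normalDeriv_mul, normalDeriv_mul, normalDeriv_add, normalDeriv_pow_two,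
    normalDeriv_X_self_pow] at h2
  simp only [map_add, map_pow, axis_X_self, axis_one_X_zero, mul_zero, zero_mul, add_zero,
    zero_pow two_ne_zero, zero_add] at h2
  have he' : PowerSeries.constantCoeff (axis 1 e) ≠ 0 := by simpa using he
  have hx' : PowerSeries.constantCoeff (axis 1 x) = 0 := by simpa using hx
  have hy' : PowerSeries.constantCoeff (axis 1 y) = 0 := by simpa using hy
  have hne : axis 1 x * axis 1 y ≠ 0 := by
    rw [h1]
    refine mul_ne_zero (fun h3 => he' (by rw [h3, map_zero])) (pow_ne_zero _ PowerSeries.X_ne_zero)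
  obtain ⟨i, w, hw, hw0⟩ := exists_eq_X_pow_mul (left_ne_zero_of_mul hne)
  obtain ⟨j, z, hz, hz0⟩ := exists_eq_X_pow_mul (right_ne_zero_of_mul hne)
  have hi : 1 ≤ i := by
    by_contra hi
    obtain rfl : i = 0 := by omega
    rw [pow_zero, one_mul] at hw
    exact hw0 (hw ▸ hx')
  have hj : 1 ≤ j := by
    by_contra hi
    obtain rfl : j = 0 := by omega
    rw [pow_zero, one_mul] at hz
    exact hz0 (hz ▸ hy')
  have hij : i + j = N := by
    refine X_pow_mul_inj (w := w * z) (w' := axis 1 e) (by simpa using ⟨hw0, hz0⟩) he' ?_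
    rw [mul_comm (PowerSeries.X ^ N), ← h1, hw, hz]
    ring
  -- In $x_uy+xy_u$, of order at least $N=i+j$, unequal orders of $x$ and $y$ would leave the lower
  -- term uncancelled.
  have hji : j ≤ i := by
    by_contra hcon
    have : i + 1 ≤ i := by
      refine le_of_X_pow_dvd (w := w * normalDeriv 1 y) (by simpa using ⟨hw0, hdy⟩) ?_
      have e3 : PowerSeries.X ^ i * (w * normalDeriv 1 y)
          = normalDeriv 1 e * PowerSeries.X ^ N - normalDeriv 1 x * axis 1 y := by
        rw [← mul_assoc, ← hw]; linear_combination h2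
      rw [e3, hz]
      exact dvd_sub ((pow_dvd_pow _ (by omega)).mul_left _)
        (((pow_dvd_pow _ (by omega)).mul_right _).mul_left _)
    omega
  have hij' : i ≤ j := by
    by_contra hcon
    have : j + 1 ≤ j := by
      refine le_of_X_pow_dvd (w := z * normalDeriv 1 x) (by simpa using ⟨hz0, hdx⟩) ?_
      have e3 : PowerSeries.X ^ j * (z * normalDeriv 1 x)
          = normalDeriv 1 e * PowerSeries.X ^ N - axis 1 x * normalDeriv 1 y := by
        rw [← mul_assoc, ← hz]; linear_combination h2
      rw [e3, hw]
      exact dvd_sub ((pow_dvd_pow _ (by omega)).mul_left _)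
        (((pow_dvd_pow _ (by omega)).mul_right _).mul_right _)
    omega
  obtain rfl : i = j := le_antisymm hij' hji
  refine ⟨i, hi, by omega, Dvd.intro _ hw.symm, Dvd.intro _ hz.symm, ?_, ?_, hdx, hdy, ?_⟩
  · rwa [hw, coeff_X_pow_mul_self]
  · rwa [hz, coeff_X_pow_mul_self]
  · rw [hw, hz, coeff_X_pow_mul_self, coeff_X_pow_mul_self]
    rw [hw, hz] at h2
    -- The $u$-derivative divided by $v^i$; its right side still vanishes at the point because
    -- $N=2i$.
    have e4 : PowerSeries.X ^ i * (normalDeriv 1 x * z + w * normalDeriv 1 y)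
        = PowerSeries.X ^ i * (normalDeriv 1 e * PowerSeries.X ^ i) := by
      rw [← hij] at h2
      linear_combination h2
    have := congrArg PowerSeries.constantCoeff
      (mul_left_cancel₀ (pow_ne_zero i PowerSeries.X_ne_zero) e4)
    simpa [show i ≠ 0 by omega] using this

/-- The two factors of a germ of type `A_{N-1}` have no common divisor vanishing at the point. -/
lemma not_dvd_factors_A {x y e : Series} (hx : MvPowerSeries.constantCoeff x = 0)
    (hy : MvPowerSeries.constantCoeff y = 0) (he : MvPowerSeries.constantCoeff e ≠ 0)
    {N : ℕ} (hN : 1 ≤ N)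
    (h : x * y = e * (MvPowerSeries.X 0 ^ 2 + MvPowerSeries.X 1 ^ N))
    {w : Series} (hw : MvPowerSeries.constantCoeff w = 0) (hwx : w ∣ x) : ¬ w ∣ y := by
  intro hwy
  obtain ⟨i, hi, hNi, h1, h2, h3, h4, h5, h6, h7⟩ := mul_eq_A hx hy he hN h
  obtain ⟨p, rfl⟩ := hwx
  obtain ⟨q, rfl⟩ := hwy
  have hw' : PowerSeries.constantCoeff (axis 1 w) = 0 := by simpa using hw
  have hd : ∀ r, PowerSeries.constantCoeff (normalDeriv 1 (w * r)) =
      PowerSeries.constantCoeff (normalDeriv 1 w) * PowerSeries.constantCoeff (axis 1 r) := by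
    intro r
    rw [normalDeriv_mul, map_add, map_mul, map_mul, hw', zero_mul, add_zero]
  rw [hd] at h5 h6 h7
  rw [hd] at h7
  have hp := right_ne_zero_of_mul h5
  have hpu : IsUnit (axis 1 p) := by
    rw [PowerSeries.isUnit_iff_constantCoeff]; exact isUnit_iff_ne_zero.mpr hp
  rw [map_mul] at h1
  obtain ⟨z, hz⟩ := (hpu.dvd_mul_right).mp h1
  have hc : ∀ r, PowerSeries.coeff i (axis 1 (w * r)) =
      PowerSeries.constantCoeff z * PowerSeries.constantCoeff (axis 1 r) := by
    intro r
    rw [map_mul, hz, mul_assoc, coeff_X_pow_mul_self, map_mul]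
  rw [hc] at h3 h7
  rw [hc] at h7
  -- With a common factor $w$ the two summands of the last relation of `mul_eq_A` coincide, so they
  -- cannot cancel.
  refine (mul_ne_zero (mul_ne_zero two_ne_zero h6) h3) ?_
  linear_combination h7

/-- A germ of type `E_6` is irreducible. -/
lemma mul_ne_E6 {x y e : Series} (hx : MvPowerSeries.constantCoeff x = 0)
    (hy : MvPowerSeries.constantCoeff y = 0) (he : MvPowerSeries.constantCoeff e ≠ 0) :
    x * y ≠ e * (MvPowerSeries.X 0 ^ 3 + MvPowerSeries.X 1 ^ 4) := by
  intro h
  -- If neither factor had a linear term in $u$, the product would have order at least $4$ along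
  -- $v=0$, against $u^3$.
  wlog hdx : PowerSeries.constantCoeff (normalDeriv 1 x) ≠ 0 generalizing x y
  · refine this hy hx (by rw [mul_comm, h]) ?_
    intro hdy
    have h0 := congrArg (axis 0) h
    push Not at hdx
    rw [constantCoeff_normalDeriv, show (Fin.rev 1 : Fin 2) = 0 from rfl] at hdx hdy
    have key : ∀ z : PowerSeries ℂ, PowerSeries.constantCoeff z = 0 → PowerSeries.coeff 1 z = 0 →
        PowerSeries.X ^ 2 ∣ z := by
      intro z h1 h2
      rw [PowerSeries.X_pow_dvd_iff]
      intro m hm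
      interval_cases m
      · simpa using h1
      · exact h2
    have h4 : PowerSeries.X ^ (3 + 1) ∣ PowerSeries.X ^ 3 * axis 0 e := by
      have := mul_dvd_mul (key _ (by simpa using hx) hdx) (key _ (by simpa using hy) hdy)
      rw [← map_mul, h] at this
      simp only [map_add, map_mul, map_pow, axis_X_self, axis_zero_X_one] at this
      convert this using 1 <;> ring
    have := le_of_X_pow_dvd (by simpa using he) h4
    omega
  have h0 := congrArg (axis 0) h
  have h1 := congrArg (axis 1) h
  have hd0 := congrArg (normalDeriv 0) h
  have hd1 := congrArg (normalDeriv 1) h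
  rw [normalDeriv_mul, normalDeriv_mul, normalDeriv_add, normalDeriv_pow_three,
    normalDeriv_X_self_pow] at hd1
  rw [normalDeriv_mul, normalDeriv_mul, normalDeriv_add, normalDeriv_X_self_pow,
    show (4 : ℕ) = 2 * 2 from rfl, pow_mul,
    normalDeriv_pow_two] at hd0
  simp only [map_add, map_mul, map_pow, axis_X_self, axis_one_X_zero, axis_zero_X_one, mul_zero,
    zero_mul, add_zero, zero_pow two_ne_zero, zero_pow three_ne_zero, zero_add,
    zero_pow four_ne_zero] at h0 h1 hd0 hd1
  -- The coefficient of $uv$ in $y$ can be read on either axis.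
  have hxy : PowerSeries.coeff 1 (normalDeriv 0 y) = PowerSeries.coeff 1 (normalDeriv 1 y) := by
    simp [normalDeriv, MvPowerSeries.coeff_pderiv, add_comm]
  have hdx0 : PowerSeries.constantCoeff (normalDeriv 0 x) = PowerSeries.coeff 1 (axis 1 x) :=
    constantCoeff_normalDeriv 0 x
  have hdy0 : PowerSeries.constantCoeff (normalDeriv 0 y) = PowerSeries.coeff 1 (axis 1 y) :=
    constantCoeff_normalDeriv 0 y
  rw [constantCoeff_normalDeriv, show (Fin.rev 1 : Fin 2) = 0 from rfl] at hdx
  have hdy1 : PowerSeries.constantCoeff (normalDeriv 1 y) = PowerSeries.coeff 1 (axis 0 y) :=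
    constantCoeff_normalDeriv 1 y
  have hdx1 : PowerSeries.constantCoeff (normalDeriv 1 x) = PowerSeries.coeff 1 (axis 0 x) :=
    constantCoeff_normalDeriv 1 x
  have hx0 : ∀ i, PowerSeries.coeff 0 (axis i x) = 0 := fun _ => by simpa using hx
  have hy0 : ∀ i, PowerSeries.coeff 0 (axis i y) = 0 := fun _ => by simpa using hy
  have he0 : PowerSeries.coeff 0 (axis 1 e) ≠ 0 := by simpa using he
  have he0' : PowerSeries.coeff 0 (axis 0 e) ≠ 0 := by simpa using he
  rw [← PowerSeries.coeff_zero_eq_constantCoeff_apply] at hdx0 hdy0 hdy1 hdx1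
  -- Coefficients of $u^2,u^3,v^3,v^4,uv,uv^2,u^2v$; on the right only those of $u^3$ and $v^4$ are
  -- nonzero.
  have a2 := congrArg (PowerSeries.coeff 2) h0
  have a3 := congrArg (PowerSeries.coeff 3) h0
  have b3 := congrArg (PowerSeries.coeff 3) h1
  have b4 := congrArg (PowerSeries.coeff 4) h1
  have d1 := congrArg (PowerSeries.coeff 1) hd1
  have d2 := congrArg (PowerSeries.coeff 2) hd1
  have f2 := congrArg (PowerSeries.coeff 2) hd0
  simp only [map_add, PowerSeries.coeff_mul, PowerSeries.coeff_X_pow,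
    Finset.Nat.antidiagonal_succ, Finset.Nat.antidiagonal_zero] at a2 a3 b3 b4 d1 d2 f2
  simp [hx0, hy0, -coeff_axis, -PowerSeries.coeff_zero_eq_constantCoeff] at a2 a3 b3 b4 d1 d2 f2
  have hy01 := a2.resolve_left hdx
  rw [hdx1, hdy1, hy01, mul_zero, add_zero] at d1
  have hy11 := (mul_eq_zero.mp d1).resolve_left hdx
  rw [hy01, mul_zero, add_zero] at a3
  have hy02 := right_ne_zero_of_mul (a3.trans_ne he0')
  rw [hy11, mul_zero, add_zero] at b3 b4
  rw [hdx1, hdy1, hy01, hy11, mul_zero, mul_zero, add_zero, add_zero] at d2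
  rw [hdx0, hdy0, hy01, hy11, mul_zero, mul_zero, add_zero, add_zero, hxy] at f2
  -- Without a $v$-term in $x$, the $v^2$-term of $y$ vanishes and $v^4$ cannot appear; with one,
  -- the coefficient of $u^2v$ is nonzero.
  by_cases hx11 : PowerSeries.coeff 1 (axis 1 x) = 0
  · rw [hx11, zero_mul, add_zero] at d2
    rw [hx11, zero_mul, zero_add, (mul_eq_zero.mp d2).resolve_left hdx, mul_zero] at b4
    exact he0 b4.symm
  · rw [(mul_eq_zero.mp b3).resolve_left hx11, mul_zero, zero_add] at d2
    rw [(mul_eq_zero.mp d2).resolve_left hx11, mul_zero, add_zero] at f2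
    exact mul_ne_zero hx11 hy02 f2
end SemiTorus

namespace SemiTorus
open MvPolynomial

/-! ### Linear changes of coordinates -/

/-- The linear change of coordinates with matrix `M`. -/
noncomputable def lin (M : Matrix (Fin 3) (Fin 3) ℂ) : Form →ₐ[ℂ] Form :=
  aeval fun i => ∑ j, C (M i j) * X j

lemma aeval_lin {B : Type*} [CommRing B] [Algebra ℂ B] (M : Matrix (Fin 3) (Fin 3) ℂ)
    (y : Fin 3 → B) (G : Form) :
    aeval y (lin M G) = aeval (fun i => ∑ j, algebraMap ℂ B (M i j) * y j) G := by
  have : (aeval y).comp (lin M) = aeval (fun i => ∑ j, algebraMap ℂ B (M i j) * y j) := by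
    ext i; simp [lin]
  exact DFunLike.congr_fun this G

lemma eval_lin (M : Matrix (Fin 3) (Fin 3) ℂ) (x : Fin 3 → ℂ) (G : Form) :
    eval x (lin M G) = eval (M.mulVec x) G := by
  have := aeval_lin M x G
  rw [aeval_eq_eval] at this
  exact this

lemma lin_lin (M N : Matrix (Fin 3) (Fin 3) ℂ) (G : Form) :
    lin M (lin N G) = lin (N * M) G := by
  have : (lin M).comp (lin N) = lin (N * M) := by
    ext1 i
    simp only [lin, AlgHom.comp_apply, aeval_X, map_sum, map_mul, aeval_C, algebraMap_eq,
      Matrix.mul_apply, Finset.mul_sum, Finset.sum_mul, mul_assoc]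
    exact Finset.sum_comm
  exact DFunLike.congr_fun this G

lemma lin_one (G : Form) : lin 1 G = G := by
  have : lin 1 = AlgHom.id ℂ Form := by
    ext1 i
    simp [lin, Matrix.one_apply]
  exact DFunLike.congr_fun this G

lemma lin_inv_lin {M : Matrix (Fin 3) (Fin 3) ℂ} (hM : M.det ≠ 0) (G : Form) :
    lin M⁻¹ (lin M G) = G := by
  rw [lin_lin, Matrix.mul_nonsing_inv _ (isUnit_iff_ne_zero.mpr hM), lin_one]

lemma lin_isHomogeneous {G : Form} {d : ℕ} (hG : G.IsHomogeneous d)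
    (M : Matrix (Fin 3) (Fin 3) ℂ) : (lin M G).IsHomogeneous d := by
  have := hG.aeval (fun i => ∑ j, C (M i j) * X j) (n := 1)
    (fun i => IsHomogeneous.sum _ _ _ fun j _ => isHomogeneous_C_mul_X _ _)
  simpa [lin] using this

lemma aeval_mul_of_isHomogeneous {B σ : Type*} [CommRing B] [Algebra ℂ B]
    {G : MvPolynomial σ ℂ} {d : ℕ}
    (hG : G.IsHomogeneous d) (c : B) (y : σ → B) :
    aeval (fun i => c * y i) G = c ^ d * aeval y G := by
  rw [aeval_def, aeval_def, eval₂_eq, eval₂_eq, Finset.mul_sum]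
  refine Finset.sum_congr rfl fun m hm => ?_
  have hd : ∑ i ∈ m.support, m i = d := by
    have := hG (mem_support_iff.mp hm)
    rw [← this, Finsupp.weight_apply, Finsupp.sum]; simp
  rw [← hd, ← Finset.prod_pow_eq_pow_sum]
  simp only [mul_pow, Finset.prod_mul_distrib]
  ring

lemma eval_smul_of_isHomogeneous {σ : Type*} {G : MvPolynomial σ ℂ} {d : ℕ}
    (hG : G.IsHomogeneous d) (c : ℂ) (x : σ → ℂ) : eval (c • x) G = c ^ d * eval x G := by
  have := aeval_mul_of_isHomogeneous hG c x
  simpa [aeval_eq_eval, Pi.smul_def] using this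

/-! ### Normalized local coordinates -/

/-- Local coordinates at `(1 : 0 : 0)` whose linear parts are the two affine coordinates. -/
structure IsStdParam (Ψ : Fin 3 → Series) : Prop where
  const : ∀ i, MvPowerSeries.constantCoeff (Ψ i) = ![1, 0, 0] i
  fst : ∀ i, MvPowerSeries.coeff (Finsupp.single 0 1) (Ψ i) = ![0, 1, 0] i
  snd : ∀ i, MvPowerSeries.coeff (Finsupp.single 1 1) (Ψ i) = ![0, 0, 1] i

/-- The columns of $M$ are the representative of $P$ and the two first derivatives of $\Phi$, and
$\Psi=M^{-1}\Phi$. The last column is recorded because it is the tangent direction of $u=0$. -/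
lemma exists_isStdParam {P : Plane} {Φ : Fin 3 → Series} (h : IsLocalParam P Φ) :
    ∃ (M : Matrix (Fin 3) (Fin 3) ℂ) (Ψ : Fin 3 → Series), M.det ≠ 0 ∧
      M.mulVec ![1, 0, 0] = P.rep ∧ IsStdParam Ψ ∧
      M.mulVec ![0, 0, 1] = (fun i => MvPowerSeries.coeff (Finsupp.single 1 1) (Φ i)) ∧
      ∀ G, aeval Φ G = aeval Ψ (lin M G) := by
  obtain ⟨h0, hdet⟩ := h
  set N := Matrix.of ![P.rep,
      fun i => MvPowerSeries.coeff (Finsupp.single 0 1) (Φ i),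
      fun i => MvPowerSeries.coeff (Finsupp.single 1 1) (Φ i)] with hN
  have hdet' : N.transpose.det ≠ 0 := by rwa [Matrix.det_transpose]
  have e0 : N.transpose.mulVec ![1, 0, 0] = P.rep := by
    ext i; simp [hN, Matrix.mulVec, dotProduct, Fin.sum_univ_three]
  have e1 : N.transpose.mulVec ![0, 1, 0] =
      (fun i => MvPowerSeries.coeff (Finsupp.single 0 1) (Φ i)) := by
    ext i; simp [hN, Matrix.mulVec, dotProduct, Fin.sum_univ_three]
  have e2 : N.transpose.mulVec ![0, 0, 1] =
      (fun i => MvPowerSeries.coeff (Finsupp.single 1 1) (Φ i)) := by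
    ext i; simp [hN, Matrix.mulVec, dotProduct, Fin.sum_univ_three]
  have hinv : ∀ x y, N.transpose.mulVec x = y → (N.transpose⁻¹).mulVec y = x := by
    rintro x y rfl
    rw [Matrix.mulVec_mulVec, Matrix.nonsing_inv_mul _ (isUnit_iff_ne_zero.mpr hdet'),
      Matrix.one_mulVec]
  refine ⟨N.transpose, fun j => ∑ i, MvPowerSeries.C (N.transpose⁻¹ j i) * Φ i, hdet', e0,
    ⟨fun j => ?_, fun j => ?_, fun j => ?_⟩, e2, fun G => ?_⟩
  · rw [← hinv _ _ e0]
    simp [Matrix.mulVec, dotProduct, h0]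
  · rw [← hinv _ _ e1]
    simp [Matrix.mulVec, dotProduct]
  · rw [← hinv _ _ e2]
    simp [Matrix.mulVec, dotProduct]
  · rw [aeval_lin]
    congr 2
    ext1 i
    have : ∀ c, algebraMap ℂ Series c = MvPowerSeries.C c := fun _ => rfl
    simp only [this, Finset.mul_sum, ← mul_assoc, ← map_mul]
    rw [Finset.sum_comm]
    simp only [← Finset.sum_mul, ← map_sum]
    have h1 := Matrix.mul_nonsing_inv N.transpose (isUnit_iff_ne_zero.mpr hdet')
    have h2 : ∀ k, ∑ j, N.transpose i j * N.transpose⁻¹ j k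
        = (1 : Matrix (Fin 3) (Fin 3) ℂ) i k := fun k => by rw [← h1, Matrix.mul_apply]
    simp only [h2, Matrix.one_apply]
    simp

/-! ### Polynomials are dense in power series, for any local coordinates -/

/-- The maximal ideal of the ring of power series. -/
noncomputable def maxIdeal : Ideal Series := Ideal.span {MvPowerSeries.X 0, MvPowerSeries.X 1}

lemma X_mem_maxIdeal (i : Fin 2) : (MvPowerSeries.X i : Series) ∈ maxIdeal := by
  fin_cases i <;> exact Ideal.subset_span (by simp)

lemma mem_maxIdeal_iff {F : Series} : F ∈ maxIdeal ↔ MvPowerSeries.constantCoeff F = 0 := by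
  constructor
  · intro h
    obtain ⟨p, q, rfl⟩ := Ideal.mem_span_pair.mp h
    simp
  · intro h
    obtain ⟨F₁, F₂, rfl⟩ := exists_eq_of_X_pow_dvd_axis (F := F) (k := 1)
      (by rw [pow_one]; exact X_dvd_axis 1 h)
    rw [pow_one]
    exact Ideal.add_mem _ (Ideal.mul_mem_right _ _ (X_mem_maxIdeal 0))
      (Ideal.mul_mem_right _ _ (X_mem_maxIdeal 1))

lemma coeff_single_mul {F G : Series} (i : Fin 2) :
    MvPowerSeries.coeff (Finsupp.single i 1) (F * G) =
      MvPowerSeries.coeff (Finsupp.single i 1) F * MvPowerSeries.constantCoeff G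
        + MvPowerSeries.constantCoeff F * MvPowerSeries.coeff (Finsupp.single i 1) G := by
  simp only [← coeff_axis, map_mul, PowerSeries.coeff_mul, Finset.Nat.antidiagonal_succ,
    Finset.Nat.antidiagonal_zero, ← constantCoeff_axis i,
    ← PowerSeries.coeff_zero_eq_constantCoeff_apply]
  simp
  ring

lemma mem_maxIdeal_sq {F : Series} (h0 : MvPowerSeries.constantCoeff F = 0)
    (h : ∀ i, MvPowerSeries.coeff (Finsupp.single i 1) F = 0) : F ∈ maxIdeal ^ 2 := by
  obtain ⟨F₁, F₂, hF⟩ := exists_eq_of_X_pow_dvd_axis (F := F) (k := 1)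
    (by rw [pow_one]; exact X_dvd_axis 1 h0)
  rw [pow_one] at hF
  have h1 := h 0
  have h2 := h 1
  rw [hF, map_add, coeff_single_mul, coeff_single_mul] at h1 h2
  simp [MvPowerSeries.coeff_X, Finsupp.single_left_inj] at h1 h2
  rw [hF, pow_two]
  exact Ideal.add_mem _ (Ideal.mul_mem_mul (X_mem_maxIdeal 0) (mem_maxIdeal_iff.mpr h1))
      (Ideal.mul_mem_mul (X_mem_maxIdeal 1) (mem_maxIdeal_iff.mpr h2))

lemma order_le_of_mem_maxIdeal_pow {F : Series} {k : ℕ} (h : F ∈ maxIdeal ^ k) :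
    (k : ℕ∞) ≤ F.order := by
  induction k generalizing F with
  | zero => simp
  | succ k ih =>
    rw [pow_succ] at h
    refine Submodule.mul_induction_on h (fun x hx y hy => ?_) (fun x y hx hy => ?_)
    · refine le_trans ?_ MvPowerSeries.le_order_mul
      push_cast
      exact add_le_add (ih hx)
        (MvPowerSeries.one_le_order_iff_constCoeff_eq_zero.mpr (mem_maxIdeal_iff.mp hy))
    · exact le_trans (le_min hx hy) MvPowerSeries.min_order_le_add

section Density

variable {α : MvPolynomial (Fin 2) ℂ →ₐ[ℂ] Series}

lemma map_mem_maxIdeal_pow (hα : ∀ i, α (X i) - MvPowerSeries.X i ∈ maxIdeal ^ 2) {j : ℕ}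
    {G : MvPolynomial (Fin 2) ℂ} (hG : G ∈ idealOfVars (Fin 2) ℂ ^ j) : α G ∈ maxIdeal ^ j := by
  have h1 : Ideal.map (α : MvPolynomial (Fin 2) ℂ →+* Series) (idealOfVars (Fin 2) ℂ ^ j)
      ≤ maxIdeal ^ j := by
    rw [Ideal.map_pow]
    refine Ideal.pow_right_mono ?_ j
    rw [idealOfVars, Ideal.map_span, Ideal.span_le]
    rintro _ ⟨_, ⟨i, rfl⟩, rfl⟩
    have := Ideal.add_mem _ (Ideal.pow_le_self two_ne_zero (hα i)) (X_mem_maxIdeal i)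
    simpa using this
  exact h1 (Ideal.mem_map_of_mem (α : MvPolynomial (Fin 2) ℂ →+* Series) hG)

/-- A substitution tangent to the identity is surjective on $\mathfrak m^j/\mathfrak m^{j+1}$;
products of linear approximations give the induction. -/
lemma exists_sub_map_mem (hα : ∀ i, α (X i) - MvPowerSeries.X i ∈ maxIdeal ^ 2) (j : ℕ)
    {F : Series} (hF : F ∈ maxIdeal ^ j) :
    ∃ G ∈ idealOfVars (Fin 2) ℂ ^ j, F - α G ∈ maxIdeal ^ (j + 1) := by
  have hconst : ∀ F : Series, F - MvPowerSeries.C (MvPowerSeries.constantCoeff F) ∈ maxIdeal :=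
    fun F => mem_maxIdeal_iff.mpr (by simp)
  have hC : ∀ c, α (C c) = MvPowerSeries.C c := fun c => α.commutes c
  induction j generalizing F with
  | zero =>
    refine ⟨C (MvPowerSeries.constantCoeff F), by simp, ?_⟩
    rw [hC, zero_add, pow_one]
    exact hconst F
  | succ j ih =>
    rw [pow_succ'] at hF
    refine Submodule.mul_induction_on hF (fun F₁ hF₁ F₂ hF₂ => ?_) ?_
    · obtain ⟨G₂, hG₂, h2⟩ := ih hF₂
      obtain ⟨A, B, hAB⟩ := Ideal.mem_span_pair.mp hF₁
      let G₁ : MvPolynomial (Fin 2) ℂ := C (MvPowerSeries.constantCoeff A) * X 0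
        + C (MvPowerSeries.constantCoeff B) * X 1
      have hG₁ : G₁ ∈ idealOfVars (Fin 2) ℂ :=
        Ideal.add_mem _ (Ideal.mul_mem_left _ _ (Ideal.subset_span ⟨0, rfl⟩))
          (Ideal.mul_mem_left _ _ (Ideal.subset_span ⟨1, rfl⟩))
      have h1 : F₁ - α G₁ ∈ maxIdeal ^ 2 := by
        have e : F₁ - α G₁ =
            ((A - MvPowerSeries.C (MvPowerSeries.constantCoeff A)) * MvPowerSeries.X 0
            + (B - MvPowerSeries.C (MvPowerSeries.constantCoeff B)) * MvPowerSeries.X 1)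
            - (MvPowerSeries.C (MvPowerSeries.constantCoeff A) * (α (X 0) - MvPowerSeries.X 0)
            + MvPowerSeries.C (MvPowerSeries.constantCoeff B) * (α (X 1) - MvPowerSeries.X 1)) := by
          rw [← hAB]
          simp only [G₁, map_add, map_mul, hC]
          ring
        rw [e]
        refine Ideal.sub_mem _ (Ideal.add_mem _ ?_ ?_)
          (Ideal.add_mem _ (Ideal.mul_mem_left _ _ (hα 0)) (Ideal.mul_mem_left _ _ (hα 1)))
        · rw [pow_two]; exact Ideal.mul_mem_mul (hconst A) (X_mem_maxIdeal 0)
        · rw [pow_two]; exact Ideal.mul_mem_mul (hconst B) (X_mem_maxIdeal 1)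
      refine ⟨G₁ * G₂, by rw [pow_succ']; exact Ideal.mul_mem_mul hG₁ hG₂, ?_⟩
      have e : F₁ * F₂ - α (G₁ * G₂) = (F₁ - α G₁) * F₂ + α G₁ * (F₂ - α G₂) := by
        rw [map_mul]; ring
      rw [e]
      refine Ideal.add_mem _ ?_ ?_
      · have := Ideal.mul_mem_mul h1 hF₂
        rwa [← pow_add, show 2 + j = j + 1 + 1 by omega] at this
      · have h3 : α G₁ ∈ maxIdeal ^ 1 := map_mem_maxIdeal_pow hα (by rwa [pow_one])
        have := Ideal.mul_mem_mul h3 h2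
        rwa [← pow_add, show 1 + (j + 1) = j + 1 + 1 by omega] at this
    · rintro F₁ F₂ ⟨G₁, hG₁, h1⟩ ⟨G₂, hG₂, h2⟩
      refine ⟨G₁ + G₂, Ideal.add_mem _ hG₁ hG₂, ?_⟩
      have := Ideal.add_mem _ h1 h2
      rw [map_add]
      convert this using 1; ring

lemma exists_sub_map_mem_pow (hα : ∀ i, α (X i) - MvPowerSeries.X i ∈ maxIdeal ^ 2) (j : ℕ)
    (F : Series) : ∃ G, F - α G ∈ maxIdeal ^ j := by
  induction j with
  | zero => exact ⟨0, by simp⟩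
  | succ j ih =>
    obtain ⟨G, hG⟩ := ih
    obtain ⟨G', -, hG'⟩ := exists_sub_map_mem hα j hG
    exact ⟨G + G', by rw [map_add, ← sub_sub]; exact hG'⟩

/-- On the graded pieces $\alpha$ is the identity, so it detects the order of a polynomial. -/
lemma map_sub_coe_mem (hα : ∀ i, α (X i) - MvPowerSeries.X i ∈ maxIdeal ^ 2) (j : ℕ)
    {G : MvPolynomial (Fin 2) ℂ} (hG : G ∈ idealOfVars (Fin 2) ℂ ^ j) :
    α G - (G : Series) ∈ maxIdeal ^ (j + 1) := by
  have hcoe : ∀ i, coeToMvPowerSeries.algHom (σ := Fin 2) (R := ℂ) ℂ (X i) - (MvPowerSeries.X i : Series)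
      ∈ maxIdeal ^ 2 := by simp
  have hC : ∀ c, α (C c) = MvPowerSeries.C c := fun c => α.commutes c
  have hbase : ∀ G : MvPolynomial (Fin 2) ℂ, α G - (G : Series) ∈ maxIdeal := by
    intro G
    induction G using MvPolynomial.induction_on with
    | C c => simp [hC]
    | add p q hp hq =>
      have := Ideal.add_mem _ hp hq
      rw [map_add, coe_add]
      convert this using 1; ring
    | mul_X p i hp =>
      rw [map_mul, coe_mul, coe_X]
      have : α p * α (X i) - (p : Series) * MvPowerSeries.X i
          = α p * (α (X i) - MvPowerSeries.X i) + (α p - (p : Series)) * MvPowerSeries.X i := by ring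
      rw [this]
      exact Ideal.add_mem _ (Ideal.mul_mem_left _ _ (Ideal.pow_le_self two_ne_zero (hα i)))
        (Ideal.mul_mem_right _ _ hp)
  induction j generalizing G with
  | zero => simpa using hbase G
  | succ j ih =>
    rw [pow_succ'] at hG
    refine Submodule.mul_induction_on hG (fun G₁ hG₁ G₂ hG₂ => ?_) (fun G₁ G₂ h1 h2 => ?_)
    · have h1 : α G₁ - (G₁ : Series) ∈ maxIdeal ^ 2 := by
        refine Submodule.span_induction ?_ (by simp) ?_ ?_ hG₁
        · rintro _ ⟨i, rfl⟩
          simpa using hα i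
        · intro p q _ _ hp hq
          have := Ideal.add_mem _ hp hq
          rw [map_add, coe_add]
          convert this using 1; ring
        · intro p q hq' hq
          rw [smul_eq_mul, map_mul, coe_mul]
          have : α p * α q - (p : Series) * q = α p * (α q - (q : Series)) + (α p - (p : Series)) * q := by ring
          rw [this, pow_two]
          have hq1 : (q : Series) ∈ maxIdeal := by
            have := map_mem_maxIdeal_pow (j := 1) hcoe (by rw [pow_one]; exact hq')
            simpa using this
          refine Ideal.add_mem _ (Ideal.mul_mem_left _ _ (by rwa [← pow_two]))
            (Ideal.mul_mem_mul (hbase p) hq1)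
      have e : α (G₁ * G₂) - ((G₁ * G₂ : MvPolynomial (Fin 2) ℂ) : Series)
          = (α G₁ - G₁) * α G₂ + (G₁ : Series) * (α G₂ - G₂) := by
        rw [map_mul, coe_mul]; ring
      rw [e]
      refine Ideal.add_mem _ ?_ ?_
      · have := Ideal.mul_mem_mul h1 (map_mem_maxIdeal_pow hα hG₂)
        rwa [← pow_add, show 2 + j = j + 1 + 1 by omega] at this
      · have h3 : (G₁ : Series) ∈ maxIdeal ^ 1 := by
          have := map_mem_maxIdeal_pow (j := 1) hcoe (by rw [pow_one]; exact hG₁)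
          simpa using this
        have := Ideal.mul_mem_mul h3 (ih hG₂)
        rwa [← pow_add, show 1 + (j + 1) = j + 1 + 1 by omega] at this
    · have := Ideal.add_mem _ h1 h2
      rw [map_add, coe_add]
      convert this using 1; ring

lemma mem_idealOfVars_pow_of_map_mem (hα : ∀ i, α (X i) - MvPowerSeries.X i ∈ maxIdeal ^ 2) (j : ℕ)
    {G : MvPolynomial (Fin 2) ℂ} (hG : α G ∈ maxIdeal ^ j) : G ∈ idealOfVars (Fin 2) ℂ ^ j := by
  induction j with
  | zero => simp
  | succ j ih =>
    have h1 := ih (Ideal.pow_le_pow_right (Nat.le_succ j) hG)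
    have h2 := Ideal.sub_mem _ hG (map_sub_coe_mem hα j h1)
    rw [sub_sub_cancel] at h2
    rw [mem_pow_idealOfVars_iff']
    intro m hm
    have := order_le_of_mem_maxIdeal_pow h2
    rw [← coeff_coe]
    refine MvPowerSeries.coeff_of_lt_order (lt_of_lt_of_le ?_ this)
    exact_mod_cast hm

/-- Membership in an ideal with two generators may be tested on power series, up to a factor which
does not vanish at the origin. -/
lemma exists_mul_mem_span_of_map_mem_span
    (hα : ∀ i, α (X i) - MvPowerSeries.X i ∈ maxIdeal ^ 2) {a b H : MvPolynomial (Fin 2) ℂ}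
    (h : α H ∈ Ideal.span {α a, α b}) :
    ∃ s, constantCoeff s = 1 ∧ s * H ∈ Ideal.span {a, b} := by
  obtain ⟨p, q, hpq⟩ := Ideal.mem_span_pair.mp h
  set J := Ideal.span {a, b}
  -- Polynomial approximations of $p,q$ to order $i$ show that the class of $H$ lies in every power
  -- of the maximal ideal of the origin.
  have hx : (Ideal.Quotient.mk J H : MvPolynomial (Fin 2) ℂ ⧸ J) ∈
      (⨅ i : ℕ, idealOfVars (Fin 2) ℂ ^ i • ⊤ :
        Submodule (MvPolynomial (Fin 2) ℂ) (MvPolynomial (Fin 2) ℂ ⧸ J)) := by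
    rw [Submodule.mem_iInf]
    intro i
    obtain ⟨p', hp'⟩ := exists_sub_map_mem_pow hα i p
    obtain ⟨q', hq'⟩ := exists_sub_map_mem_pow hα i q
    have h1 : H - (p' * a + q' * b) ∈ idealOfVars (Fin 2) ℂ ^ i := by
      refine mem_idealOfVars_pow_of_map_mem hα i ?_
      have e : α (H - (p' * a + q' * b)) = (p - α p') * α a + (q - α q') * α b := by
        rw [map_sub, ← hpq, map_add, map_mul, map_mul]; ring
      rw [e]
      exact Ideal.add_mem _ (Ideal.mul_mem_right _ _ hp') (Ideal.mul_mem_right _ _ hq')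
    have h2 : (Ideal.Quotient.mk J H : MvPolynomial (Fin 2) ℂ ⧸ J)
        = (H - (p' * a + q' * b)) • (1 : MvPolynomial (Fin 2) ℂ ⧸ J) := by
      refine (Ideal.Quotient.eq.mpr ?_ : Ideal.Quotient.mk J H
        = Ideal.Quotient.mk J ((H - (p' * a + q' * b)) * 1))
      rw [mul_one, sub_sub_cancel]
      exact Ideal.mem_span_pair.mpr ⟨p', q', rfl⟩
    rw [h2]
    exact Submodule.smul_mem_smul h1 trivial
  -- Krull's intersection theorem: some $r$ vanishing at the origin fixes the class of $H$, and
  -- $s=1-r$.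
  obtain ⟨⟨r, hr⟩, hrx⟩ := (Ideal.mem_iInf_smul_pow_eq_bot_iff _ _).mp hx
  refine ⟨1 - r, ?_, ?_⟩
  · have : constantCoeff r = 0 := by
      have h1 : idealOfVars (Fin 2) ℂ ≤ RingHom.ker (constantCoeff (R := ℂ) (σ := Fin 2)) := by
        rw [idealOfVars, Ideal.span_le]
        rintro _ ⟨i, rfl⟩
        simp
      exact h1 hr
    rw [map_sub, this, map_one, sub_zero]
  · rw [← Ideal.Quotient.eq_zero_iff_mem, sub_mul, one_mul, map_sub, sub_eq_zero]
    exact hrx.symm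

end Density

/-! ### Dehomogenization -/

/-- Passage to the affine chart `X 0 = 1`. -/
noncomputable def dehom : Form →ₐ[ℂ] MvPolynomial (Fin 2) ℂ := aeval ![1, X 0, X 1]

/-- All large degrees are allowed so that several polynomials can be homogenized compatibly. -/
lemma exists_isHomogeneous_dehom_eq (s : MvPolynomial (Fin 2) ℂ) :
    ∃ n₀, ∀ n ≥ n₀, ∃ G : Form, G.IsHomogeneous n ∧ dehom G = s := by
  induction s using MvPolynomial.induction_on with
  | C c =>
    refine ⟨0, fun n _ => ⟨C c * X 0 ^ n, ?_, by simp [dehom, algebraMap_eq]⟩⟩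
    simpa using isHomogeneous_C_mul_X_pow c (0 : Fin 3) n
  | add p q hp hq =>
    obtain ⟨n₁, h1⟩ := hp
    obtain ⟨n₂, h2⟩ := hq
    refine ⟨max n₁ n₂, fun n hn => ?_⟩
    obtain ⟨G₁, hG₁, e1⟩ := h1 n (le_trans (le_max_left _ _) hn)
    obtain ⟨G₂, hG₂, e2⟩ := h2 n (le_trans (le_max_right _ _) hn)
    exact ⟨G₁ + G₂, hG₁.add hG₂, by rw [map_add, e1, e2]⟩
  | mul_X p i hp =>
    obtain ⟨n₁, h1⟩ := hp
    refine ⟨n₁ + 1, fun n hn => ?_⟩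
    obtain ⟨G, hG, e⟩ := h1 (n - 1) (by omega)
    refine ⟨G * X i.succ, ?_, ?_⟩
    · have := hG.mul (isHomogeneous_X ℂ i.succ)
      rwa [Nat.sub_add_cancel (by omega)] at this
    · rw [map_mul, e]
      congr 1
      fin_cases i <;> simp [dehom]

lemma eq_zero_of_dehom_eq_zero {G : Form} {n : ℕ} (hG : G.IsHomogeneous n) (h : dehom G = 0) :
    G = 0 := by
  have h1 : X 0 * G = 0 := by
    refine MvPolynomial.funext fun x => ?_
    rw [map_mul, eval_X, map_zero]
    by_cases hx : x 0 = 0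
    · rw [hx, zero_mul]
    · have e : x = x 0 • ![1, x 1 / x 0, x 2 / x 0] := by
        ext i; fin_cases i <;> simp <;> field_simp
      have h2 := congrArg (eval ![x 1 / x 0, x 2 / x 0]) h
      rw [map_zero] at h2
      have h3 : eval ![x 1 / x 0, x 2 / x 0] (dehom G) = eval ![1, x 1 / x 0, x 2 / x 0] G := by
        rw [dehom, ← aeval_eq_eval, ← aeval_eq_eval]
        change (aeval ![x 1 / x 0, x 2 / x 0]) (aeval _ G) = _
        rw [← AlgHom.comp_apply, comp_aeval]
        congr 2
        ext i; fin_cases i <;> simp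
      rw [e, eval_smul_of_isHomogeneous hG, ← h3, h2, mul_zero, mul_zero]
  exact (mul_eq_zero.mp h1).resolve_left (X_ne_zero 0)

/-- Membership of forms in an ideal with two homogeneous generators may be tested in local
coordinates at a point, up to a form which does not vanish there. -/
theorem exists_mul_mem_span {P : Plane} {Φ : Fin 3 → Series} (hΦ : IsLocalParam P Φ)
    {a b H : Form} {i j d : ℕ} (ha : a.IsHomogeneous i) (hb : b.IsHomogeneous j)
    (hH : H.IsHomogeneous d) (h : aeval Φ H ∈ Ideal.span {aeval Φ a, aeval Φ b}) :
    ∃ (n : ℕ) (s : Form), s.IsHomogeneous n ∧ value s P ≠ 0 ∧ s * H ∈ Ideal.span {a, b} := by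
  obtain ⟨M, Ψ, hM, hMP, hΨ, -, hΦΨ⟩ := exists_isStdParam hΦ
  obtain ⟨w, hw⟩ := isUnit_iff_constantCoeff_ne_zero.mpr
    (show MvPowerSeries.constantCoeff (Ψ 0) ≠ 0 by simp [hΨ.const 0])
  have hw1 : Ψ 0 * (↑w⁻¹ : Series) = 1 := by rw [← hw]; simp
  have hwc : MvPowerSeries.constantCoeff (↑w⁻¹ : Series) = 1 := by
    have := congrArg MvPowerSeries.constantCoeff hw1
    simpa [hΨ.const 0] using this
  -- The affine coordinates $\Psi_1/\Psi_0,\Psi_2/\Psi_0$ are tangent to $u,v$, as the density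
  -- lemmas require.
  let α : MvPolynomial (Fin 2) ℂ →ₐ[ℂ] Series := aeval ![Ψ 1 * ↑w⁻¹, Ψ 2 * ↑w⁻¹]
  have hα : ∀ i, α (X i) - MvPowerSeries.X i ∈ maxIdeal ^ 2 := by
    intro i
    have hc1 := hΨ.const 1
    have hc2 := hΨ.const 2
    have hf1 := hΨ.fst 1
    have hf2 := hΨ.fst 2
    have hs1 := hΨ.snd 1
    have hs2 := hΨ.snd 2
    refine mem_maxIdeal_sq ?_ fun j => ?_
    · fin_cases i <;> simp [α, hc1, hc2]
    · fin_cases i <;> fin_cases j <;>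
        simp [α, coeff_single_mul, hc1, hc2, hwc, hf1, hf2, hs1, hs2, MvPowerSeries.coeff_X,
          Finsupp.single_left_inj]
  have key : ∀ {G : Form} {n : ℕ}, G.IsHomogeneous n →
      aeval Φ G = Ψ 0 ^ n * α (dehom (lin M G)) := by
    intro G n hG
    have e : Ψ = fun i => Ψ 0 * ![1, Ψ 1 * ↑w⁻¹, Ψ 2 * ↑w⁻¹] i := by
      funext i
      fin_cases i
      · simp
      · simp [mul_left_comm (Ψ 0), hw1]
      · simp [mul_left_comm (Ψ 0), hw1]
    rw [hΦΨ]
    conv_lhs => rw [e]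
    rw [aeval_mul_of_isHomogeneous (lin_isHomogeneous hG M), ← AlgHom.comp_apply α dehom, dehom,
      comp_aeval]
    congr 3
    funext i
    fin_cases i <;> simp [α]
  have hunit : ∀ n, IsUnit (Ψ 0 ^ n) := fun n => by rw [← hw]; exact (Units.isUnit w).pow n
  obtain ⟨s, hs, hsH⟩ := exists_mul_mem_span_of_map_mem_span hα
    (a := dehom (lin M a)) (b := dehom (lin M b)) (H := dehom (lin M H)) (by
      obtain ⟨p, q, hpq⟩ := Ideal.mem_span_pair.mp h
      rw [key ha, key hb, key hH] at hpq
      obtain ⟨z, hz⟩ := hunit d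
      rw [Ideal.mem_span_pair]
      refine ⟨↑z⁻¹ * p * Ψ 0 ^ i, ↑z⁻¹ * q * Ψ 0 ^ j, ?_⟩
      have hz' : (↑z⁻¹ : Series) * Ψ 0 ^ d = 1 := by rw [← hz]; simp
      linear_combination (↑z⁻¹ : Series) * hpq + (α (dehom (lin M H))) * hz')
  obtain ⟨p, q, hpq⟩ := Ideal.mem_span_pair.mp hsH
  obtain ⟨n₁, h1⟩ := exists_isHomogeneous_dehom_eq s
  obtain ⟨n₂, h2⟩ := exists_isHomogeneous_dehom_eq p
  obtain ⟨n₃, h3⟩ := exists_isHomogeneous_dehom_eq q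
  -- The degrees make $S\cdot H$, $p'a$ and $q'b$ homogeneous of one common degree.
  obtain ⟨S, hS, eS⟩ := h1 (n₁ + n₂ + n₃ + i + j) (by omega)
  obtain ⟨p', hp', ep⟩ := h2 (n₁ + n₂ + n₃ + j + d) (by omega)
  obtain ⟨q', hq', eq⟩ := h3 (n₁ + n₂ + n₃ + i + d) (by omega)
  have hEq : S * lin M H - (p' * lin M a + q' * lin M b) = 0 := by
    refine eq_zero_of_dehom_eq_zero (n := n₁ + n₂ + n₃ + i + j + d) ?_ ?_
    · refine (hS.mul (lin_isHomogeneous hH M)).sub (IsHomogeneous.add ?_ ?_)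
      · convert! hp'.mul (lin_isHomogeneous ha M) using 1; omega
      · convert! hq'.mul (lin_isHomogeneous hb M) using 1; omega
    · rw [map_sub, map_add, map_mul, map_mul, map_mul, eS, ep, eq, hpq, sub_self]
  refine ⟨_, lin M⁻¹ S, lin_isHomogeneous hS _, ?_, ?_⟩
  · rw [value, eval_lin, ← hMP, Matrix.mulVec_mulVec,
      Matrix.nonsing_inv_mul _ (isUnit_iff_ne_zero.mpr hM), Matrix.one_mulVec]
    have h4 : eval ![1, 0, 0] S = constantCoeff (dehom S) := by
      rw [← eval_zero, ← aeval_eq_eval, ← aeval_eq_eval]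
      change _ = (aeval 0) (aeval _ S)
      rw [← AlgHom.comp_apply, comp_aeval]
      congr 2
      funext i; fin_cases i <;> simp
    rw [h4, eS, hs]
    exact one_ne_zero
  · have := congrArg (lin M⁻¹) (sub_eq_zero.mp hEq)
    rw [map_mul, map_add, map_mul, map_mul, lin_inv_lin hM, lin_inv_lin hM, lin_inv_lin hM] at this
    rw [this]
    exact Ideal.mem_span_pair.mpr ⟨_, _, rfl⟩
end SemiTorus

namespace SemiTorus
open MvPolynomial

/-! ### Homogeneous forms and points of the plane -/

lemma eval_ne_zero_of_value_ne_zero {G : Form} {n : ℕ} (hG : G.IsHomogeneous n) {x : Fin 3 → ℂ}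
    (hx : x ≠ 0) : value G (Projectivization.mk ℂ x hx) ≠ 0 ↔ eval x G ≠ 0 := by
  obtain ⟨c, hc⟩ := Projectivization.exists_smul_eq_mk_rep ℂ x hx
  rw [value, ← hc, Units.smul_def, eval_smul_of_isHomogeneous hG]
  simp [c.ne_zero]

lemma value_mk_eq_zero {G : Form} {n : ℕ} (hG : G.IsHomogeneous n) {x : Fin 3 → ℂ}
    (hx : x ≠ 0) : value G (Projectivization.mk ℂ x hx) = 0 ↔ eval x G = 0 :=
  not_iff_not.mp (eval_ne_zero_of_value_ne_zero hG hx)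

lemma homogeneousComponent_mul_of_isHomogeneous {σ : Type*} (p : MvPolynomial σ ℂ)
    {a : MvPolynomial σ ℂ} {i n : ℕ} (ha : a.IsHomogeneous i) :
    homogeneousComponent (n + i) (p * a) = homogeneousComponent n p * a := by
  induction p using MvPolynomial.induction_on' with
  | monomial m c =>
    have h1 : (monomial m c : MvPolynomial σ ℂ).IsHomogeneous m.degree :=
      isHomogeneous_monomial _ rfl
    rw [homogeneousComponent_of_mem (h1.mul ha), homogeneousComponent_of_mem h1]
    by_cases h : n = m.degree
    · simp [h]
    · simp [h]
  | add p q hp hq => rw [add_mul, map_add, hp, hq, map_add, add_mul]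

/-- A homogeneous element of an ideal with two homogeneous generators is a combination of them with
homogeneous coefficients. -/
lemma exists_isHomogeneous_of_mem_span {σ : Type*} {a b H : MvPolynomial σ ℂ} {i j k l n : ℕ}
    (ha : a.IsHomogeneous i) (hb : b.IsHomogeneous j) (hH : H.IsHomogeneous n) (hk : k + i = n)
    (hl : l + j = n) (h : H ∈ Ideal.span {a, b}) :
    ∃ p q, p.IsHomogeneous k ∧ q.IsHomogeneous l ∧ H = p * a + q * b := by
  obtain ⟨p, q, hpq⟩ := Ideal.mem_span_pair.mp h
  refine ⟨_, _, homogeneousComponent_isHomogeneous k p, homogeneousComponent_isHomogeneous l q, ?_⟩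
  rw [← homogeneousComponent_mul_of_isHomogeneous p ha,
    ← homogeneousComponent_mul_of_isHomogeneous q hb, hk, hl, ← map_add, hpq,
    homogeneousComponent_eq_self hH]

/-! ### Coprimality -/

lemma exists_pow_mem_of_eval_eq_zero {σ : Type*} [Finite σ] {I : Ideal (MvPolynomial σ ℂ)}
    (h : ∀ x : σ → ℂ, (∀ p ∈ I, eval x p = 0) → x = 0) (i : σ) : ∃ n : ℕ, X i ^ n ∈ I := by
  have : X i ∈ vanishingIdeal ℂ (zeroLocus ℂ I) := by
    rw [mem_vanishingIdeal_iff]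
    intro x hx
    rw [h x fun p hp => by simpa [aeval_eq_eval] using hx p hp]
    simp
  rwa [vanishingIdeal_zeroLocus_eq_radical] at this

/-- By the Nullstellensatz a common divisor divides powers of both variables, hence is a unit. -/
lemma isRelPrime_of_eval_eq_zero {p q : MvPolynomial (Fin 2) ℂ}
    (h : ∀ x, eval x p = 0 → eval x q = 0 → x = 0) : IsRelPrime p q := by
  intro d hp hq
  have h1 := exists_pow_mem_of_eval_eq_zero (I := Ideal.span {d}) fun x hx => by
    have hd := hx d (Ideal.mem_span_singleton_self d)
    obtain ⟨p', rfl⟩ := hp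
    obtain ⟨q', rfl⟩ := hq
    exact h x (by simp [hd]) (by simp [hd])
  obtain ⟨n, hn⟩ := h1 0
  obtain ⟨m, hm⟩ := h1 1
  rw [Ideal.mem_span_singleton] at hn hm
  have hX : IsRelPrime (X 0 : MvPolynomial (Fin 2) ℂ) (X 1) := by
    rw [(X_prime (R := ℂ) (i := (0 : Fin 2))).irreducible.isRelPrime_iff_not_dvd]
    intro ⟨r, hr⟩
    have := congrArg (eval ![0, 1]) hr
    simp at this
  exact IsRelPrime.pow hX hn hm

/-- Restriction of a form to the line `X 0 = 0`. -/
noncomputable def resLine : Form →ₐ[ℂ] MvPolynomial (Fin 2) ℂ := aeval ![0, X 0, X 1]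

lemma eval_resLine (x : Fin 2 → ℂ) (G : Form) : eval x (resLine G) = eval ![0, x 0, x 1] G := by
  rw [← aeval_eq_eval, ← aeval_eq_eval, resLine]
  change (aeval x) (aeval _ G) = _
  rw [← AlgHom.comp_apply, comp_aeval]
  congr 2
  funext i; fin_cases i <;> simp

/-- The cone over a curve in the line `X 0 = 0`. -/
noncomputable def liftLine : MvPolynomial (Fin 2) ℂ →ₐ[ℂ] Form := aeval ![X 1, X 2]

lemma resLine_liftLine (p : MvPolynomial (Fin 2) ℂ) : resLine (liftLine p) = p := by
  have : resLine.comp liftLine = AlgHom.id ℂ _ := by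
    ext1 i
    fin_cases i <;> simp [resLine, liftLine]
  exact DFunLike.congr_fun this p

lemma X_dvd_of_resLine_eq_zero {p : Form} (h : resLine p = 0) : X 0 ∣ p := by
  have key : ∀ p : Form, X 0 ∣ p - liftLine (resLine p) := by
    intro p
    induction p using MvPolynomial.induction_on with
    | C c => simp [resLine, liftLine, algebraMap_eq]
    | add p q hp hq =>
      rw [map_add, map_add, add_sub_add_comm]
      exact dvd_add hp hq
    | mul_X p i hp =>
      rw [map_mul, map_mul]
      have : X 0 ∣ X i - liftLine (resLine (X i)) := by
        fin_cases i <;> simp [resLine, liftLine]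
      have e : p * X i - liftLine (resLine p) * liftLine (resLine (X i))
        = (p - liftLine (resLine p)) * X i + liftLine (resLine p) * (X i - liftLine (resLine (X i))) := by
        ring
      rw [e]
      exact dvd_add (dvd_mul_of_dvd_left hp _) (dvd_mul_of_dvd_right this _)
  simpa [h] using key p

lemma isRelPrime_resLine {a b : Form}
    (h : ∀ x, eval x a = 0 → eval x b = 0 → x 0 = 0 → x = 0) :
    IsRelPrime (resLine a) (resLine b) := by
  refine isRelPrime_of_eval_eq_zero fun x hxa hxb => ?_
  rw [eval_resLine] at hxa hxb
  have := h _ hxa hxb rfl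
  ext i
  have := congrFun this i.succ
  fin_cases i <;> simpa using this

/-- A common divisor $d$ is a nonzero constant on $X_0=0$, so $d(0)\neq0$. On the line through the
origin and a point where $a\neq0$ it divides a power of the parameter, so it is constant there. -/
lemma isRelPrime_of_resLine {a b : Form} {i j : ℕ} (ha : a.IsHomogeneous i)
    (hb : b.IsHomogeneous j) (h : IsRelPrime (resLine a) (resLine b)) : IsRelPrime a b := by
  intro d hda hdb
  obtain ⟨c, hc, hcd⟩ := isUnit_iff_eq_C_of_isReduced.mp (h (map_dvd resLine hda) (map_dvd resLine hdb))
  have hd0 : eval 0 d = c := by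
    have := eval_resLine 0 d
    rw [hcd, eval_C] at this
    rw [this]
    congr 2
    funext i; fin_cases i <;> simp
  have key : ∀ {a : Form} {i : ℕ}, a.IsHomogeneous i → d ∣ a → a ≠ 0 → IsUnit d := by
    intro a i ha hda ha0
    have h1 : (d - C c) * a = 0 := by
      refine MvPolynomial.funext fun x => ?_
      rw [map_mul, map_sub, eval_C, map_zero]
      by_cases hx : eval x a = 0
      · rw [hx, mul_zero]
      · let φ : Form →ₐ[ℂ] Polynomial ℂ := aeval fun i => Polynomial.X * Polynomial.C (x i)
        have hφ : ∀ t G, (φ G).eval t = eval (t • x) G := by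
          intro t G
          have : ((Polynomial.aeval t).comp φ) = aeval (t • x) := by
            ext1 i
            simp [φ]
            ring
          have := DFunLike.congr_fun this G
          simpa [aeval_eq_eval] using this
        have h2 : φ d ∣ Polynomial.X ^ i * Polynomial.C (eval x a) := by
          convert! map_dvd φ hda using 1
          refine Polynomial.funext fun t => ?_
          rw [hφ, eval_smul_of_isHomogeneous ha]
          simp only [Polynomial.eval_mul, Polynomial.eval_pow, Polynomial.eval_X, Polynomial.eval_C]
        have h3 : φ d ∣ Polynomial.X ^ i :=
          (IsUnit.dvd_mul_right (Polynomial.isUnit_C.mpr (isUnit_iff_ne_zero.mpr hx))).mp h2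
        obtain ⟨k, -, hk⟩ := (dvd_prime_pow Polynomial.prime_X i).mp h3
        obtain ⟨u, hu⟩ := hk.symm
        have hk0 : k = 0 := by
          by_contra hk0
          have h4 := hφ 0 d
          rw [zero_smul, hd0, ← hu] at h4
          simp [hk0] at h4
          exact hc.ne_zero h4.symm
        rw [hk0, pow_zero, one_mul] at hu
        obtain ⟨r, hr, hr'⟩ := Polynomial.isUnit_iff.mp u.isUnit
        have h5 := hφ 0 d
        have h6 := hφ 1 d
        rw [← hu, ← hr', Polynomial.eval_C] at h5 h6
        rw [zero_smul, hd0] at h5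
        rw [one_smul] at h6
        rw [← h6, h5, sub_self, zero_mul]
    rw [sub_eq_zero.mp ((mul_eq_zero.mp h1).resolve_right ha0)]
    exact hc.map C
  by_cases ha0 : a = 0
  · by_cases hb0 : b = 0
    · rw [ha0, hb0, map_zero] at h
      exact absurd (h (dvd_refl _) (dvd_refl _)) not_isUnit_zero
    · exact key hb hdb hb0
  · exact key ha hda ha0

/-- $X_0$ is a nonzerodivisor modulo $(a,b)$: the relation induced on $X_0=0$ is a multiple of the
trivial one $(b,-a)$; subtracting a lift makes both coefficients divisible by $X_0$. -/
lemma mem_span_of_X_mul_mem {a b G : Form} (h : IsRelPrime (resLine a) (resLine b))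
    (hG : X 0 * G ∈ Ideal.span {a, b}) : G ∈ Ideal.span {a, b} := by
  obtain ⟨p, q, hpq⟩ := Ideal.mem_span_pair.mp hG
  have h1 : resLine p * resLine a + resLine q * resLine b = 0 := by
    have := congrArg resLine hpq
    rw [map_add, map_mul, map_mul, map_mul] at this
    rw [this]; simp [resLine]
  obtain ⟨r, hr1, hr2⟩ : ∃ r, resLine p = r * resLine b ∧ resLine q = - (r * resLine a) := by
    by_cases hb : resLine b = 0
    · rw [hb] at h
      obtain ⟨w, hw⟩ := h (dvd_refl _) (dvd_zero _)
      refine ⟨-(resLine q * ↑w⁻¹), ?_, ?_⟩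
      · rw [hb, mul_zero, add_zero] at h1
        rw [hb, mul_zero]
        exact (mul_eq_zero.mp h1).resolve_right (hw ▸ w.ne_zero)
      · rw [← hw]; simp
    · obtain ⟨r, hr⟩ := h.symm.dvd_of_dvd_mul_right
        (show resLine b ∣ resLine p * resLine a from ⟨-resLine q, by linear_combination h1⟩)
      refine ⟨r, by rw [hr, mul_comm], ?_⟩
      refine mul_right_cancel₀ hb ?_
      rw [hr] at h1
      linear_combination h1
  obtain ⟨p', hp'⟩ := X_dvd_of_resLine_eq_zero (p := p - liftLine r * b)
    (by rw [map_sub, map_mul, resLine_liftLine, hr1, sub_self])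
  obtain ⟨q', hq'⟩ := X_dvd_of_resLine_eq_zero (p := q + liftLine r * a)
    (by rw [map_add, map_mul, resLine_liftLine, hr2, neg_add_cancel])
  refine Ideal.mem_span_pair.mpr ⟨p', q', ?_⟩
  refine mul_left_cancel₀ (X_ne_zero (R := ℂ) (0 : Fin 3)) ?_
  linear_combination hpq - a * hp' - b * hq'

/-! ### Noether's theorem -/

/-- Some line avoids the finitely many common zeros; it is taken as $X_0=0$. -/
lemma exists_lin_of_finite {a b : Form} {i j : ℕ} (ha : a.IsHomogeneous i) (hb : b.IsHomogeneous j)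
    (hfin : {P : Plane | value a P = 0 ∧ value b P = 0}.Finite) :
    ∃ M : Matrix (Fin 3) (Fin 3) ℂ, M.det ≠ 0 ∧
      ∀ x, eval x (lin M a) = 0 → eval x (lin M b) = 0 → x 0 = 0 → x = 0 := by
  set Z := {P : Plane | value a P = 0 ∧ value b P = 0}
  have := hfin.to_subtype
  -- The extra vector $(1,0,0)$ keeps the functional nonzero when there are no common zeros.
  obtain ⟨f, hf⟩ := Module.exists_dual_forall_apply_ne_zero (K := ℂ) (M := Fin 3 → ℂ)
    (ι := Option Z) (fun o => o.elim ![1, 0, 0] fun P => P.1.rep) (by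
      rintro (_ | P)
      · intro h
        simpa using congrFun h 0
      · exact P.1.rep_nonzero)
  let r : Fin 3 → ℂ := fun k => f (Pi.single k 1)
  have hfr : ∀ x, f x = r 0 * x 0 + r 1 * x 1 + r 2 * x 2 := by
    intro x
    conv_lhs => rw [pi_eq_sum_univ' x]
    simp [Fin.sum_univ_three, r, mul_comm]
  have hr : r ≠ 0 := by
    intro h
    refine hf none ?_
    rw [hfr, h]; simp
  obtain ⟨N, hN, hN0⟩ : ∃ N : Matrix (Fin 3) (Fin 3) ℂ, N.det ≠ 0 ∧ N 0 = r := by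
    by_cases h0 : r 0 = 0
    · by_cases h1 : r 1 = 0
      · have h2 : r 2 ≠ 0 := fun h2 => hr (by ext k; fin_cases k <;> simpa)
        exact ⟨Matrix.of ![r, ![1, 0, 0], ![0, 1, 0]], by simpa [Matrix.det_fin_three] using h2, rfl⟩
      · exact ⟨Matrix.of ![r, ![1, 0, 0], ![0, 0, 1]], by simpa [Matrix.det_fin_three] using h1, rfl⟩
    · exact ⟨Matrix.of ![r, ![0, 1, 0], ![0, 0, 1]], by simpa [Matrix.det_fin_three] using h0, rfl⟩
  have hinv := Matrix.mul_nonsing_inv _ (isUnit_iff_ne_zero.mpr hN)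
  refine ⟨N⁻¹, fun h => ?_, fun x hxa hxb hx0 => ?_⟩
  · have := congrArg Matrix.det hinv
    rw [Matrix.det_mul, h] at this
    simp at this
  · by_contra hx
    rw [eval_lin] at hxa hxb
    set y := N⁻¹.mulVec x with hy
    have hNy : N.mulVec y = x := by rw [hy, Matrix.mulVec_mulVec, hinv, Matrix.one_mulVec]
    have hy0 : y ≠ 0 := by rintro h; exact hx (by rw [← hNy, h, Matrix.mulVec_zero])
    have hP : Projectivization.mk ℂ y hy0 ∈ Z :=
      ⟨(value_mk_eq_zero ha hy0).mpr hxa, (value_mk_eq_zero hb hy0).mpr hxb⟩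
    refine hf (some ⟨_, hP⟩) ?_
    obtain ⟨c, hc⟩ := Projectivization.exists_smul_eq_mk_rep ℂ y hy0
    change f (Projectivization.mk ℂ y hy0).rep = 0
    rw [← hc, Units.smul_def, map_smul]
    have : f y = x 0 := by
      rw [← hNy, hfr, Matrix.mulVec, hN0]; simp [dotProduct, Fin.sum_univ_three]
    rw [this, hx0, smul_zero]

lemma isRelPrime_of_finite {a b : Form} {i j : ℕ} (ha : a.IsHomogeneous i) (hb : b.IsHomogeneous j)
    (hfin : {P : Plane | value a P = 0 ∧ value b P = 0}.Finite) : IsRelPrime a b := by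
  obtain ⟨M, hM, h⟩ := exists_lin_of_finite ha hb hfin
  intro d hda hdb
  have := isRelPrime_of_resLine (lin_isHomogeneous ha M) (lin_isHomogeneous hb M)
    (isRelPrime_resLine h) (map_dvd (lin M) hda) (map_dvd (lin M) hdb)
  have := this.map (lin M⁻¹)
  rwa [lin_inv_lin hM] at this

/-- Noether's theorem: if the forms `a` and `b` have finitely many common zeros, membership in the
ideal they generate is a local condition at these zeros. -/
theorem mem_span_of_local {a b H : Form} {i j : ℕ} (ha : a.IsHomogeneous i) (hb : b.IsHomogeneous j)
    (hfin : {P : Plane | value a P = 0 ∧ value b P = 0}.Finite)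
    (hloc : ∀ P, value a P = 0 → value b P = 0 →
      ∃ (n : ℕ) (s : Form), s.IsHomogeneous n ∧ value s P ≠ 0 ∧ s * H ∈ Ideal.span {a, b}) :
    H ∈ Ideal.span {a, b} := by
  obtain ⟨M, hM, h⟩ := exists_lin_of_finite ha hb hfin
  have hrel := isRelPrime_resLine h
  have hmap : ∀ {N : Matrix (Fin 3) (Fin 3) ℂ} {a b G : Form}, G ∈ Ideal.span {a, b} →
      lin N G ∈ Ideal.span {lin N a, lin N b} := by
    intro N a b G hG
    obtain ⟨p, q, rfl⟩ := Ideal.mem_span_pair.mp hG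
    rw [map_add, map_mul, map_mul]
    exact Ideal.mem_span_pair.mpr ⟨_, _, rfl⟩
  have hM1 : ∀ x : Fin 3 → ℂ, M.mulVec x = 0 → x = 0 := fun x hx => by
    rw [← Matrix.one_mulVec x, ← Matrix.nonsing_inv_mul M (isUnit_iff_ne_zero.mpr hM),
      ← Matrix.mulVec_mulVec, hx, Matrix.mulVec_zero]
  -- The quotient ideal $(a,b):H$ has no zero except the origin, so it contains a power of $X_0$.
  obtain ⟨n, hn⟩ := exists_pow_mem_of_eval_eq_zero
    (I := Submodule.comap (LinearMap.mulRight Form (lin M H)) (Ideal.span {lin M a, lin M b}))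
    (fun x hx => by
      by_contra hx0
      have hy0 : M.mulVec x ≠ 0 := fun h => hx0 (hM1 x h)
      have ha0 := hx (lin M a) (Ideal.mul_mem_right _ _ (Ideal.subset_span (by simp)))
      have hb0 := hx (lin M b) (Ideal.mul_mem_right _ _ (Ideal.subset_span (by simp)))
      rw [eval_lin] at ha0 hb0
      obtain ⟨n, s, hs, hsP, hsH⟩ := hloc (Projectivization.mk ℂ _ hy0)
        ((value_mk_eq_zero ha hy0).mpr ha0) ((value_mk_eq_zero hb hy0).mpr hb0)
      refine (eval_ne_zero_of_value_ne_zero hs hy0).mp hsP ?_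
      have h1 := hmap (N := M) hsH
      rw [map_mul] at h1
      have := hx (lin M s) h1
      rwa [eval_lin] at this) 0
  have hn' : X 0 ^ n * lin M H ∈ Ideal.span {lin M a, lin M b} := hn
  have hH : lin M H ∈ Ideal.span {lin M a, lin M b} := by
    clear hn
    induction n with
    | zero => simpa using hn'
    | succ n ih =>
      rw [pow_succ', mul_assoc] at hn'
      exact ih (mem_span_of_X_mul_mem hrel hn')
  have := hmap (N := M⁻¹) hH
  rwa [lin_inv_lin hM, lin_inv_lin hM, lin_inv_lin hM] at this
end SemiTorus

namespace SemiTorus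
open MvPolynomial

/-! ### Forms of low degree -/

lemma exists_eq_C_of_isHomogeneous {G : Form} (h : G.IsHomogeneous 0) : ∃ c, G = C c :=
  ⟨_, totalDegree_eq_zero_iff_eq_C.mp ((totalDegree_zero_iff_isHomogeneous _).mpr h)⟩

lemma not_isUnit_of_isHomogeneous {G : Form} {d : ℕ} (h : G.IsHomogeneous d) (hd : d ≠ 0) :
    ¬ IsUnit G := by
  intro hu
  have h1 := hu.map (eval (0 : Fin 3 → ℂ))
  have h2 := eval_smul_of_isHomogeneous h 0 0
  rw [zero_smul, zero_pow hd, zero_mul] at h2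
  rw [h2] at h1
  exact not_isUnit_zero h1

lemma exists_isHomogeneous_of_dvd {g G : Form} {j k n : ℕ} (hg : g.IsHomogeneous j)
    (hG : G.IsHomogeneous n) (hk : k + j = n) (h : g ∣ G) :
    ∃ q : Form, q.IsHomogeneous k ∧ G = q * g := by
  obtain ⟨r, rfl⟩ := h
  obtain ⟨p, q, hp, -, hpq⟩ := exists_isHomogeneous_of_mem_span hg (isHomogeneous_zero _ _ j) hG hk hk
    (Ideal.mul_mem_right r _ (Ideal.subset_span (by simp)))
  exact ⟨p, hp, by rw [hpq, mul_zero, add_zero]⟩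

lemma exists_eq_C_mul_of_dvd {g G : Form} {n : ℕ} (hg : g.IsHomogeneous n)
    (hG : G.IsHomogeneous n) (h : g ∣ G) : ∃ c, G = C c * g := by
  obtain ⟨q, hq, rfl⟩ := exists_isHomogeneous_of_dvd hg hG (zero_add n) h
  obtain ⟨c, rfl⟩ := exists_eq_C_of_isHomogeneous hq
  exact ⟨c, rfl⟩

lemma irreducible_of_isHomogeneous_one {w : Form} (hw : w.IsHomogeneous 1) (h0 : w ≠ 0) :
    Irreducible w := by
  refine ⟨not_isUnit_of_isHomogeneous hw one_ne_zero, fun p q hpq => ?_⟩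
  have hp : p ≠ 0 := by rintro rfl; exact h0 (by rw [hpq, zero_mul])
  have hq : q ≠ 0 := by rintro rfl; exact h0 (by rw [hpq, mul_zero])
  have h1 := totalDegree_mul_of_isDomain hp hq
  rw [← hpq, hw.totalDegree h0] at h1
  have key : ∀ r : Form, r ≠ 0 → r.totalDegree = 0 → IsUnit r := fun r hr h => by
    rw [totalDegree_eq_zero_iff_eq_C] at h
    rw [h]
    refine (isUnit_iff_ne_zero.mpr fun h' => hr ?_).map C
    rw [h, h', map_zero]
  rcases Nat.eq_zero_or_pos p.totalDegree with h | h
  · exact Or.inl (key p hp h)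
  · exact Or.inr (key q hq (by omega))

lemma prime_of_isHomogeneous_one {w : Form} (hw : w.IsHomogeneous 1) (h0 : w ≠ 0) : Prime w :=
  (irreducible_of_isHomogeneous_one hw h0).prime

lemma ne_zero_of_isRelPrime {a b : Form} {i : ℕ} (ha : a.IsHomogeneous i) (hi : i ≠ 0)
    (h : IsRelPrime a b) : b ≠ 0 := by
  rintro rfl
  exact not_isUnit_of_isHomogeneous ha hi (h (dvd_refl _) (dvd_zero _))

/-- Relatively prime forms of the same degree are linearly independent. -/
lemma eq_zero_of_isRelPrime {a b : Form} {i : ℕ} (ha : a.IsHomogeneous i) (hb : b.IsHomogeneous i)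
    (hi : i ≠ 0) (h : IsRelPrime a b) {s t : ℂ} (hst : C s * a + C t * b = 0) : s = 0 ∧ t = 0 := by
  have key : ∀ {a b : Form} {s t : ℂ}, a.IsHomogeneous i → b.IsHomogeneous i → IsRelPrime a b →
      C s * a + C t * b = 0 → s = 0 := by
    intro a b s t ha hb h hst
    by_contra hs
    have : b ∣ a := by
      refine ⟨C (-t / s), ?_⟩
      have hs' : (C s⁻¹ : Form) * C s = 1 := by rw [← map_mul, inv_mul_cancel₀ hs, map_one]
      rw [neg_div, div_eq_mul_inv, map_neg, map_mul]
      linear_combination C s⁻¹ * hst - a * hs'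
    exact not_isUnit_of_isHomogeneous hb hi (h this (dvd_refl _))
  exact ⟨key ha hb h hst, key hb ha h.symm (by rwa [add_comm])⟩

/-- The linear form with given coefficients. -/
noncomputable def linForm (r : Fin 3 → ℂ) : Form := ∑ i, C (r i) * X i

lemma linForm_isHomogeneous (r : Fin 3 → ℂ) : (linForm r).IsHomogeneous 1 :=
  IsHomogeneous.sum _ _ _ fun _ _ => isHomogeneous_C_mul_X _ _

lemma aeval_linForm {B : Type*} [CommRing B] [Algebra ℂ B] (r : Fin 3 → ℂ) (y : Fin 3 → B) :
    aeval y (linForm r) = ∑ i, algebraMap ℂ B (r i) * y i := by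
  simp [linForm]

lemma eval_linForm (r x : Fin 3 → ℂ) : eval x (linForm r) = ∑ i, r i * x i := by
  simp [linForm]

lemma linForm_ne_zero {r : Fin 3 → ℂ} (hr : r ≠ 0) : ∃ x, eval x (linForm r) ≠ 0 := by
  obtain ⟨i, hi⟩ := Function.ne_iff.mp hr
  refine ⟨Pi.single i 1, ?_⟩
  rw [eval_linForm, Finset.sum_eq_single i (fun j _ hj => by simp [hj]) (by simp)]
  simpa using hi

lemma exists_linForm_eval_eq_zero (x y : Fin 3 → ℂ) :
    ∃ r ≠ 0, eval x (linForm r) = 0 ∧ eval y (linForm r) = 0 := by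
  have hdet : (Matrix.of ![x, y, 0]).det = 0 := Matrix.det_eq_zero_of_row_eq_zero 2 (by simp)
  obtain ⟨r, hr, h⟩ := Matrix.exists_mulVec_eq_zero_iff.mpr hdet
  refine ⟨r, hr, ?_, ?_⟩
  · have := congrFun h 0
    simpa [Matrix.mulVec, dotProduct, eval_linForm, mul_comm] using this
  · have := congrFun h 1
    simpa [Matrix.mulVec, dotProduct, eval_linForm, mul_comm] using this

/-! ### Values of forms in local coordinates -/

lemma constantCoeff_aeval {P : Plane} {Φ : Fin 3 → Series} (hΦ : IsLocalParam P Φ) (G : Form) :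
    MvPowerSeries.constantCoeff (aeval Φ G) = value G P := by
  have : (MvPowerSeries.constantCoeff (σ := Fin 2) (R := ℂ)).comp (aeval Φ : Form →ₐ[ℂ] Series).toRingHom
      = eval P.rep := by
    refine MvPolynomial.ringHom_ext (fun c => ?_) fun i => ?_
    · simp only [RingHom.comp_apply, AlgHom.toRingHom_eq_coe, RingHom.coe_coe, aeval_C, eval_C]
      exact MvPowerSeries.constantCoeff_C c
    · simp [hΦ.1 i]
  exact DFunLike.congr_fun this G

lemma coeff_axis_linForm {Φ : Fin 3 → Series} (r : Fin 3 → ℂ) :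
    PowerSeries.coeff 1 (axis 1 (aeval Φ (linForm r))) =
      eval (fun i => MvPowerSeries.coeff (Finsupp.single 1 1) (Φ i)) (linForm r) := by
  rw [aeval_linForm, eval_linForm, coeff_axis, map_sum]
  refine Finset.sum_congr rfl fun i _ => ?_
  exact MvPowerSeries.coeff_C_mul _ _ _

/-! ### Two pencils -/

section Pencil

variable {f g a b w n n' : Form}

/-- Eliminating $a$ gives $w(c'f-cg)=(c'n-cn')b$. The line $w$ does not divide $b$, so it divides
the linear form $c'n-cn'$, and the quotient is the constant $\kappa$. -/
lemma pencil_of_mul_mem (hf : f.IsHomogeneous 2) (hg : g.IsHomogeneous 2) (hfg : IsRelPrime f g)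
    (ha : a.IsHomogeneous 3) (hb : b.IsHomogeneous 2) (hab : IsRelPrime a b)
    (hw : w.IsHomogeneous 1) (hw0 : w ≠ 0) (hn : n.IsHomogeneous 1) (hn' : n'.IsHomogeneous 1)
    {c c' : ℂ} (h1 : w * f = C c * a + n * b) (h2 : w * g = C c' * a + n' * b) :
    ∃ κ : ℂ, κ ≠ 0 ∧ C c' * f - C c * g = C κ * b := by
  have hwp := prime_of_isHomogeneous_one hw hw0
  have hb0 := ne_zero_of_isRelPrime ha three_ne_zero hab
  -- If $b=wb'$, then $w\nmid a$ forces $c=c'=0$, and $b'$ divides both $f$ and $g$.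
  have hwb : ¬ w ∣ b := by
    intro hwb
    have key : ∀ {f n : Form} {c : ℂ}, w * f = C c * a + n * b → c = 0 := by
      intro f n c h
      by_contra hc
      have h3 : w ∣ C c * a := by
        rw [show C c * a = w * f - n * b by rw [h]; ring]
        exact dvd_sub (dvd_mul_right _ _) (dvd_mul_of_dvd_right hwb _)
      have h4 : w ∣ a := ((isUnit_iff_ne_zero.mpr hc).map C).dvd_mul_left.mp h3
      exact hwp.not_isUnit (hab h4 hwb)
    obtain rfl := key h1
    obtain rfl := key h2
    obtain ⟨b', hb', rfl⟩ := exists_isHomogeneous_of_dvd (k := 1) hw hb rfl hwb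
    rw [map_zero, zero_mul, zero_add] at h1 h2
    refine not_isUnit_of_isHomogeneous hb' one_ne_zero (hfg ⟨n, ?_⟩ ⟨n', ?_⟩)
    · exact mul_left_cancel₀ hw0 (by rw [h1]; ring)
    · exact mul_left_cancel₀ hw0 (by rw [h2]; ring)
  have h3 : w * (C c' * f - C c * g) = (C c' * n - C c * n') * b := by
    linear_combination C c' * h1 - C c * h2
  have h4 : w ∣ C c' * n - C c * n' := (hwp.dvd_or_dvd ⟨_, h3.symm⟩).resolve_right hwb
  have hC : ∀ {G : Form} {d : ℕ} (c : ℂ), G.IsHomogeneous d → (C c * G).IsHomogeneous d :=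
    fun c hG => by simpa using (isHomogeneous_C _ c).mul hG
  obtain ⟨κ, hκ⟩ := exists_eq_C_mul_of_dvd hw ((hC c' hn).sub (hC c hn')) h4
  have h5 : C c' * f - C c * g = C κ * b := by
    refine mul_left_cancel₀ hw0 ?_
    rw [h3, hκ]; ring
  refine ⟨κ, ?_, h5⟩
  -- If $\kappa=0$, independence of $f,g$ gives $c=c'=0$; then $w$ divides $n,n'$ and $b$ divides
  -- $f,g$.
  rintro rfl
  rw [map_zero, zero_mul] at h5
  obtain ⟨rfl, hc⟩ := eq_zero_of_isRelPrime hf hg two_ne_zero hfg (s := c') (t := -c)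
    (by rw [map_neg]; linear_combination h5)
  obtain rfl := neg_eq_zero.mp hc
  rw [map_zero, zero_mul, zero_add] at h1 h2
  obtain ⟨ν, rfl⟩ := exists_eq_C_mul_of_dvd hw hn ((hwp.dvd_or_dvd ⟨_, h1.symm⟩).resolve_right hwb)
  obtain ⟨ν', rfl⟩ := exists_eq_C_mul_of_dvd hw hn' ((hwp.dvd_or_dvd ⟨_, h2.symm⟩).resolve_right hwb)
  refine not_isUnit_of_isHomogeneous hb two_ne_zero (hfg ⟨C ν, ?_⟩ ⟨C ν', ?_⟩)
  · exact mul_left_cancel₀ hw0 (by rw [h1]; ring)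
  · exact mul_left_cancel₀ hw0 (by rw [h2]; ring)

lemma exists_pencil (hf : f.IsHomogeneous 2) (hg : g.IsHomogeneous 2)
    (ha : a.IsHomogeneous 3) (hb : b.IsHomogeneous 2) (hw : w.IsHomogeneous 1)
    (h1 : w * f ∈ Ideal.span {a, b}) (h2 : w * g ∈ Ideal.span {a, b}) :
    ∃ (c c' : ℂ) (n n' : Form), n.IsHomogeneous 1 ∧ n'.IsHomogeneous 1 ∧
      w * f = C c * a + n * b ∧ w * g = C c' * a + n' * b := by
  obtain ⟨p, n, hp, hn, e1⟩ := exists_isHomogeneous_of_mem_span (k := 0) (l := 1) (n := 3) ha hb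
    (by simpa using hw.mul hf) rfl rfl h1
  obtain ⟨p', n', hp', hn', e2⟩ := exists_isHomogeneous_of_mem_span (k := 0) (l := 1) (n := 3) ha hb
    (by simpa using hw.mul hg) rfl rfl h2
  obtain ⟨c, rfl⟩ := exists_eq_C_of_isHomogeneous hp
  obtain ⟨c', rfl⟩ := exists_eq_C_of_isHomogeneous hp'
  exact ⟨c, c', n, n', hn, hn', e1, e2⟩

/-- Both lines produce the same member $b$ of the pencil, so a suitable nonzero combination of them
has $c=c'=0$, contradicting $\kappa\neq0$. The point $z$ certifies independence. -/
lemma false_of_two_mul_mem (hf : f.IsHomogeneous 2) (hg : g.IsHomogeneous 2) (hfg : IsRelPrime f g)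
    (ha : a.IsHomogeneous 3) (hb : b.IsHomogeneous 2) (hab : IsRelPrime a b) {w₁ w₂ : Form}
    (hw₁ : w₁.IsHomogeneous 1) (hw₂ : w₂.IsHomogeneous 1) {z : Fin 3 → ℂ} (hz : eval z w₁ ≠ 0)
    (hz2 : eval z w₂ = 0) (hw20 : w₂ ≠ 0)
    (h1 : w₁ * f ∈ Ideal.span {a, b}) (h2 : w₁ * g ∈ Ideal.span {a, b})
    (h3 : w₂ * f ∈ Ideal.span {a, b}) (h4 : w₂ * g ∈ Ideal.span {a, b}) : False := by
  obtain ⟨c₁, c₁', n₁, n₁', hn₁, hn₁', e1, e1'⟩ := exists_pencil hf hg ha hb hw₁ h1 h2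
  obtain ⟨c₂, c₂', n₂, n₂', hn₂, hn₂', e2, e2'⟩ := exists_pencil hf hg ha hb hw₂ h3 h4
  obtain ⟨κ₁, hκ₁, k1⟩ := pencil_of_mul_mem hf hg hfg ha hb hab hw₁ (by rintro rfl; simp at hz)
    hn₁ hn₁' e1 e1'
  obtain ⟨κ₂, hκ₂, k2⟩ := pencil_of_mul_mem hf hg hfg ha hb hab hw₂ hw20 hn₂ hn₂' e2 e2'
  have hC : ∀ {G : Form} {d : ℕ} (c : ℂ), G.IsHomogeneous d → (C c * G).IsHomogeneous d :=
    fun c hG => by simpa using (isHomogeneous_C _ c).mul hG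
  obtain ⟨hc', hc⟩ := eq_zero_of_isRelPrime hf hg two_ne_zero hfg (s := κ₂ * c₁' - κ₁ * c₂')
    (t := -(κ₂ * c₁ - κ₁ * c₂)) (by
      simp only [map_sub, map_neg, map_mul]
      linear_combination C κ₂ * k1 - C κ₁ * k2)
  rw [neg_eq_zero] at hc
  obtain ⟨κ, hκ, k3⟩ := pencil_of_mul_mem (w := C κ₂ * w₁ - C κ₁ * w₂) (c := 0) (c' := 0)
    (n := C κ₂ * n₁ - C κ₁ * n₂) (n' := C κ₂ * n₁' - C κ₁ * n₂') hf hg hfg ha hb hab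
    ((hC _ hw₁).sub (hC _ hw₂)) (by
      intro h
      have := congrArg (eval z) h
      simp [hz2, hκ₂, hz] at this)
    ((hC _ hn₁).sub (hC _ hn₂)) ((hC _ hn₁').sub (hC _ hn₂'))
    (by
      have := congrArg (C : ℂ → Form) hc
      simp only [map_sub, map_mul, map_zero] at this ⊢
      linear_combination C κ₂ * e1 - C κ₁ * e2 + a * this)
    (by
      have := congrArg (C : ℂ → Form) hc'
      simp only [map_sub, map_mul, map_zero] at this ⊢
      linear_combination C κ₂ * e1' - C κ₁ * e2' + a * this)
  rw [map_zero, zero_mul, zero_mul, sub_zero, eq_comm, mul_eq_zero] at k3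
  rcases k3 with h | h
  · exact hκ (by simpa using h)
  · exact ne_zero_of_isRelPrime ha three_ne_zero hab h

end Pencil
end SemiTorus

namespace SemiTorus
open MvPolynomial

/-! ### Nice sextics with simple inner singularities -/

/-- The standing assumptions on a sextic of semi-torus type. -/
structure IsGood (f g h : Form) : Prop where
  hf : f.IsHomogeneous 2
  hg : g.IsHomogeneous 2
  hh : h.IsHomogeneous 2
  finite : {P : Plane | value f P = 0 ∧ value g P = 0}.Finite
  value_ne : ∀ P, value f P = 0 → value g P = 0 → value h P ≠ 0
  hasType : ∀ P, value f P = 0 → value g P = 0 → ∃ τ, HasType (sextic f g h) P τ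

variable {f g h a b : Form}

lemma isSingularAt_sextic {P : Plane} (hf : value f P = 0) (hg : value g P = 0) :
    IsSingularAt (sextic f g h) P := by
  unfold value at hf hg
  refine ⟨by simp [value, sextic, hf, hg], fun i => ?_⟩
  simp [value, sextic, Derivation.leibniz, Derivation.leibniz_pow, hf, hg]

lemma IsGood.of_isInnerConfiguration (hf : f.IsHomogeneous 2) (hg : g.IsHomogeneous 2)
    (hh : h.IsHomogeneous 2) (hnice : IsNice f g h) {S : Multiset SimpleType}
    (hS : IsInnerConfiguration f g h S) : IsGood f g h := by
  obtain ⟨T, type, hT, hT', -⟩ := hS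
  have key : ∀ P, value f P = 0 → value g P = 0 → P ∈ T := fun P hfP hgP =>
    (hT P).mpr ⟨isSingularAt_sextic hfP hgP, hfP, hgP, hnice P⟩
  exact ⟨hf, hg, hh, T.finite_toSet.subset fun P hP => key P hP.1 hP.2,
    fun P hfP hgP hhP => hnice P ⟨isSingularAt_sextic hfP hgP, hfP, hgP, hhP⟩,
    fun P hfP hgP => ⟨_, hT' P (key P hfP hgP)⟩⟩

lemma IsGood.isRelPrime (H : IsGood f g h) : IsRelPrime f g :=
  isRelPrime_of_finite H.hf H.hg H.finite

/-- The local equation of the sextic at an inner singularity. -/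
lemma IsGood.exists_local (H : IsGood f g h) {P : Plane} (hfP : value f P = 0)
    (hgP : value g P = 0) : ∃ (τ : SimpleType) (Φ : Fin 3 → Series) (e : Series), τ.Valid ∧ IsLocalParam P Φ ∧
      MvPowerSeries.constantCoeff e ≠ 0 ∧ aeval Φ (sextic f g h) = e * τ.normalForm ∧
      τ.IsCuspidal ∧ 1 ≤ τ.cuspOrder ∧
      ∀ G, G ∈ Ideal.span {aeval Φ g, aeval Φ f} ↔ PowerSeries.X ^ τ.cuspOrder ∣ axis 1 G := by
  obtain ⟨τ, hτ, Φ, hΦ, e, he, heq⟩ := H.hasType P hfP hgP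
  rw [isUnit_iff_constantCoeff_ne_zero] at he
  obtain ⟨h1, h2, h3⟩ := cube_add_sq_eq_normalForm (a := aeval Φ g) (b := aeval Φ f) (ε := aeval Φ h)
    hτ (by rw [constantCoeff_aeval hΦ, hgP]) (by rw [constantCoeff_aeval hΦ, hfP]) he
    (by rw [constantCoeff_aeval hΦ]; exact H.value_ne P hfP hgP)
    (by rw [← heq, sextic, map_add, map_mul, map_pow, map_pow]; ring)
  exact ⟨τ, Φ, e, hτ, hΦ, he, heq, h1, h2, h3⟩

/-- The coordinates and the criterion are those of `IsGood.exists_local`, so the local ideals of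
$(a,b)$ and $(g,f)$ can be compared. -/
lemma cube_add_sq_local {P : Plane} {Φ : Fin 3 → Series} {F : Form} (hF : F = a ^ 2 + b ^ 3)
    {τ : SimpleType} {e : Series} (hτ : τ.Valid)
    (hΦ : IsLocalParam P Φ) (he : MvPowerSeries.constantCoeff e ≠ 0)
    (heq : aeval Φ F = e * τ.normalForm) (haP : value a P = 0) (hbP : value b P = 0) :
    τ.IsCuspidal ∧ 1 ≤ τ.cuspOrder ∧
      ∀ G, G ∈ Ideal.span {aeval Φ a, aeval Φ b} ↔ PowerSeries.X ^ τ.cuspOrder ∣ axis 1 G :=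
  cube_add_sq_eq_normalForm (a := aeval Φ a) (b := aeval Φ b) (ε := 1)
    hτ (by rw [constantCoeff_aeval hΦ, haP]) (by rw [constantCoeff_aeval hΦ, hbP]) he (by simp)
    (by rw [← heq, hF, map_add, map_pow, map_pow]; ring)

/-! ### Decompositions into a square and a cube -/

/-- A common zero of $a,b$ is a singular point, and a simple germ there is cuspidal; outside $E$
only inner points remain. -/
lemma eq_zero_of_cube_add_sq (hF : sextic f g h = a ^ 2 + b ^ 3) {E : Set Plane}
    (hE : NoFurtherCusps f g h E) {P : Plane} (haP : value a P = 0) (hbP : value b P = 0)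
    (hP : P ∉ E) : value f P = 0 ∧ value g P = 0 := by
  have hsing : IsSingularAt (sextic f g h) P := by
    unfold value at haP hbP
    rw [hF]
    refine ⟨by simp [value, haP, hbP], fun i => ?_⟩
    simp [value, Derivation.leibniz_pow, haP, hbP]
  by_contra hcon
  obtain ⟨τ, ⟨hτ, Φ, hΦ, e, he, heq⟩, hc⟩ := hE P hsing (fun h => hcon ⟨h.2.1, h.2.2.1⟩) hP
  rw [isUnit_iff_constantCoeff_ne_zero] at he
  exact hc (cube_add_sq_local hF hτ hΦ he heq haP hbP).1

lemma finite_of_cube_add_sq (H : IsGood f g h) (hF : sextic f g h = a ^ 2 + b ^ 3) {E : Set Plane}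
    (hfin : E.Finite) (hE : NoFurtherCusps f g h E) :
    {P : Plane | value a P = 0 ∧ value b P = 0}.Finite := by
  refine (hfin.union H.finite).subset fun P hP => ?_
  by_cases hPE : P ∈ E
  · exact Or.inl hPE
  · exact Or.inr (eq_zero_of_cube_add_sq hF hE hP.1 hP.2 hPE)

/-- At inner common zeros $f,g$ already lie in the local ideal $(a,b)$; at the points of $E$ the
factor $w$ does. -/
lemma mul_mem_of_cube_add_sq (H : IsGood f g h) (ha : a.IsHomogeneous 3) (hb : b.IsHomogeneous 2)
    (hF : sextic f g h = a ^ 2 + b ^ 3) {E : Set Plane} (hfin : E.Finite)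
    (hE : NoFurtherCusps f g h E) {w : Form}
    (hw : ∀ P ∈ E, value a P = 0 → value b P = 0 →
      ∃ (n : ℕ) (s : Form), s.IsHomogeneous n ∧ value s P ≠ 0 ∧ s * w ∈ Ideal.span {a, b}) :
    w * f ∈ Ideal.span {a, b} ∧ w * g ∈ Ideal.span {a, b} := by
  have key : ∀ G : Form, G = f ∨ G = g → w * G ∈ Ideal.span {a, b} := by
    intro G hG
    refine mem_span_of_local ha hb (finite_of_cube_add_sq H hF hfin hE) fun P haP hbP => ?_
    by_cases hPE : P ∈ E
    · obtain ⟨n, s, hs, hsP, hsw⟩ := hw P hPE haP hbP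
      exact ⟨n, s, hs, hsP, by rw [← mul_assoc]; exact Ideal.mul_mem_right _ _ hsw⟩
    · obtain ⟨hfP, hgP⟩ := eq_zero_of_cube_add_sq hF hE haP hbP hPE
      obtain ⟨τ, Φ, e, hτ, hΦ, he, heq, -, -, h1⟩ := H.exists_local hfP hgP
      obtain ⟨-, -, h2⟩ := cube_add_sq_local hF hτ hΦ he heq haP hbP
      have hG2 : G.IsHomogeneous 2 := by rcases hG with rfl | rfl; exacts [H.hf, H.hg]
      obtain ⟨n, s, hs, hsP, hsG⟩ := exists_mul_mem_span hΦ ha hb hG2 (by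
        rw [h2, ← h1]
        refine Ideal.subset_span ?_
        rcases hG with rfl | rfl <;> simp)
      exact ⟨n, s, hs, hsP, by rw [mul_left_comm]; exact Ideal.mul_mem_left _ _ hsG⟩
  exact ⟨key f (Or.inl rfl), key g (Or.inr rfl)⟩

/-- The linear forms satisfying the conditions at the exceptional points determine a pencil. -/
lemma false_of_forall_mul_mem (H : IsGood f g h) (ha : a.IsHomogeneous 3) (hb : b.IsHomogeneous 2)
    (hab : IsRelPrime a b) (x : Fin 3 → ℂ)
    (hw : ∀ r, eval x (linForm r) = 0 →
      linForm r * f ∈ Ideal.span {a, b} ∧ linForm r * g ∈ Ideal.span {a, b}) : False := by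
  obtain ⟨r, hr, hrx, -⟩ := exists_linForm_eval_eq_zero x x
  obtain ⟨z, hz⟩ := linForm_ne_zero hr
  obtain ⟨r', hr', hrx', hrz'⟩ := exists_linForm_eval_eq_zero x z
  obtain ⟨z', hz'⟩ := linForm_ne_zero hr'
  exact false_of_two_mul_mem H.hf H.hg H.isRelPrime ha hb hab (linForm_isHomogeneous r)
    (linForm_isHomogeneous r') hz hrz' (by rintro h; rw [h, map_zero] at hz'; exact hz' rfl)
    (hw r hrx).1 (hw r hrx).2 (hw r' hrx').1 (hw r' hrx').2

/-- At an $A_2$ the ideal $(a,b)$ is maximal, so $w$ need only vanish there. If $P,Q$ are both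
common zeros, $w$ is the line $PQ$ and $c'f-cg=\kappa b$ is evaluated at both points. Otherwise a
whole pencil of lines is available. -/
theorem not_cube_add_sq_of_two_cusps (H : IsGood f g h) {P Q : Plane}
    (hP : HasType (sextic f g h) P (.A 2)) (hQ : HasType (sextic f g h) Q (.A 2))
    (hfg : value f P * value g Q - value f Q * value g P ≠ 0)
    (hE : NoFurtherCusps f g h {P, Q}) (ha : a.IsHomogeneous 3) (hb : b.IsHomogeneous 2) :
    sextic f g h ≠ a ^ 2 + b ^ 3 := by
  intro hF
  have hfin : ({P, Q} : Set Plane).Finite := by simp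
  have hab := isRelPrime_of_finite ha hb (finite_of_cube_add_sq H hF hfin hE)
  have hloc : ∀ {R : Plane} (_ : HasType (sextic f g h) R (.A 2)) (_ : value a R = 0)
      (_ : value b R = 0) {w : Form} (_ : w.IsHomogeneous 1) (_ : value w R = 0),
      ∃ (n : ℕ) (s : Form), s.IsHomogeneous n ∧ value s R ≠ 0 ∧ s * w ∈ Ideal.span {a, b} := by
    rintro R ⟨hτ, Φ, hΦ, e, he, heq⟩ haR hbR w hw hwR
    rw [isUnit_iff_constantCoeff_ne_zero] at he
    obtain ⟨-, -, h2⟩ := cube_add_sq_local hF hτ hΦ he heq haR hbR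
    refine exists_mul_mem_span hΦ ha hb hw ((h2 _).mpr ?_)
    rw [show SimpleType.cuspOrder (.A 2) = 1 from rfl, pow_one]
    exact X_dvd_axis 1 (by rw [constantCoeff_aeval hΦ, hwR])
  by_cases hPab : value a P = 0 ∧ value b P = 0
  · by_cases hQab : value a Q = 0 ∧ value b Q = 0
    · obtain ⟨r, hr, hrP, hrQ⟩ := exists_linForm_eval_eq_zero P.rep Q.rep
      obtain ⟨h1, h2⟩ := mul_mem_of_cube_add_sq H ha hb hF hfin hE (w := linForm r) (by
        rintro R (rfl | rfl) haR hbR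
        · exact hloc hP haR hbR (linForm_isHomogeneous r) hrP
        · exact hloc hQ haR hbR (linForm_isHomogeneous r) hrQ)
      obtain ⟨c, c', n, n', hn, hn', e1, e2⟩ := exists_pencil H.hf H.hg ha hb
        (linForm_isHomogeneous r) h1 h2
      obtain ⟨z, hz⟩ := linForm_ne_zero hr
      obtain ⟨κ, hκ, k⟩ := pencil_of_mul_mem H.hf H.hg H.isRelPrime ha hb hab
        (linForm_isHomogeneous r) (by rintro h; rw [h, map_zero] at hz; exact hz rfl) hn hn' e1 e2
      have kP := congrArg (eval P.rep) k
      have kQ := congrArg (eval Q.rep) k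
      obtain ⟨-, hbP⟩ := hPab
      obtain ⟨-, hbQ⟩ := hQab
      simp only [map_sub, map_mul, eval_C] at kP kQ
      unfold value at hbP hbQ hfg
      rw [hbP, mul_zero] at kP
      rw [hbQ, mul_zero] at kQ
      have hc' : c' = 0 := (mul_eq_zero.mp (show c' * (eval P.rep f * eval Q.rep g -
        eval Q.rep f * eval P.rep g) = 0 by
          linear_combination (eval Q.rep g) * kP - (eval P.rep g) * kQ)).resolve_right hfg
      have hc : c = 0 := (mul_eq_zero.mp (show c * (eval P.rep f * eval Q.rep g -
        eval Q.rep f * eval P.rep g) = 0 by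
          linear_combination (eval Q.rep f) * kP - (eval P.rep f) * kQ)).resolve_right hfg
      rw [hc, hc', map_zero, zero_mul, zero_mul, sub_zero, eq_comm, mul_eq_zero] at k
      rcases k with h | h
      · exact hκ (by simpa using h)
      · exact ne_zero_of_isRelPrime ha three_ne_zero hab h
    · refine false_of_forall_mul_mem H ha hb hab P.rep fun r hr =>
        mul_mem_of_cube_add_sq H ha hb hF hfin hE ?_
      rintro R (rfl | rfl) haR hbR
      · exact hloc hP haR hbR (linForm_isHomogeneous r) hr
      · exact absurd ⟨haR, hbR⟩ hQab
  · refine false_of_forall_mul_mem H ha hb hab Q.rep fun r hr =>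
      mul_mem_of_cube_add_sq H ha hb hF hfin hE ?_
    rintro R (rfl | rfl) haR hbR
    · exact absurd ⟨haR, hbR⟩ hPab
    · exact hloc hQ haR hbR (linForm_isHomogeneous r) hr

/-! ### Tangent cones -/

lemma tangentCone_eq {F : Form} {P : Plane} {k : ℕ} {φ : (Fin 3 → ℂ) → ℂ}
    (h0 : ∀ j < k, ∀ u, (alongLine F P u).coeff j = 0)
    (h : ∀ u, (alongLine F P u).coeff k = φ u) (hφ : ∃ u, φ u ≠ 0) :
    tangentCone F P = {w | φ w = 0} := by
  ext w
  refine ⟨fun hw => ?_, fun hw j hj => ?_⟩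
  · rw [Set.mem_ofPred_eq, ← h]; exact hw k h0
  · obtain ⟨u, hu⟩ := hφ
    rcases lt_trichotomy j k with h1 | h1 | h1
    · exact h0 j h1 w
    · rw [h1, h]; exact hw
    · exact absurd (hj k h1 u) (by rw [h]; exact hu)

lemma alongLine_mul (F G : Form) (P : Plane) (w : Fin 3 → ℂ) :
    alongLine (F * G) P w = alongLine F P w * alongLine G P w := map_mul _ _ _

lemma alongLine_add (F G : Form) (P : Plane) (w : Fin 3 → ℂ) :
    alongLine (F + G) P w = alongLine F P w + alongLine G P w := map_add _ _ _

lemma alongLine_C (c : ℂ) (P : Plane) (w : Fin 3 → ℂ) :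
    alongLine (C c) P w = Polynomial.C c := aeval_C _ _

lemma coeff_zero_alongLine (F : Form) (P : Plane) (w : Fin 3 → ℂ) :
    (alongLine F P w).coeff 0 = value F P := by
  rw [Polynomial.coeff_zero_eq_eval_zero]
  have : (Polynomial.aeval (0 : ℂ)).comp (aeval (fun i => Polynomial.C (P.rep i)
      + Polynomial.X * Polynomial.C (w i)) : Form →ₐ[ℂ] Polynomial ℂ) = aeval P.rep := by
    ext i; simp
  have := DFunLike.congr_fun this F
  simpa [aeval_eq_eval, alongLine, value] using this

lemma coeff_one_mul (p q : Polynomial ℂ) :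
    (p * q).coeff 1 = p.coeff 1 * q.coeff 0 + p.coeff 0 * q.coeff 1 := by
  simp [Polynomial.coeff_mul, Finset.Nat.antidiagonal_succ]; ring

lemma coeff_two_mul (p q : Polynomial ℂ) :
    (p * q).coeff 2 = p.coeff 2 * q.coeff 0 + p.coeff 1 * q.coeff 1 + p.coeff 0 * q.coeff 2 := by
  simp [Polynomial.coeff_mul, Finset.Nat.antidiagonal_succ]; ring

lemma coeff_one_alongLine_linForm (r : Fin 3 → ℂ) (P : Plane) (w : Fin 3 → ℂ) :
    (alongLine (linForm r) P w).coeff 1 = eval w (linForm r) := by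
  rw [alongLine, aeval_linForm, eval_linForm, Polynomial.finsetSum_coeff]
  refine Finset.sum_congr rfl fun i _ => ?_
  rw [← Polynomial.C_eq_algebraMap, Polynomial.coeff_C_mul]
  simp

end SemiTorus

/-! ### Square plus cube: the case of an outer $A_5$ -/

namespace SemiTorus
open MvPolynomial
variable {f g h a b : Form}

lemma pderiv_linForm (r : Fin 3 → ℂ) (i : Fin 3) : pderiv i (linForm r) = C (r i) := by
  simp only [linForm, map_sum, pderiv_C_mul, pderiv_X]
  rw [Finset.sum_eq_single i]
  · simp
  · intro j _ hj; simp [hj]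
  · simp

/-- The tangent line of a product of a line through `P` and a form not vanishing at `P`. -/
lemma tangentConeIsTangentOf_of_eq {F J m : Form} {P : Plane} {r : Fin 3 → ℂ} (hr : r ≠ 0)
    (hrP : value (linForm r) P = 0) (hmP : value m P ≠ 0) (hJ : J = linForm r * m)
    {K : ℂ} (hK : K ≠ 0) (h0 : ∀ j < 2, ∀ u, (alongLine F P u).coeff j = 0)
    (h2 : ∀ u, (alongLine F P u).coeff 2 = (K * eval u (linForm r)) ^ 2) :
    TangentConeIsTangentOf F J P := by
  obtain ⟨z, hz⟩ := linForm_ne_zero hr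
  refine ⟨?_, fun hs => ?_, ?_⟩
  · unfold value at *; simp [hJ, hrP]
  · obtain ⟨i, hi⟩ := Function.ne_iff.mp hr
    have := hs.2 i
    unfold value at *
    simp [hJ, Derivation.leibniz, pderiv_linForm, hrP, hmP] at this
    exact hi this
  · rw [tangentCone_eq (k := 1) (F := J) (φ := fun u => value m P * eval u (linForm r)) ?_ ?_
      ⟨z, mul_ne_zero hmP hz⟩, tangentCone_eq h0 h2 ⟨z, pow_ne_zero 2 (mul_ne_zero hK hz)⟩]
    · ext u; simp [hK, hmP]
    · intro j hj u
      obtain rfl : j = 0 := by omega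
      rw [coeff_zero_alongLine, hJ]
      unfold value at *; simp [hrP]
    · intro u
      rw [hJ, alongLine_mul, coeff_one_mul, coeff_one_alongLine_linForm, coeff_zero_alongLine,
        coeff_zero_alongLine, hrP]
      ring

/-- At $P$ the ideal $(a,b)$ is $(u,v^2)$, so $w$ may be the tangent line of $u=0$. Writing
$f=\gamma b+\delta g$ and $a=\zeta wg+mb$ and expanding in powers of $g$ gives $b=\theta wm$. The
tangent cone of $F$ is then $w^2=0$, and $w$ is tangent to the conic. -/
theorem not_cube_add_sq_of_A5 (H : IsGood f g h) {P : Plane}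
    (hP : HasType (sextic f g h) P (.A 5)) (hfP : value f P ≠ 0) (hgP : value g P ≠ 0)
    (htan : ¬ TangentConeIsTangentOf (sextic f g h) (C (value g P) * f - C (value f P) * g) P)
    (hE : NoFurtherCusps f g h {P}) (ha : a.IsHomogeneous 3) (hb : b.IsHomogeneous 2) :
    sextic f g h ≠ a ^ 2 + b ^ 3 := by
  intro hF
  have hfin : ({P} : Set Plane).Finite := by simp
  have hab := isRelPrime_of_finite ha hb (finite_of_cube_add_sq H hF hfin hE)
  by_cases hPab : value a P = 0 ∧ value b P = 0
  swap
  · refine false_of_forall_mul_mem H ha hb hab 0 fun r hr =>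
      mul_mem_of_cube_add_sq H ha hb hF hfin hE ?_
    rintro R rfl haR hbR
    exact absurd ⟨haR, hbR⟩ hPab
  obtain ⟨haP, hbP⟩ := hPab
  obtain ⟨hτ, Φ, hΦ, e, he, heq⟩ := hP
  rw [isUnit_iff_constantCoeff_ne_zero] at he
  obtain ⟨-, -, hspan⟩ := cube_add_sq_local hF hτ hΦ he heq haP hbP
  obtain ⟨k, -, hk, -, -, hbk, hak⟩ := cube_add_sq_eq_A (a := aeval Φ a) (b := aeval Φ b) (ε := 1)
    (e := e) (N := 6) (by rw [constantCoeff_aeval hΦ, haP]) (by rw [constantCoeff_aeval hΦ, hbP])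
    he (by simp) (by norm_num)
    (by
      have := heq
      rw [hF, map_add, map_pow, map_pow] at this
      rw [one_mul, add_comm, this]; rfl)
  obtain rfl : k = 2 := by omega
  obtain ⟨r, hr, hrP, hrv⟩ := exists_linForm_eval_eq_zero P.rep
    (fun i => MvPowerSeries.coeff (Finsupp.single 1 1) (Φ i))
  obtain ⟨z, hz⟩ := linForm_ne_zero hr
  set w := linForm r with hw_def
  have hw : w.IsHomogeneous 1 := linForm_isHomogeneous r
  have hw0 : w ≠ 0 := by intro h; rw [h, map_zero] at hz; exact hz rfl
  have hwX : PowerSeries.X ^ 2 ∣ axis 1 (aeval Φ w) := by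
    rw [PowerSeries.X_pow_dvd_iff]
    intro m hm
    interval_cases m
    · rw [PowerSeries.coeff_zero_eq_constantCoeff_apply, constantCoeff_axis,
        constantCoeff_aeval hΦ]
      exact hrP
    · rw [hw_def, coeff_axis_linForm]; exact hrv
  obtain ⟨h1, h2⟩ := mul_mem_of_cube_add_sq H ha hb hF hfin hE (w := w) (by
    rintro R rfl - -
    exact exists_mul_mem_span hΦ ha hb hw ((hspan _).mpr hwX))
  obtain ⟨c, c', n, n', hn, hn', e1, e2⟩ := exists_pencil H.hf H.hg ha hb hw h1 h2
  obtain ⟨κ, hκ, hk⟩ := pencil_of_mul_mem H.hf H.hg H.isRelPrime ha hb hab hw hw0 hn hn' e1 e2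
  have hb0 := ne_zero_of_isRelPrime ha three_ne_zero hab
  have hcP : c' * value f P = c * value g P := by
    have := congrArg (eval P.rep) hk
    unfold value at *
    simp only [map_sub, map_mul, eval_C, hbP, mul_zero] at this
    linear_combination this
  have hc' : c' ≠ 0 := by
    rintro rfl
    rw [zero_mul, eq_comm, mul_eq_zero] at hcP
    obtain rfl := hcP.resolve_right hgP
    rw [map_zero, zero_mul, zero_mul, sub_zero, eq_comm, mul_eq_zero] at hk
    rcases hk with h | h
    · exact hκ (by simpa using h)
    · exact hb0 h
  have hc : c ≠ 0 := by
    rintro rfl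
    rw [zero_mul, mul_eq_zero] at hcP
    exact hcP.elim hc' hfP
  obtain ⟨γ, δ, hγ, hδ, hfe, hδP⟩ : ∃ γ δ : ℂ, γ ≠ 0 ∧ δ ≠ 0 ∧ f = C γ * b + C δ * g ∧
      value f P = δ * value g P := by
    refine ⟨κ / c', c / c', div_ne_zero hκ hc', div_ne_zero hc hc', ?_, ?_⟩
    · have h3 : (C c'⁻¹ : Form) * C c' = 1 := by rw [← map_mul, inv_mul_cancel₀ hc', map_one]
      rw [div_eq_mul_inv, div_eq_mul_inv, map_mul, map_mul]
      linear_combination C c'⁻¹ * hk - f * h3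
    · field_simp; linear_combination hcP
  obtain ⟨l, m, ζ, hζ, hl, hm, hae⟩ : ∃ (l m : Form) (ζ : ℂ), ζ ≠ 0 ∧ l = C ζ * w ∧
      m.IsHomogeneous 1 ∧ a = l * g + m * b := by
    refine ⟨_, C (γ / c) * w - C (1 / c) * n, δ / c, div_ne_zero hδ hc, rfl, ?_, ?_⟩
    · exact (by simpa using (isHomogeneous_C _ _).mul hw : (C (γ / c) * w).IsHomogeneous 1).sub
        (by simpa using (isHomogeneous_C _ _).mul hn)
    · have h3 : (C c⁻¹ : Form) * C c = 1 := by rw [← map_mul, inv_mul_cancel₀ hc, map_one]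
      rw [div_eq_mul_inv, div_eq_mul_inv, div_eq_mul_inv, map_mul, map_mul, map_mul, map_one]
      linear_combination -C c⁻¹ * e1 - a * h3 + C c⁻¹ * w * hfe
  have hgb : IsRelPrime g b := fun d hd1 hd2 => H.isRelPrime
    (by rw [hfe]; exact dvd_add (dvd_mul_of_dvd_right hd2 _) (dvd_mul_of_dvd_right hd1 _)) hd1
  have hCh : ∀ {G : Form} {d : ℕ} (c : ℂ), G.IsHomogeneous d → (C c * G).IsHomogeneous d :=
    fun c hG => by simpa using (isHomogeneous_C _ c).mul hG
  have hg0 : g ≠ 0 := ne_zero_of_isRelPrime H.hf two_ne_zero H.isRelPrime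
  have hF' : (C γ * b + C δ * g) ^ 3 + g ^ 2 * h = (l * g + m * b) ^ 2 + b ^ 3 := by
    rw [← hfe, ← hae, ← hF, sextic]
  -- Reduction of the equation modulo $g$, after cancelling $b^2$.
  obtain ⟨ν, hν⟩ := exists_eq_C_mul_of_dvd H.hg ((hCh (γ ^ 3 - 1) hb).sub (hm.pow 2))
    ((hgb.pow_right (n := 2)).dvd_of_dvd_mul_left ⟨-(3 * C γ ^ 2 * C δ * b ^ 2
      + 3 * C γ * C δ ^ 2 * b * g + C δ ^ 3 * g ^ 2 + g * h - l ^ 2 * g - 2 * l * m * b), by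
        rw [map_sub, map_pow, map_one]; linear_combination hF'⟩)
  rw [map_sub, map_pow, map_one] at hν
  have hlm : (2 * l * m).IsHomogeneous 2 := by
    have : (C 2 * (C ζ * w * m)).IsHomogeneous 2 := hCh 2 ((hCh ζ hw).mul hm)
    rw [hl, mul_assoc]
    exact this
  have h4 : b * ((C ν + 3 * C γ ^ 2 * C δ) * b - 2 * l * m)
      = g * -(3 * C γ * C δ ^ 2 * b + C δ ^ 3 * g + h - l ^ 2) := by
    refine mul_left_cancel₀ hg0 ?_
    linear_combination hF' - b ^ 2 * hν
  -- The next order in $g$; evaluation at $P$, where $w$ and $b$ vanish and $g$ does not, gives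
  -- $\rho=0$.
  obtain ⟨ρ, hρ⟩ := exists_eq_C_mul_of_dvd H.hg
    (G := (C ν + 3 * C γ ^ 2 * C δ) * b - 2 * l * m)
    (by
      have := (hCh (ν + 3 * γ ^ 2 * δ) hb).sub hlm
      simpa only [map_add, map_mul, map_pow, show (C 3 : Form) = 3 from rfl] using this)
    (hgb.dvd_of_dvd_mul_left ⟨_, h4⟩)
  have hρ0 : ρ = 0 := by
    have := congrArg (eval P.rep) hρ
    unfold value at *
    simp [hl, hbP, hrP] at this
    exact this.resolve_right hgP
  rw [hρ0, map_zero, zero_mul, sub_eq_zero] at hρ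
  have hη : ν + 3 * γ ^ 2 * δ ≠ 0 := by
    intro hη
    have h5 : (C ν + 3 * C γ ^ 2 * C δ : Form) = 0 := by
      have := congrArg (C : ℂ → Form) hη
      simpa only [map_add, map_mul, map_pow, map_zero, show (C 3 : Form) = 3 from rfl] using this
    rw [h5, zero_mul, eq_comm, mul_eq_zero, hl] at hρ
    have hm0 : m = 0 := hρ.resolve_left
      (mul_ne_zero two_ne_zero (mul_ne_zero (by simpa using hζ) hw0))
    obtain ⟨-, hν0⟩ := eq_zero_of_isRelPrime hb H.hg two_ne_zero hgb.symm (s := γ ^ 3 - 1) (t := -ν)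
      (by rw [hm0] at hν; simp only [map_sub, map_pow, map_one, map_neg]; linear_combination hν)
    rw [neg_eq_zero.mp hν0, zero_add] at hη
    exact mul_ne_zero (mul_ne_zero three_ne_zero (pow_ne_zero 2 hγ)) hδ hη
  obtain ⟨θ, hθ, hbe⟩ : ∃ θ : ℂ, θ ≠ 0 ∧ b = C θ * w * m := by
    refine ⟨(ν + 3 * γ ^ 2 * δ)⁻¹ * 2 * ζ, mul_ne_zero (mul_ne_zero (inv_ne_zero hη) two_ne_zero) hζ, ?_⟩
    have h6 : (C (ν + 3 * γ ^ 2 * δ)⁻¹ : Form) * (C ν + 3 * C γ ^ 2 * C δ) = 1 := by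
      have := congrArg (C : ℂ → Form) (inv_mul_cancel₀ hη)
      simpa only [map_add, map_mul, map_pow, map_one, show (C 3 : Form) = 3 from rfl] using this
    rw [map_mul, map_mul, show (C 2 : Form) = 2 from rfl]
    rw [hl] at hρ
    linear_combination C (ν + 3 * γ ^ 2 * δ)⁻¹ * hρ - b * h6
  -- Otherwise $b=\theta wm$ would have order at least $3$ along $u=0$, but it has order $2$.
  have hmP : value m P ≠ 0 := by
    intro hmP
    refine hbk ?_
    have h7 : PowerSeries.X ^ 3 ∣ axis 1 (aeval Φ b) := by
      rw [hbe, map_mul, map_mul, map_mul, map_mul, mul_assoc]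
      refine dvd_mul_of_dvd_right ?_ _
      rw [pow_succ]
      exact mul_dvd_mul hwX (X_dvd_axis 1 (by rw [constantCoeff_aeval hΦ, hmP]))
    exact PowerSeries.X_pow_dvd_iff.mp h7 2 (by norm_num)
  have h7 : a = C ζ * w * (g + C θ * m * (C ζ⁻¹ * m)) := by
    have h8 : (C ζ⁻¹ : Form) * C ζ = 1 := by rw [← map_mul, inv_mul_cancel₀ hζ, map_one]
    rw [hae, hl]; linear_combination m * hbe - w * m * C θ * m * h8
  have hwP : value w P = 0 := hrP
  -- Otherwise $a$ would be a product of two forms vanishing at $P$, but it is smooth there.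
  have hKP : value (g + C θ * m * (C ζ⁻¹ * m)) P ≠ 0 := by
    intro hK
    refine hak ?_
    have hA : MvPowerSeries.constantCoeff (aeval Φ (C ζ * w)) = 0 := by
      rw [constantCoeff_aeval hΦ]
      unfold value at *
      simp [hwP]
    have hB := constantCoeff_aeval hΦ (g + C θ * m * (C ζ⁻¹ * m))
    rw [hK] at hB
    rw [h7, map_mul]
    generalize aeval Φ (C ζ * w) = A at *
    generalize aeval Φ (g + C θ * m * (C ζ⁻¹ * m)) = B at *
    rw [normalDeriv_mul, map_add, map_mul, map_mul, constantCoeff_axis, constantCoeff_axis, hA, hB]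
    ring
  -- Since $f(P)=\delta g(P)$, the conic equals $g(P)\gamma b=g(P)\gamma\theta\,wm$.
  refine htan (tangentConeIsTangentOf_of_eq hr hrP (m := C (value g P * γ * θ) * m) ?_ ?_
    (mul_ne_zero hζ hKP) ?_ ?_)
  · unfold value at *
    simp [hgP, hγ, hθ, hmP]
  · rw [hδP, map_mul, map_mul, map_mul]
    linear_combination C (value g P) * hfe + C (value g P) * C γ * hbe
  · intro j hj u
    have hA := coeff_zero_alongLine a P u
    have hB := coeff_zero_alongLine b P u
    rw [haP] at hA
    rw [hbP] at hB
    rw [hF, alongLine_add, pow_two, pow_succ, pow_two, alongLine_mul, alongLine_mul, alongLine_mul,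
      Polynomial.coeff_add]
    interval_cases j
    · rw [Polynomial.mul_coeff_zero, Polynomial.mul_coeff_zero, hA, hB]; ring
    · rw [coeff_one_mul, coeff_one_mul, Polynomial.mul_coeff_zero, hA, hB]; ring
  · intro u
    have hA := coeff_zero_alongLine a P u
    have hB := coeff_zero_alongLine b P u
    rw [haP] at hA
    rw [hbP] at hB
    have hA1 : (alongLine a P u).coeff 1
        = ζ * value (g + C θ * m * (C ζ⁻¹ * m)) P * eval u w := by
      rw [h7, alongLine_mul, alongLine_mul, coeff_one_mul, alongLine_C, Polynomial.coeff_C_mul,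
        Polynomial.coeff_C_mul, hw_def, coeff_one_alongLine_linForm, coeff_zero_alongLine,
        coeff_zero_alongLine, ← hw_def, hwP]
      ring
    rw [hF, alongLine_add, pow_two, pow_succ, pow_two, alongLine_mul, alongLine_mul, alongLine_mul,
      Polynomial.coeff_add, coeff_two_mul, coeff_two_mul, coeff_one_mul, Polynomial.mul_coeff_zero,
      hA, hB, hA1]
    ring
end SemiTorus

namespace SemiTorus
open MvPolynomial

/-! ### Expansions of forms -/

lemma exists_eq_sum_X_mul {G : Form} {n : ℕ} (hG : G.IsHomogeneous (n + 1)) :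
    ∃ G₀ G₁ G₂ : Form, G₀.IsHomogeneous n ∧ G₁.IsHomogeneous n ∧ G₂.IsHomogeneous n ∧
      G = X 0 * G₀ + X 1 * G₁ + X 2 * G₂ := by
  have key : ∀ s ⊆ G.support, ∃ G₀ G₁ G₂ : Form,
      G₀.IsHomogeneous n ∧ G₁.IsHomogeneous n ∧ G₂.IsHomogeneous n ∧
      ∑ m ∈ s, monomial m (coeff m G) = X 0 * G₀ + X 1 * G₁ + X 2 * G₂ := by
    intro s
    induction s using Finset.induction_on with
    | empty =>
      exact fun _ => ⟨0, 0, 0, isHomogeneous_zero _ _ _, isHomogeneous_zero _ _ _,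
        isHomogeneous_zero _ _ _, by simp⟩
    | insert m s hm ih =>
      intro hs
      obtain ⟨G₀, G₁, G₂, h0, h1, h2, e⟩ := ih fun x hx => hs (Finset.mem_insert_of_mem hx)
      have hd : m.degree = n + 1 := by
        have := hG (mem_support_iff.mp (hs (Finset.mem_insert_self m s)))
        rw [Finsupp.degree_eq_weight_one]
        exact this
      obtain ⟨i, hi⟩ : ∃ i, m i ≠ 0 := by
        by_contra! hcon
        rw [show m = 0 from Finsupp.ext hcon] at hd
        simp at hd
      have hle : Finsupp.single i 1 ≤ m := by
        rw [Finsupp.single_le_iff]; omega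
      obtain ⟨m', rfl⟩ := exists_add_of_le hle
      have hm' : (monomial m' (coeff (Finsupp.single i 1 + m') G)).IsHomogeneous n := by
        refine isHomogeneous_monomial _ ?_
        rw [map_add, Finsupp.degree_single] at hd
        omega
      rw [Finset.sum_insert hm, e, monomial_single_add, pow_one]
      fin_cases i
      · exact ⟨_, G₁, G₂, hm'.add h0, h1, h2, by simp only [Fin.zero_eta]; ring⟩
      · exact ⟨G₀, _, G₂, h0, hm'.add h1, h2, by simp only [Fin.mk_one]; ring⟩
      · exact ⟨G₀, G₁, _, h0, h1, hm'.add h2, by simp only [Fin.reduceFinMk]; ring⟩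
  obtain ⟨G₀, G₁, G₂, h0, h1, h2, e⟩ := key _ (Finset.Subset.refl _)
  exact ⟨G₀, G₁, G₂, h0, h1, h2, by rw [← e, support_sum_monomial_coeff]⟩

lemma exists_eq_linForm {G : Form} (hG : G.IsHomogeneous 1) : ∃ r, G = linForm r := by
  obtain ⟨G₀, G₁, G₂, h0, h1, h2, e⟩ := exists_eq_sum_X_mul hG
  obtain ⟨c₀, rfl⟩ := exists_eq_C_of_isHomogeneous h0
  obtain ⟨c₁, rfl⟩ := exists_eq_C_of_isHomogeneous h1
  obtain ⟨c₂, rfl⟩ := exists_eq_C_of_isHomogeneous h2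
  refine ⟨![c₀, c₁, c₂], ?_⟩
  rw [e, linForm, Fin.sum_univ_three]
  simp [mul_comm]

lemma exists_eq_linear {G : Form} (hG : G.IsHomogeneous 1) :
    ∃ c₀ c₁ c₂ : ℂ, G = C c₀ * X 0 + C c₁ * X 1 + C c₂ * X 2 := by
  obtain ⟨r, rfl⟩ := exists_eq_linForm hG
  exact ⟨r 0, r 1, r 2, by rw [linForm, Fin.sum_univ_three]⟩

lemma exists_eq_quadratic {G : Form} (hG : G.IsHomogeneous 2) :
    ∃ a₀ a₁ a₂ a₃ a₄ a₅ : ℂ, G = C a₀ * X 0 ^ 2 + C a₁ * (X 0 * X 1) + C a₂ * (X 0 * X 2)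
      + C a₃ * X 1 ^ 2 + C a₄ * (X 1 * X 2) + C a₅ * X 2 ^ 2 := by
  obtain ⟨G₀, G₁, G₂, h0, h1, h2, e⟩ := exists_eq_sum_X_mul hG
  obtain ⟨b₀, b₁, b₂, rfl⟩ := exists_eq_linear h0
  obtain ⟨c₀, c₁, c₂, rfl⟩ := exists_eq_linear h1
  obtain ⟨d₀, d₁, d₂, rfl⟩ := exists_eq_linear h2
  refine ⟨b₀, b₁ + c₀, b₂ + d₀, c₁, c₂ + d₁, d₂, ?_⟩
  rw [e]
  simp only [map_add]
  ring

lemma exists_eq_cubic {G : Form} (hG : G.IsHomogeneous 3) :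
    ∃ a₀ a₁ a₂ a₃ a₄ a₅ a₆ a₇ a₈ a₉ : ℂ, G = C a₀ * X 0 ^ 3 + C a₁ * (X 0 ^ 2 * X 1)
      + C a₂ * (X 0 ^ 2 * X 2) + C a₃ * (X 0 * X 1 ^ 2) + C a₄ * (X 0 * X 1 * X 2)
      + C a₅ * (X 0 * X 2 ^ 2) + C a₆ * X 1 ^ 3 + C a₇ * (X 1 ^ 2 * X 2) + C a₈ * (X 1 * X 2 ^ 2)
      + C a₉ * X 2 ^ 3 := by
  obtain ⟨G₀, G₁, G₂, h0, h1, h2, e⟩ := exists_eq_sum_X_mul hG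
  obtain ⟨b₀, b₁, b₂, b₃, b₄, b₅, rfl⟩ := exists_eq_quadratic h0
  obtain ⟨c₀, c₁, c₂, c₃, c₄, c₅, rfl⟩ := exists_eq_quadratic h1
  obtain ⟨d₀, d₁, d₂, d₃, d₄, d₅, rfl⟩ := exists_eq_quadratic h2
  refine ⟨b₀, b₁ + c₀, b₂ + d₀, b₃ + c₁, b₄ + c₂ + d₁, b₅ + d₂, c₃, c₄ + d₃, c₅ + d₄, d₅, ?_⟩
  rw [e]
  simp only [map_add]
  ring

/-! ### Restriction of forms to the axes -/

lemma axis_C (i : Fin 2) (c : ℂ) : axis i (MvPowerSeries.C c) = PowerSeries.C c := by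
  classical
  ext n
  rw [coeff_axis, MvPowerSeries.coeff_C, PowerSeries.coeff_C]
  simp

lemma normalDeriv_C (i : Fin 2) (c : ℂ) : normalDeriv i (MvPowerSeries.C c) = 0 := by
  have : MvPowerSeries.pderiv ℂ i.rev (MvPowerSeries.C c : Series) = 0 :=
    (MvPowerSeries.pderiv ℂ i.rev).map_algebraMap c
  rw [normalDeriv, this, map_zero]

lemma aeval_C' (Φ : Fin 3 → Series) (c : ℂ) : aeval Φ (C c : Form) = MvPowerSeries.C c :=
  aeval_C _ _

lemma constantCoeff_eq_zero_of_X_dvd {φ : PowerSeries ℂ} (h : PowerSeries.X ∣ φ) :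
    PowerSeries.constantCoeff φ = 0 := PowerSeries.X_dvd_iff.mp h

lemma IsStdParam.axis_one {Ψ : Fin 3 → Series} (hΨ : IsStdParam Ψ) :
    PowerSeries.constantCoeff (axis 1 (Ψ 0)) = 1 ∧
    (∃ p₁, axis 1 (Ψ 1) = PowerSeries.X ^ 2 * p₁) ∧
    (∃ p₂, axis 1 (Ψ 2) = PowerSeries.X * p₂ ∧ PowerSeries.constantCoeff p₂ = 1) ∧
    PowerSeries.constantCoeff (normalDeriv 1 (Ψ 0)) = 0 ∧
    PowerSeries.constantCoeff (normalDeriv 1 (Ψ 1)) = 1 ∧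
    PowerSeries.constantCoeff (normalDeriv 1 (Ψ 2)) = 0 := by
  refine ⟨by simp [hΨ.const 0], ?_, ?_, ?_, ?_, ?_⟩
  · obtain ⟨p, hp⟩ : PowerSeries.X ^ 2 ∣ axis 1 (Ψ 1) := by
      rw [PowerSeries.X_pow_dvd_iff]
      intro m hm
      interval_cases m
      · simp [hΨ.const 1]
      · simp [hΨ.snd 1]
    exact ⟨p, hp⟩
  · obtain ⟨p, hp⟩ := X_dvd_axis 1 (F := Ψ 2) (by simp [hΨ.const 2])
    refine ⟨p, hp, ?_⟩
    have := hΨ.snd 2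
    rw [← coeff_axis, hp] at this
    simpa [PowerSeries.coeff_succ_X_mul] using this
  · rw [constantCoeff_normalDeriv, coeff_axis]; exact hΨ.fst 0
  · rw [constantCoeff_normalDeriv, coeff_axis]; exact hΨ.fst 1
  · rw [constantCoeff_normalDeriv, coeff_axis]; exact hΨ.fst 2

/-- Along $u=0$ the coordinates $X_0,X_1,X_2$ have orders $0$, at least $2$, and $1$. The hypotheses
remove successively the monomials corresponding to $1,u,v,v^2,uv$. -/
lemma exists_eq_of_axis_cubic {Ψ : Fin 3 → Series} (hΨ : IsStdParam Ψ) {A : Form}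
    (hA : A.IsHomogeneous 3) (h1 : PowerSeries.X ^ 3 ∣ axis 1 (aeval Ψ A))
    (h2 : PowerSeries.X ^ 2 ∣ normalDeriv 1 (aeval Ψ A)) :
    ∃ a₃ a₆ a₇ a₈ a₉ : ℂ, A = C a₃ * (X 0 * X 1 ^ 2) + C a₆ * X 1 ^ 3 + C a₇ * (X 1 ^ 2 * X 2)
      + C a₈ * (X 1 * X 2 ^ 2) + C a₉ * X 2 ^ 3 := by
  obtain ⟨a₀, a₁, a₂, a₃, a₄, a₅, a₆, a₇, a₈, a₉, rfl⟩ := exists_eq_cubic hA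
  obtain ⟨hp0, ⟨p₁, hp₁⟩, ⟨p₂, hp₂, hp2⟩, hd0, hd1, hd2⟩ := hΨ.axis_one
  simp only [map_add, map_mul, map_pow, aeval_C', aeval_X, axis_C, hp₁, hp₂] at h1
  simp only [map_add, map_mul, map_pow, aeval_C', aeval_X, normalDeriv_add, normalDeriv_mul,
    normalDeriv_pow_two, normalDeriv_pow_three, axis_C, hp₁, hp₂, normalDeriv_C] at h2
  generalize axis 1 (Ψ 0) = p₀ at *
  generalize normalDeriv 1 (Ψ 0) = d₀ at *
  generalize normalDeriv 1 (Ψ 1) = d₁ at *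
  generalize normalDeriv 1 (Ψ 2) = d₂ at *
  have ha0 : a₀ = 0 := by
    have := constantCoeff_eq_zero_of_X_dvd (dvd_trans (dvd_pow_self _ three_ne_zero) h1)
    simpa [hp0] using this
  have ha1 : a₁ = 0 := by
    have := constantCoeff_eq_zero_of_X_dvd (dvd_trans (dvd_pow_self _ two_ne_zero) h2)
    simpa [hp0, hp2, hd0, hd1, hd2] using this
  subst ha0 ha1
  rw [show PowerSeries.X ^ 3 = PowerSeries.X * PowerSeries.X ^ 2 from by ring] at h1
  simp only [map_zero, zero_mul, zero_add] at h1 h2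
  have h3 : PowerSeries.X ^ 2 ∣ PowerSeries.C a₂ * (p₀ ^ 2 * p₂)
      + PowerSeries.X * (PowerSeries.C a₃ * (p₀ * PowerSeries.X ^ 2 * p₁ ^ 2)
      + PowerSeries.C a₄ * (p₀ * PowerSeries.X * p₁ * p₂)
      + PowerSeries.C a₅ * (p₀ * p₂ ^ 2) + PowerSeries.C a₆ * PowerSeries.X ^ 4 * p₁ ^ 3
      + PowerSeries.C a₇ * PowerSeries.X ^ 3 * (p₁ ^ 2 * p₂)
      + PowerSeries.C a₈ * PowerSeries.X ^ 2 * (p₁ * p₂ ^ 2)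
      + PowerSeries.C a₉ * PowerSeries.X * p₂ ^ 3) := by
    refine (mul_dvd_mul_iff_left (PowerSeries.X_ne_zero (R := ℂ))).mp ?_
    convert h1 using 1
    ring
  have ha2 : a₂ = 0 := by
    have := constantCoeff_eq_zero_of_X_dvd (dvd_trans (dvd_pow_self _ two_ne_zero) h3)
    simpa [hp0, hp2] using this
  subst ha2
  rw [map_zero, zero_mul, zero_add, pow_two,
    mul_dvd_mul_iff_left (PowerSeries.X_ne_zero (R := ℂ))] at h3
  have ha5 : a₅ = 0 := by
    have := constantCoeff_eq_zero_of_X_dvd h3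
    simpa [hp0, hp2] using this
  subst ha5
  simp only [map_zero, zero_mul, zero_add, add_zero] at h2
  have h4 : PowerSeries.X ∣ PowerSeries.C a₄ * p₀ * d₁ * p₂ := by
    obtain ⟨q, hq⟩ := h2
    refine ⟨q - (PowerSeries.C a₃ * (d₀ * PowerSeries.X ^ 2 * p₁ ^ 2 + 2 * p₀ * p₁ * d₁)
      + PowerSeries.C a₄ * (d₀ * PowerSeries.X * p₁ * p₂ + p₀ * p₁ * d₂)
      + PowerSeries.C a₆ * (3 * PowerSeries.X ^ 2 * p₁ ^ 2 * d₁)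
      + PowerSeries.C a₇ * (2 * PowerSeries.X * p₁ * d₁ * p₂ + PowerSeries.X ^ 2 * p₁ ^ 2 * d₂)
      + PowerSeries.C a₈ * (d₁ * p₂ ^ 2 + PowerSeries.X * p₁ * 2 * p₂ * d₂)
      + PowerSeries.C a₉ * (3 * p₂ ^ 2 * d₂)), ?_⟩
    refine mul_left_cancel₀ (PowerSeries.X_ne_zero (R := ℂ)) ?_
    linear_combination hq
  have ha4 : a₄ = 0 := by
    have := constantCoeff_eq_zero_of_X_dvd h4
    simpa [hp0, hp2, hd1] using this
  subst ha4
  exact ⟨a₃, a₆, a₇, a₈, a₉, by simp⟩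

/-- When $X_1$ has order at least $3$, the monomials $X_0^2,X_0X_2,X_2^2$ are the only ones of order
$0,1,2$. -/
lemma X_one_dvd_of_axis_quadratic {Ψ : Fin 3 → Series} (hΨ : IsStdParam Ψ) {q : Form}
    (hq : q.IsHomogeneous 2) (h1 : PowerSeries.X ^ 3 ∣ axis 1 (aeval Ψ q))
    (h2 : PowerSeries.X ^ 3 ∣ axis 1 (Ψ 1)) : X 1 ∣ q := by
  obtain ⟨a₀, a₁, a₂, a₃, a₄, a₅, rfl⟩ := exists_eq_quadratic hq
  obtain ⟨hp0, -, ⟨p₂, hp₂, hp2⟩, -⟩ := hΨ.axis_one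
  have h3 : PowerSeries.X ^ 3 ∣ PowerSeries.C a₀ * axis 1 (Ψ 0) ^ 2
      + PowerSeries.X * (PowerSeries.C a₂ * axis 1 (Ψ 0) * p₂)
      + PowerSeries.X ^ 2 * (PowerSeries.C a₅ * p₂ ^ 2) := by
    obtain ⟨q, hq⟩ := h1
    obtain ⟨p₁, hp₁⟩ := h2
    simp only [map_add, map_mul, map_pow, aeval_C', aeval_X, axis_C, hp₁, hp₂] at hq
    refine ⟨q - (PowerSeries.C a₁ * axis 1 (Ψ 0) * p₁
      + PowerSeries.C a₃ * p₁ ^ 2 * PowerSeries.X ^ 3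
      + PowerSeries.C a₄ * p₁ * (PowerSeries.X * p₂)), ?_⟩
    linear_combination hq
  have ha0 : a₀ = 0 := by
    have := constantCoeff_eq_zero_of_X_dvd (dvd_trans (dvd_pow_self _ three_ne_zero) h3)
    simpa [hp0] using this
  subst ha0
  have h4 : PowerSeries.X ^ 2 ∣ PowerSeries.C a₂ * axis 1 (Ψ 0) * p₂
      + PowerSeries.X * (PowerSeries.C a₅ * p₂ ^ 2) := by
    refine (mul_dvd_mul_iff_left (PowerSeries.X_ne_zero (R := ℂ))).mp ?_
    convert h3 using 1
    · ring
    · rw [map_zero]; ring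
  have ha2 : a₂ = 0 := by
    have := constantCoeff_eq_zero_of_X_dvd (dvd_trans (dvd_pow_self _ two_ne_zero) h4)
    simpa [hp0, hp2] using this
  subst ha2
  rw [map_zero, zero_mul, zero_mul, zero_add, pow_two,
    mul_dvd_mul_iff_left (PowerSeries.X_ne_zero (R := ℂ))] at h4
  have ha5 : a₅ = 0 := by
    have := constantCoeff_eq_zero_of_X_dvd h4
    simpa [hp2] using this
  subst ha5
  refine ⟨C a₁ * X 0 + C a₃ * X 1 + C a₄ * X 2, ?_⟩
  simp only [map_zero]
  ring

/-! ### Germs of conics and cubics -/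

lemma X_pow_dvd_normalForm_A (e : Series) (N : ℕ) :
    PowerSeries.X ^ N ∣ axis 1 (e * (MvPowerSeries.X 0 ^ 2 + MvPowerSeries.X 1 ^ N)) ∧
    PowerSeries.X ^ N ∣ normalDeriv 1 (e * (MvPowerSeries.X 0 ^ 2 + MvPowerSeries.X 1 ^ N)) := by
  rw [normalDeriv_mul, normalDeriv_add, normalDeriv_X_self_pow, normalDeriv_pow_two]
  simp only [map_mul, map_add, map_pow, axis_one_X_zero, axis_X_self]
  constructor
  · exact ⟨axis 1 e, by ring⟩
  · exact ⟨normalDeriv 1 e, by ring⟩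

lemma X_pow_dvd_normalForm_E6 (e : Series) :
    PowerSeries.X ^ 4 ∣ axis 1 (e * (MvPowerSeries.X 0 ^ 3 + MvPowerSeries.X 1 ^ 4)) ∧
    PowerSeries.X ^ 4 ∣ normalDeriv 1 (e * (MvPowerSeries.X 0 ^ 3 + MvPowerSeries.X 1 ^ 4)) ∧
    PowerSeries.X ^ 3 ∣ axis 0 (e * (MvPowerSeries.X 0 ^ 3 + MvPowerSeries.X 1 ^ 4)) := by
  rw [normalDeriv_mul, normalDeriv_add, normalDeriv_X_self_pow, normalDeriv_pow_three]
  simp only [map_mul, map_add, map_pow, axis_one_X_zero, axis_zero_X_one, axis_X_self]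
  refine ⟨⟨axis 1 e, by ring⟩, ⟨normalDeriv 1 e, by ring⟩, ⟨axis 0 e, by ring⟩⟩

lemma IsStdParam.constantCoeff_aeval {Ψ : Fin 3 → Series} (hΨ : IsStdParam Ψ) (G : Form) :
    MvPowerSeries.constantCoeff (aeval Ψ G) = eval ![1, 0, 0] G := by
  have : (MvPowerSeries.constantCoeff (σ := Fin 2) (R := ℂ)).comp
      (aeval Ψ : Form →ₐ[ℂ] Series).toRingHom = eval ![1, 0, 0] := by
    refine MvPolynomial.ringHom_ext (fun c => ?_) fun i => ?_
    · simp only [RingHom.comp_apply, AlgHom.toRingHom_eq_coe, RingHom.coe_coe, aeval_C, eval_C]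
      exact MvPowerSeries.constantCoeff_C c
    · simp [hΨ.const i]
  exact DFunLike.congr_fun this G

/-- A conic has no singularity of type `A_n` with `n ≥ 2`. -/
lemma quadratic_ne_A {P : Plane} {Φ : Fin 3 → Series} (hΦ : IsLocalParam P Φ) {q : Form}
    (hq : q.IsHomogeneous 2) {e : Series} (he : MvPowerSeries.constantCoeff e ≠ 0) {N : ℕ}
    (hN : 3 ≤ N) : aeval Φ q ≠ e * (MvPowerSeries.X 0 ^ 2 + MvPowerSeries.X 1 ^ N) := by
  intro h
  obtain ⟨M, Ψ, hM, -, hΨ, -, hΦΨ⟩ := exists_isStdParam hΦ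
  rw [hΦΨ] at h
  obtain ⟨h1, h2⟩ := X_pow_dvd_normalForm_A e N
  rw [← h] at h1 h2
  -- The factor $X_0$, a local unit, makes the lemma on cubics applicable. As the product vanishes
  -- on $X_0=0$, four evaluations there leave a multiple of $X_1^2$.
  obtain ⟨a₃, a₆, a₇, a₈, a₉, hA⟩ := exists_eq_of_axis_cubic hΨ (A := X 0 * lin M q)
    (by simpa using (isHomogeneous_X ℂ (0 : Fin 3)).mul (lin_isHomogeneous hq M))
    (by
      rw [map_mul, map_mul]
      exact dvd_mul_of_dvd_right (dvd_trans (pow_dvd_pow _ hN) h1) _)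
    (by
      rw [map_mul, normalDeriv_mul]
      exact dvd_add (dvd_mul_of_dvd_right (dvd_trans (pow_dvd_pow _ (by omega)) h1) _)
        (dvd_mul_of_dvd_right (dvd_trans (pow_dvd_pow _ (by omega)) h2) _))
  have e1 := congrArg (eval ![0, 0, 1]) hA
  have e2 := congrArg (eval ![0, 1, 0]) hA
  have e3 := congrArg (eval ![0, 1, 1]) hA
  have e4 := congrArg (eval ![0, 1, -1]) hA
  simp at e1 e2 e3 e4
  subst e1 e2
  have e5 : a₇ = 0 := by linear_combination -(e3 - e4) / 2
  have e6 : a₈ = 0 := by linear_combination -(e3 + e4) / 2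
  subst e5 e6
  have hq' : lin M q = X 1 * (C a₃ * X 1) := by
    refine mul_left_cancel₀ (X_ne_zero (R := ℂ) (0 : Fin 3)) ?_
    rw [hA]
    simp only [map_zero]
    ring
  have hX : MvPowerSeries.constantCoeff (Ψ 1) = 0 := hΨ.const 1
  rw [hq', map_mul, map_mul, aeval_X] at h
  exact not_dvd_factors_A hX (by simp [hX]) he (by omega) h hX dvd_rfl (dvd_mul_left _ _)

/-- A cubic has no singularity of type `E₆`. -/
lemma cubic_ne_E6 {P : Plane} {Φ : Fin 3 → Series} (hΦ : IsLocalParam P Φ) {A : Form}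
    (hA : A.IsHomogeneous 3) {e : Series} (he : MvPowerSeries.constantCoeff e ≠ 0) :
    aeval Φ A ≠ e * (MvPowerSeries.X 0 ^ 3 + MvPowerSeries.X 1 ^ 4) := by
  intro h
  obtain ⟨M, Ψ, hM, -, hΨ, -, hΦΨ⟩ := exists_isStdParam hΦ
  rw [hΦΨ] at h
  obtain ⟨h1, h2, h3⟩ := X_pow_dvd_normalForm_E6 e
  rw [← h] at h1 h2 h3
  obtain ⟨a₃, a₆, a₇, a₈, a₉, hA⟩ := exists_eq_of_axis_cubic hΨ (lin_isHomogeneous hA M)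
    (dvd_trans (pow_dvd_pow _ (by norm_num)) h1) (dvd_trans (pow_dvd_pow _ (by norm_num)) h2)
  have hX : MvPowerSeries.constantCoeff (Ψ 1) = 0 := hΨ.const 1
  rw [hA] at h h1 h2 h3
  obtain ⟨hp0, ⟨p₁, hp₁⟩, ⟨p₂, hp₂, hp2⟩, hd0, hd1, hd2⟩ := hΨ.axis_one
  -- The restriction to $v=0$ has order $3$, while $X_0X_1^2$ has order $2$.
  have ha3 : a₃ = 0 := by
    obtain ⟨r₁, hr₁⟩ := X_dvd_axis 0 hX
    obtain ⟨r₂, hr₂⟩ : PowerSeries.X ^ 2 ∣ axis 0 (Ψ 2) := by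
      rw [PowerSeries.X_pow_dvd_iff]
      intro m hm
      interval_cases m
      · simp [hΨ.const 2]
      · simp [hΨ.fst 2]
    have hr1 : PowerSeries.constantCoeff r₁ = 1 := by
      have := hΨ.fst 1
      rw [← coeff_axis, hr₁] at this
      simpa [PowerSeries.coeff_succ_X_mul] using this
    have h4 : PowerSeries.X ∣ PowerSeries.C a₃ * axis 0 (Ψ 0) * r₁ ^ 2 := by
      obtain ⟨s, hs⟩ := h3
      simp only [map_add, map_mul, map_pow, aeval_C', aeval_X, axis_C, hr₁, hr₂] at hs
      refine ⟨s - (PowerSeries.C a₆ * r₁ ^ 3 + PowerSeries.C a₇ * r₁ ^ 2 * r₂ * PowerSeries.X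
        + PowerSeries.C a₈ * r₁ * r₂ ^ 2 * PowerSeries.X ^ 2
        + PowerSeries.C a₉ * r₂ ^ 3 * PowerSeries.X ^ 3), ?_⟩
      refine mul_left_cancel₀ (pow_ne_zero 2 (PowerSeries.X_ne_zero (R := ℂ))) ?_
      linear_combination hs
    have := constantCoeff_eq_zero_of_X_dvd h4
    simpa [hr1, hΨ.const 0] using this
  subst ha3
  have ha9 : a₉ = 0 := by
    have h4 : PowerSeries.X ∣ PowerSeries.C a₉ * p₂ ^ 3 := by
      obtain ⟨s, hs⟩ := h1
      simp only [map_add, map_mul, map_pow, aeval_C', aeval_X, axis_C, hp₁, hp₂, map_zero] at hs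
      refine ⟨s - (PowerSeries.C a₆ * p₁ ^ 3 * PowerSeries.X ^ 2
        + PowerSeries.C a₇ * p₁ ^ 2 * p₂ * PowerSeries.X
        + PowerSeries.C a₈ * p₁ * p₂ ^ 2), ?_⟩
      refine mul_left_cancel₀ (pow_ne_zero 3 (PowerSeries.X_ne_zero (R := ℂ))) ?_
      linear_combination hs
    have := constantCoeff_eq_zero_of_X_dvd h4
    simpa [hp2] using this
  subst ha9
  have ha8 : a₈ = 0 := by
    have h4 : PowerSeries.X ∣ PowerSeries.C a₈ * p₂ ^ 2 * normalDeriv 1 (Ψ 1) := by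
      obtain ⟨s, hs⟩ := h2
      simp only [map_add, map_mul, map_pow, aeval_C', aeval_X, normalDeriv_add, normalDeriv_mul,
        normalDeriv_pow_two, normalDeriv_pow_three, axis_C, hp₁, hp₂, normalDeriv_C, map_zero,
        show normalDeriv 1 (0 : Series) = 0 by simp [normalDeriv]] at hs
      refine ⟨PowerSeries.X * s - (PowerSeries.C a₆ * (3 * p₁ ^ 2 * normalDeriv 1 (Ψ 1)) * PowerSeries.X
        + PowerSeries.C a₇ * (2 * p₁ * normalDeriv 1 (Ψ 1) * p₂ +
          p₁ ^ 2 * PowerSeries.X * normalDeriv 1 (Ψ 2))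
        + PowerSeries.C a₈ * p₁ * 2 * p₂ * normalDeriv 1 (Ψ 2)), ?_⟩
      refine mul_left_cancel₀ (pow_ne_zero 2 (PowerSeries.X_ne_zero (R := ℂ))) ?_
      linear_combination hs
    have := constantCoeff_eq_zero_of_X_dvd h4
    simpa [hp2, hd1] using this
  subst ha8
  -- Only multiples of $X_1^2$ remain, but the germ is irreducible.
  refine mul_ne_E6 (x := Ψ 1) (y := Ψ 1 * (MvPowerSeries.C a₆ * Ψ 1 + MvPowerSeries.C a₇ * Ψ 2))
    hX (by simp [hX]) he ?_
  rw [← h]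
  simp only [map_add, map_mul, map_pow, aeval_C', aeval_X, map_zero]
  ring

end SemiTorus

/-! ### Normal form of a cuspidal cubic -/

namespace SemiTorus
open MvPolynomial

/-- The equation of the cuspidal cubic with its cusp at `(1 : 0 : 0)`. -/
noncomputable def cuspidalCubic : Form := X 0 * X 1 ^ 2 - X 2 ^ 3

lemma eval_cuspidalCubic (x : Fin 3 → ℂ) : eval x cuspidalCubic = x 0 * x 1 ^ 2 - x 2 ^ 3 := by
  simp [cuspidalCubic]

/-- A cubic with a singularity of type `A_n`, where `n ≥ 2` and `n ≠ 3`, is cuspidal. -/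
lemma exists_lin_eq_cuspidalCubic {P : Plane} {Φ : Fin 3 → Series} (hΦ : IsLocalParam P Φ)
    {A : Form} (hA : A.IsHomogeneous 3) {e : Series} (he : MvPowerSeries.constantCoeff e ≠ 0)
    {N : ℕ} (hN : 3 ≤ N) (hN4 : N ≠ 4)
    (h : aeval Φ A = e * (MvPowerSeries.X 0 ^ 2 + MvPowerSeries.X 1 ^ N)) :
    N = 3 ∧ ∃ (M : Matrix (Fin 3) (Fin 3) ℂ) (c : ℂ), M.det ≠ 0 ∧ c ≠ 0 ∧
      M.mulVec ![1, 0, 0] = c • P.rep ∧ lin M A = cuspidalCubic := by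
  obtain ⟨M, Ψ, hM, hMP, hΨ, -, hΦΨ⟩ := exists_isStdParam hΦ
  rw [hΦΨ] at h
  obtain ⟨h1, h2⟩ := X_pow_dvd_normalForm_A e N
  rw [← h] at h1 h2
  obtain ⟨a₃, a₆, a₇, a₈, a₉, hA'⟩ := exists_eq_of_axis_cubic hΨ (lin_isHomogeneous hA M)
    (dvd_trans (pow_dvd_pow _ hN) h1) (dvd_trans (pow_dvd_pow _ (by omega)) h2)
  have hX : MvPowerSeries.constantCoeff (Ψ 1) = 0 := hΨ.const 1
  have hX2 : MvPowerSeries.constantCoeff (Ψ 2) = 0 := hΨ.const 2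
  obtain ⟨hp0, ⟨p₁, hp₁⟩, ⟨p₂, hp₂, hp2⟩, hd0, hd1, hd2⟩ := hΨ.axis_one
  rw [hA'] at h h1
  have ha3 : a₃ ≠ 0 := by
    rintro rfl
    obtain ⟨r₁, hr₁⟩ := X_dvd_axis 0 hX
    obtain ⟨r₂, hr₂⟩ : PowerSeries.X ^ 2 ∣ axis 0 (Ψ 2) := by
      rw [PowerSeries.X_pow_dvd_iff]
      intro m hm
      interval_cases m
      · simp [hX2]
      · simp [hΨ.fst 2]
    have h4 : PowerSeries.X ∣ axis 0 e := by
      have hs := congrArg (axis 0) h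
      simp only [map_add, map_mul, map_pow, aeval_C', aeval_X, axis_C, hr₁, hr₂, axis_X_self,
        axis_zero_X_one, zero_pow (show N ≠ 0 by omega), map_zero] at hs
      refine ⟨PowerSeries.C a₆ * r₁ ^ 3 + PowerSeries.C a₇ * r₁ ^ 2 * r₂ * PowerSeries.X
        + PowerSeries.C a₈ * r₁ * r₂ ^ 2 * PowerSeries.X ^ 2
        + PowerSeries.C a₉ * r₂ ^ 3 * PowerSeries.X ^ 3, ?_⟩
      refine mul_left_cancel₀ (pow_ne_zero 2 (PowerSeries.X_ne_zero (R := ℂ))) ?_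
      linear_combination -hs
    have := constantCoeff_eq_zero_of_X_dvd h4
    rw [constantCoeff_axis] at this
    exact he this
  -- If $a_9=0$, the cubic is the line $X_1=0$ times a conic. Both have contact $N/2\ge3$ with
  -- $u=0$, where $N\neq4$ is used; this forces $a_8=0$, and the line divides both factors.
  have ha9 : a₉ ≠ 0 := by
    rintro rfl
    let l : Form := C a₃ * (X 0 * X 1) + C a₆ * X 1 ^ 2 + C a₇ * (X 1 * X 2)
    have hy : MvPowerSeries.constantCoeff (aeval Ψ (l + C a₈ * X 2 ^ 2)) = 0 := by
      rw [hΨ.constantCoeff_aeval]; simp [l]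
    have hxy : Ψ 1 * aeval Ψ (l + C a₈ * X 2 ^ 2)
        = e * (MvPowerSeries.X 0 ^ 2 + MvPowerSeries.X 1 ^ N) := by
      rw [← h, ← aeval_X (R := ℂ) Ψ 1, ← map_mul]
      congr 1
      simp only [l, map_zero]
      ring
    have hl : Ψ 1 ∣ aeval Ψ l := by
      rw [← aeval_X (R := ℂ) Ψ 1]
      exact map_dvd _ ⟨C a₃ * X 0 + C a₆ * X 1 + C a₇ * X 2, by simp only [l]; ring⟩
    obtain ⟨i, hi, hNi, hx, hy', -⟩ := mul_eq_A hX hy he (by omega) hxy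
    have ha8 : a₈ = 0 := by
      have h4 : PowerSeries.X ^ 3 ∣ axis 1 (aeval Ψ (C a₈ * X 2 ^ 2)) := by
        have h5 : (C a₈ * X 2 ^ 2 : Form) = (l + C a₈ * X 2 ^ 2) - l := by ring
        have h6 := pow_dvd_pow (PowerSeries.X : PowerSeries ℂ) (show 3 ≤ i by omega)
        rw [h5, map_sub, map_sub]
        exact dvd_sub (h6.trans hy') ((h6.trans hx).trans (map_dvd _ hl))
      obtain ⟨s, hs⟩ := h4
      simp only [map_mul, map_pow, aeval_C', aeval_X, axis_C, hp₂] at hs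
      have h5 : PowerSeries.X ∣ PowerSeries.C a₈ * p₂ ^ 2 := by
        refine ⟨s, mul_left_cancel₀ (pow_ne_zero 2 (PowerSeries.X_ne_zero (R := ℂ))) ?_⟩
        linear_combination hs
      simpa [hp2] using constantCoeff_eq_zero_of_X_dvd h5
    subst ha8
    refine not_dvd_factors_A hX hy he (by omega) hxy hX dvd_rfl ?_
    simpa using hl
  have hN3 : N = 3 := by
    by_contra hN3
    obtain ⟨s, hs⟩ := (pow_dvd_pow _ (show 4 ≤ N by omega)).trans h1
    simp only [map_add, map_mul, map_pow, aeval_C', aeval_X, axis_C, hp₁, hp₂] at hs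
    have h5 : PowerSeries.X ∣ PowerSeries.C a₉ * p₂ ^ 3 := by
      refine ⟨s - (PowerSeries.C a₃ * axis 1 (Ψ 0) * p₁ ^ 2 + PowerSeries.C a₆ * p₁ ^ 3
        * PowerSeries.X ^ 2 + PowerSeries.C a₇ * p₁ ^ 2 * p₂ * PowerSeries.X
        + PowerSeries.C a₈ * p₁ * p₂ ^ 2),
        mul_left_cancel₀ (pow_ne_zero 3 (PowerSeries.X_ne_zero (R := ℂ))) ?_⟩
      linear_combination hs
    exact ha9 (by simpa [hp2] using constantCoeff_eq_zero_of_X_dvd h5)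
  refine ⟨hN3, ?_⟩
  -- The substitution $X_2\mapsto\sigma X_1+\mu X_2$, $X_0\mapsto a_3^{-1}X_0+\rho X_1+\tau X_2$:
  -- $\mu$ normalizes $X_2^3$, while $\sigma,\rho,\tau$ remove $X_1X_2^2,X_1^3,X_1^2X_2$.
  obtain ⟨μ, hμ⟩ := IsAlgClosed.exists_pow_nat_eq (-1 / a₉) (show 0 < 3 by norm_num)
  have hμ' : a₉ * μ ^ 3 = -1 := by rw [hμ]; field_simp
  have hμ0 : μ ≠ 0 := by rintro rfl; norm_num at hμ'
  obtain ⟨σ, hσ⟩ : ∃ σ, 3 * a₉ * σ + a₈ = 0 := ⟨-a₈ / (3 * a₉), by field_simp; ring⟩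
  obtain ⟨ρ, hρ⟩ : ∃ ρ, a₃ * ρ + a₆ + a₇ * σ + a₈ * σ ^ 2 + a₉ * σ ^ 3 = 0 :=
    ⟨-(a₆ + a₇ * σ + a₈ * σ ^ 2 + a₉ * σ ^ 3) / a₃, by field_simp; ring⟩
  obtain ⟨τ, hτ⟩ : ∃ τ, a₃ * τ + a₇ * μ + 2 * a₈ * σ * μ + 3 * a₉ * μ * σ ^ 2 = 0 :=
    ⟨-(a₇ * μ + 2 * a₈ * σ * μ + 3 * a₉ * μ * σ ^ 2) / a₃, by field_simp; ring⟩
  let T : Matrix (Fin 3) (Fin 3) ℂ := Matrix.of ![![a₃⁻¹, ρ, τ], ![0, 1, 0], ![0, σ, μ]]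
  have hT0 : T.mulVec ![1, 0, 0] = a₃⁻¹ • ![1, 0, 0] := by
    ext i
    fin_cases i <;> simp [T, Matrix.mulVec, dotProduct, Fin.sum_univ_three]
  refine ⟨M * T, a₃⁻¹, ?_, inv_ne_zero ha3, ?_, ?_⟩
  · rw [Matrix.det_mul]
    refine mul_ne_zero hM ?_
    simp [T, Matrix.det_fin_three, ha3, hμ0]
  · rw [← Matrix.mulVec_mulVec, hT0, Matrix.mulVec_smul, hMP]
  · rw [← lin_lin, hA']
    refine MvPolynomial.funext fun x => ?_
    rw [eval_lin, eval_cuspidalCubic]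
    have h3 : a₃ * a₃⁻¹ = 1 := mul_inv_cancel₀ ha3
    simp only [map_add, map_mul, map_pow, eval_C, eval_X, T, Matrix.mulVec, dotProduct,
      Fin.sum_univ_three, Matrix.of_apply, Matrix.cons_val_zero, Matrix.cons_val_one,
      Matrix.cons_val, zero_mul, one_mul, zero_add, add_zero]
    linear_combination x 0 * x 1 ^ 2 * h3 + x 1 ^ 3 * hρ + x 1 ^ 2 * x 2 * hτ
      + x 1 * x 2 ^ 2 * μ ^ 2 * hσ + x 2 ^ 3 * hμ'
end SemiTorus

namespace SemiTorus
open MvPolynomial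

/-! ### Sums of two cubes -/

/-- If one factor of a germ is invertible, the other one has the same type. -/
lemma exists_unit_mul_of_mul_eq {x y e G : Series} (hy : MvPowerSeries.constantCoeff y ≠ 0)
    (he : MvPowerSeries.constantCoeff e ≠ 0) (h : x * y = e * G) :
    ∃ e' : Series, MvPowerSeries.constantCoeff e' ≠ 0 ∧ x = e' * G := by
  obtain ⟨w, rfl⟩ := isUnit_iff_constantCoeff_ne_zero.mpr hy
  have hw : (↑w : Series) * ↑w⁻¹ = 1 := by simp
  refine ⟨e * ↑w⁻¹, ?_, ?_⟩
  · rw [map_mul]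
    exact mul_ne_zero he (isUnit_iff_constantCoeff_ne_zero.mp (Units.isUnit w⁻¹))
  · linear_combination (↑w⁻¹ : Series) * h - x * hw

/-- With $\omega$ a primitive cube root of unity, $F$ is a product of three conics $a+\omega^ib$. If
only one vanishes at $P$, a conic has an $A_n$; if two do, all three do, and the multiplicity is at
least three. -/
theorem not_cube_add_cube {F a b : Form} {P : Plane} {n : ℕ} (hn : 2 ≤ n)
    (hP : HasType F P (.A n)) (ha : a.IsHomogeneous 2) (hb : b.IsHomogeneous 2) :
    F ≠ a ^ 3 + b ^ 3 := by
  intro hF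
  obtain ⟨hτ, Φ, hΦ, e, he, heq⟩ := hP
  rw [isUnit_iff_constantCoeff_ne_zero] at he
  have heq' : aeval Φ F = e * (MvPowerSeries.X 0 ^ 2 + MvPowerSeries.X 1 ^ (n + 1)) := heq
  obtain ⟨s, hs⟩ := IsAlgClosed.exists_pow_nat_eq (-3 : ℂ) (show 0 < 2 by norm_num)
  obtain ⟨ω, hω, hω1⟩ : ∃ ω : ℂ, ω ^ 2 + ω + 1 = 0 ∧ ω ≠ 1 := by
    refine ⟨(-1 + s) / 2, by linear_combination hs / 4, fun h => ?_⟩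
    have : s = 3 := by linear_combination 2 * h
    rw [this] at hs; norm_num at hs
  have hC : (C ω : Form) ^ 2 + C ω + 1 = 0 := by
    rw [← map_pow, ← map_add, ← map_one (C : ℂ →+* Form), ← map_add, hω, map_zero]
  have hCh : ∀ {G : Form} {d : ℕ} (c : ℂ), G.IsHomogeneous d → (C c * G).IsHomogeneous d :=
    fun c hG => by simpa using (isHomogeneous_C _ c).mul hG
  set x := a + b
  set y := a + C ω * b
  set z := a + C (ω ^ 2) * b
  have hx : x.IsHomogeneous 2 := ha.add hb
  have hy : y.IsHomogeneous 2 := ha.add (hCh _ hb)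
  have hz : z.IsHomogeneous 2 := ha.add (hCh _ hb)
  have hprod : F = x * y * z := by
    rw [hF]
    simp only [x, y, z, map_pow]
    linear_combination (-(a ^ 2 * b + C ω * a * b ^ 2) - (C ω - 1) * b ^ 3 ) * hC
  have hvx : value x P = value a P + value b P := by simp [x, value]
  have hvy : value y P = value a P + ω * value b P := by simp [y, value]
  have hvz : value z P = value a P + ω ^ 2 * value b P := by simp [z, value]
  have hω0 : ω ≠ 0 := by rintro rfl; norm_num at hω
  have hω12 : ω - 1 ≠ 0 := sub_ne_zero.mpr hω1
  have hω3 : ω + 1 ≠ 0 := fun h => by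
    rw [show ω = -1 by linear_combination h] at hω; norm_num at hω
  rw [hprod, map_mul, map_mul] at heq'
  have hone : ∀ {x y z : Form}, x.IsHomogeneous 2 →
      aeval Φ x * aeval Φ y * aeval Φ z
        = e * (MvPowerSeries.X 0 ^ 2 + MvPowerSeries.X 1 ^ (n + 1)) →
      value y P ≠ 0 → value z P ≠ 0 → False := by
    intro x y z hx h hyP hzP
    rw [mul_assoc] at h
    obtain ⟨e', he', h'⟩ := exists_unit_mul_of_mul_eq (y := aeval Φ y * aeval Φ z)
      (by rw [map_mul, constantCoeff_aeval hΦ, constantCoeff_aeval hΦ]; exact mul_ne_zero hyP hzP)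
      he h
    exact quadratic_ne_A hΦ hx he' (N := n + 1) (by omega) h'
  have h0 : value x P * value y P * value z P = 0 := by
    have := congrArg (MvPowerSeries.constantCoeff) heq'
    simpa [constantCoeff_aeval hΦ] using this
  by_cases hb0 : value b P = 0
  · have ha0 : value a P = 0 := by
      rw [hvx, hvy, hvz, hb0] at h0
      simpa using h0
    have h1 : MvPowerSeries.constantCoeff (aeval Φ x) = 0 := by
      rw [constantCoeff_aeval hΦ, hvx, ha0, hb0, add_zero]
    have h2 : MvPowerSeries.constantCoeff (aeval Φ y) = 0 := by
      rw [constantCoeff_aeval hΦ, hvy, ha0, hb0, mul_zero, add_zero]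
    have h3 : MvPowerSeries.constantCoeff (aeval Φ z) = 0 := by
      rw [constantCoeff_aeval hΦ, hvz, ha0, hb0, mul_zero, add_zero]
    rw [mul_assoc] at heq'
    obtain ⟨i, -, -, -, -, -, -, -, h4, -⟩ := mul_eq_A h1 (by rw [map_mul, h2, zero_mul]) he
      (by omega) heq'
    apply h4
    rw [normalDeriv_mul, map_add, map_mul, map_mul, constantCoeff_axis, constantCoeff_axis, h2, h3,
      mul_zero, zero_mul, add_zero]
  · rcases mul_eq_zero.mp h0 with h0 | h0
    · rcases mul_eq_zero.mp h0 with h0 | h0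
      · rw [hvx] at h0
        refine hone hx heq' ?_ ?_
        · rw [hvy, show value a P + ω * value b P = (ω - 1) * value b P by linear_combination h0]
          exact mul_ne_zero hω12 hb0
        · rw [hvz, show value a P + ω ^ 2 * value b P = (ω - 1) * (ω + 1) * value b P by
            linear_combination h0]
          exact mul_ne_zero (mul_ne_zero hω12 hω3) hb0
      · rw [hvy] at h0
        refine hone (y := x) (z := z) hy (by rw [← heq']; ring) ?_ ?_
        · rw [hvx, show value a P + value b P = -(ω - 1) * value b P by linear_combination h0]
          exact mul_ne_zero (neg_ne_zero.mpr hω12) hb0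
        · rw [hvz, show value a P + ω ^ 2 * value b P = ω * (ω - 1) * value b P by
            linear_combination h0]
          exact mul_ne_zero (mul_ne_zero hω0 hω12) hb0
    · rw [hvz] at h0
      refine hone (y := x) (z := y) hz (by rw [← heq']; ring) ?_ ?_
      · rw [hvx, show value a P + value b P = -((ω - 1) * (ω + 1)) * value b P by
          linear_combination h0]
        exact mul_ne_zero (neg_ne_zero.mpr (mul_ne_zero hω12 hω3)) hb0
      · rw [hvy, show value a P + ω * value b P = -(ω * (ω - 1)) * value b P by
          linear_combination h0]
        exact mul_ne_zero (neg_ne_zero.mpr (mul_ne_zero hω0 hω12)) hb0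

/-! ### Quadrics on the cuspidal cubic -/

/-- The parametrization of the cuspidal cubic. -/
noncomputable def cuspParam : Form →ₐ[ℂ] Polynomial ℂ := aeval ![Polynomial.X ^ 3, 1, Polynomial.X]

lemma eval_cuspParam (t : ℂ) (G : Form) : (cuspParam G).eval t = eval ![t ^ 3, 1, t] G := by
  have : (Polynomial.aeval t).comp cuspParam = aeval ![t ^ 3, 1, t] := by
    ext i
    fin_cases i <;> simp [cuspParam]
  have := DFunLike.congr_fun this G
  simpa [aeval_eq_eval] using this

lemma cuspParam_cuspidalCubic : cuspParam cuspidalCubic = 0 := by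
  simp [cuspParam, cuspidalCubic]

/-- Points of the cuspidal cubic other than the cusp are of the form `(t³ : 1 : t)`. -/
lemma exists_eq_of_eval_cuspidalCubic {x : Fin 3 → ℂ} (hx : eval x cuspidalCubic = 0)
    (h : x 1 ≠ 0) : ∃ t : ℂ, x = x 1 • ![t ^ 3, 1, t] := by
  rw [eval_cuspidalCubic] at hx
  refine ⟨x 2 / x 1, ?_⟩
  ext i
  fin_cases i
  · simp; field_simp; linear_combination hx
  · simp
  · simp; field_simp

end SemiTorus

/-! ### Conics restricted to the cuspidal cubic -/

namespace SemiTorus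
open MvPolynomial

/-- The polynomial with given coefficients, of degree at most six. -/
noncomputable def sexticPoly (c : Fin 7 → ℂ) : Polynomial ℂ :=
  ∑ i, Polynomial.C (c i) * Polynomial.X ^ (i : ℕ)

lemma coeff_sexticPoly (c : Fin 7 → ℂ) (i : Fin 7) : (sexticPoly c).coeff i = c i := by
  rw [sexticPoly, Polynomial.finsetSum_coeff, Finset.sum_eq_single i]
  · simp
  · intro j _ hj
    rw [Polynomial.coeff_C_mul_X_pow, if_neg]
    exact fun h => hj (Fin.ext h.symm)
  · simp

lemma sexticPoly_injective {c d : Fin 7 → ℂ} (h : sexticPoly c = sexticPoly d) : c = d := by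
  funext i
  rw [← coeff_sexticPoly c, h, coeff_sexticPoly]

/-- A quadric is determined by its restriction to the cuspidal cubic. -/
lemma eq_of_cuspParam_eq {q : Form} (hq : q.IsHomogeneous 2) {c : Fin 7 → ℂ}
    (h : cuspParam q = sexticPoly c) : c 5 = 0 ∧ q = C (c 6) * X 0 ^ 2 + C (c 3) * (X 0 * X 1)
      + C (c 4) * (X 0 * X 2) + C (c 0) * X 1 ^ 2 + C (c 1) * (X 1 * X 2) + C (c 2) * X 2 ^ 2 := by
  obtain ⟨a₀, a₁, a₂, a₃, a₄, a₅, rfl⟩ := exists_eq_quadratic hq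
  -- The quadratic monomials restrict to $t^6,t^3,t^4,1,t,t^2$; the power $t^5$ is missing.
  have : sexticPoly ![a₃, a₄, a₅, a₁, a₂, 0, a₀] = sexticPoly c := by
    rw [← h]
    simp [sexticPoly, Fin.sum_univ_succ, cuspParam, Polynomial.algebraMap_eq]
    ring
  rw [← sexticPoly_injective this]
  simp

lemma natDegree_cuspParam_le {q : Form} (hq : q.IsHomogeneous 2) :
    (cuspParam q).natDegree ≤ 6 := by
  obtain ⟨a₀, a₁, a₂, a₃, a₄, a₅, rfl⟩ := exists_eq_quadratic hq
  simp only [cuspParam, map_add, map_mul, map_pow, aeval_C, aeval_X, Matrix.cons_val_zero,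
    Matrix.cons_val_one, Matrix.cons_val, ← Polynomial.C_eq_algebraMap]
  compute_degree

lemma exists_eq_of_natDegree_le_two {p : Polynomial ℂ} (h : p.natDegree ≤ 2) :
    ∃ a b c : ℂ, p = Polynomial.C a * Polynomial.X ^ 2 + Polynomial.C b * Polynomial.X
      + Polynomial.C c :=
  ⟨_, _, _, Polynomial.eq_quadratic_of_degree_le_two (Polynomial.degree_le_of_natDegree_le h)⟩

/-- If the cuspidal cubic is a component of the sextic `f ^ 3 + g ^ 2 * h`, the restrictions of
the three quadrics to it are determined by two polynomials of degree at most two. -/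
lemma exists_cuspParam_eq {f g h : Form} (hg : g.IsHomogeneous 2)
    (hh : h.IsHomogeneous 2) (hdvd : cuspidalCubic ∣ sextic f g h) (hg0 : cuspParam g ≠ 0)
    (hne : ∀ x ≠ 0, eval x f = 0 → eval x g = 0 → eval x h ≠ 0) :
    ∃ D E : Polynomial ℂ, D.natDegree ≤ 2 ∧ E.natDegree ≤ 2 ∧ cuspParam g = D ^ 3 ∧
      cuspParam f = D ^ 2 * E ∧ cuspParam h = - E ^ 3 ∧
      ∀ t, D.eval t = 0 → E.eval t ≠ 0 := by
  have hF : cuspParam f ^ 3 + cuspParam g ^ 2 * cuspParam h = 0 := by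
    obtain ⟨B, hB⟩ := hdvd
    have := congrArg cuspParam hB
    rwa [map_mul, cuspParam_cuspidalCubic, zero_mul, sextic, map_add, map_mul, map_pow,
      map_pow] at this
  have hne' : ∀ t, (cuspParam f).eval t = 0 → (cuspParam g).eval t = 0 →
      (cuspParam h).eval t ≠ 0 := by
    intro t
    rw [eval_cuspParam, eval_cuspParam, eval_cuspParam]
    exact hne _ fun h => one_ne_zero (congrFun h 1)
  have hdf : ∀ t, (cuspParam g).eval t = 0 → (cuspParam f).eval t = 0 := by
    intro t ht
    have := congrArg (Polynomial.eval t) hF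
    simpa [ht] using this
  obtain ⟨D, E, h1, h2, h3⟩ : ∃ D E : Polynomial ℂ, cuspParam g = D ^ 3 ∧
      cuspParam f = D ^ 2 * E ∧ cuspParam h = - E ^ 3 := by
    -- A common zero of $g,h$ on the curve would also be one of $f$, since $f^3=-g^2h$. Hence $h$ is
    -- a cube up to a constant.
    have hcop : IsCoprime (cuspParam h) (cuspParam g ^ 2) := by
      refine IsCoprime.pow_right ?_
      rw [Polynomial.isCoprime_iff_aeval_ne_zero_of_isAlgClosed ℂ ℂ]
      intro t
      by_contra! hcon
      simp only [Polynomial.coe_aeval_eq_eval] at hcon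
      exact hne' t (hdf t hcon.2) hcon.2 hcon.1
    obtain ⟨E₀, w, hw⟩ := exists_associated_pow_of_mul_eq_pow' hcop
      (show cuspParam h * cuspParam g ^ 2 = (-cuspParam f) ^ 3 by linear_combination hF)
    obtain ⟨c, hc, hcw⟩ := Polynomial.isUnit_iff.mp w.isUnit
    obtain ⟨z, hz⟩ := IsAlgClosed.exists_pow_nat_eq (-c) (show 0 < 3 by norm_num)
    have hE : cuspParam h = - (Polynomial.C z * E₀) ^ 3 := by
      rw [← hw, ← hcw, mul_pow, ← map_pow, hz, map_neg]; ring
    generalize Polynomial.C z * E₀ = E at hE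
    by_cases hE0 : E = 0
    · have hh0 : cuspParam h = 0 := by rw [hE, hE0]; ring
      rw [hh0, mul_zero, add_zero] at hF
      have hf0 : cuspParam f = 0 := pow_eq_zero_iff (three_ne_zero) |>.mp hF
      rw [hh0, isCoprime_zero_left, isUnit_pow_iff two_ne_zero, Polynomial.isUnit_iff] at hcop
      obtain ⟨c, -, hc⟩ := hcop
      obtain ⟨z, hz⟩ := IsAlgClosed.exists_pow_nat_eq c (show 0 < 3 by norm_num)
      exact ⟨Polynomial.C z, 0, by rw [← hc, ← hz, map_pow], by rw [hf0, mul_zero],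
        by rw [hh0]; ring⟩
    · have h4 : cuspParam f ^ 3 = E ^ 3 * cuspParam g ^ 2 := by
        rw [hE] at hF; linear_combination hF
      -- From $f=Ek$ follows $k^3=g^2$, and unique factorization gives $g=D^3$, $k=D^2$.
      obtain ⟨k, hk⟩ := (UniqueFactorizationMonoid.pow_dvd_pow_iff_dvd three_ne_zero).mp ⟨_, h4⟩
      have h5 : k ^ 3 = cuspParam g ^ 2 := by
        refine mul_left_cancel₀ (pow_ne_zero 3 hE0) ?_
        rw [← h4, hk]; ring
      obtain ⟨D, hD⟩ := (UniqueFactorizationMonoid.pow_dvd_pow_iff_dvd two_ne_zero).mp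
        (show k ^ 2 ∣ cuspParam g ^ 2 from ⟨k, by rw [← h5]; ring⟩)
      have hk0 : k ≠ 0 := by rintro rfl; exact hg0 (by rw [hD, zero_mul])
      have h6 : k = D ^ 2 := by
        refine mul_left_cancel₀ (pow_ne_zero 2 hk0) ?_
        rw [hD] at h5; linear_combination h5
      exact ⟨D, E, by rw [hD, h6]; ring, by rw [hk, h6]; ring, hE⟩
  refine ⟨D, E, ?_, ?_, h1, h2, h3, fun t hD hE => ?_⟩
  · have := natDegree_cuspParam_le hg
    rw [h1, Polynomial.natDegree_pow] at this
    omega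
  · have := natDegree_cuspParam_le hh
    rw [h3, Polynomial.natDegree_neg, Polynomial.natDegree_pow] at this
    omega
  · exact hne' t (by rw [h2]; simp [hD]) (by rw [h1]; simp [hD]) (by rw [h3]; simp [hE])

end SemiTorus

namespace SemiTorus
open MvPolynomial

/-! ### Cusps of cubics -/

/-- In suitable linear coordinates, `A` is the cuspidal cubic, with its cusp at `x`. -/
def IsCuspOf (A : Form) (x : Fin 3 → ℂ) : Prop :=
  ∃ (N : Matrix (Fin 3) (Fin 3) ℂ) (c : ℂ), N.det ≠ 0 ∧ c ≠ 0 ∧ N.mulVec x = c • ![1, 0, 0] ∧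
    ∀ y, eval y A = eval (N.mulVec y) cuspidalCubic

lemma IsCuspOf.of_lin {A : Form} {M : Matrix (Fin 3) (Fin 3) ℂ} {c : ℂ} {x : Fin 3 → ℂ}
    (hM : M.det ≠ 0) (hc : c ≠ 0) (hx : M.mulVec ![1, 0, 0] = c • x)
    (h : lin M A = cuspidalCubic) : IsCuspOf A x := by
  have hMu := isUnit_iff_ne_zero.mpr hM
  refine ⟨M⁻¹, c⁻¹, fun h0 => ?_, inv_ne_zero hc, ?_, fun y => ?_⟩
  · have := congrArg Matrix.det (Matrix.mul_nonsing_inv _ hMu)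
    rw [Matrix.det_mul, h0] at this
    simp at this
  · have h1 := congrArg (M⁻¹).mulVec hx
    rw [Matrix.mulVec_mulVec, Matrix.nonsing_inv_mul _ hMu, Matrix.one_mulVec,
      Matrix.mulVec_smul] at h1
    rw [h1, smul_smul, inv_mul_cancel₀ hc, one_smul]
  · rw [← h, eval_lin, Matrix.mulVec_mulVec, Matrix.mul_nonsing_inv _ hMu, Matrix.one_mulVec]

lemma IsCuspOf.comp_lin {A : Form} {M : Matrix (Fin 3) (Fin 3) ℂ} {x : Fin 3 → ℂ} (hM : M.det ≠ 0)
    (h : IsCuspOf A (M.mulVec x)) : IsCuspOf (lin M A) x := by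
  obtain ⟨N, c, hN, hc, hx, hA⟩ := h
  refine ⟨N * M, c, ?_, hc, ?_, fun y => ?_⟩
  · rw [Matrix.det_mul]; exact mul_ne_zero hN hM
  · rw [← Matrix.mulVec_mulVec, hx]
  · rw [eval_lin, hA, Matrix.mulVec_mulVec]

/-- Along lines through the cusp there is no linear term and the quadratic term is a square of rank
one. -/
lemma IsCuspOf.expand {A : Form} {x : Fin 3 → ℂ} (h : IsCuspOf A x) :
    ∃ (N : Matrix (Fin 3) (Fin 3) ℂ) (c : ℂ), N.det ≠ 0 ∧ c ≠ 0 ∧ N.mulVec x = c • ![1, 0, 0] ∧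
      ∀ u (T : ℂ), eval (x + T • u) A = c * T ^ 2 * (N.mulVec u 1) ^ 2
        + T ^ 3 * (N.mulVec u 0 * N.mulVec u 1 ^ 2 - N.mulVec u 2 ^ 3) := by
  obtain ⟨N, c, hN, hc, hx, hA⟩ := h
  refine ⟨N, c, hN, hc, hx, fun u T => ?_⟩
  rw [hA, Matrix.mulVec_add, hx, Matrix.mulVec_smul, eval_cuspidalCubic]
  simp
  ring

lemma cubic_coeff_eq_zero {a₀ a₁ a₂ a₃ : ℂ}
    (h : ∀ T : ℂ, a₀ + a₁ * T + a₂ * T ^ 2 + a₃ * T ^ 3 = 0) :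
    a₀ = 0 ∧ a₁ = 0 ∧ a₂ = 0 ∧ a₃ = 0 := by
  have h0 := h 0
  have h1 := h 1
  have h2 := h (-1)
  have h3 := h 2
  norm_num at h0 h1 h2 h3
  have e2 : a₂ = 0 := by linear_combination (h1 + h2) / 2 - h0
  have e3 : a₃ = 0 := by linear_combination (h3 - h0 - 4 * e2 - (h1 - h2)) / 6
  exact ⟨h0, by linear_combination (h1 - h2) / 2 - e3, e2, e3⟩

/-- The gradient vanishes at a cusp, and $(1:0:0)$ is the only singular point of the cuspidal cubic.
-/
lemma eq_smul_of_isCuspOf_cuspidalCubic {x : Fin 3 → ℂ} (h : IsCuspOf cuspidalCubic x) :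
    x 1 = 0 ∧ x 2 = 0 := by
  obtain ⟨N, c, -, -, -, hN⟩ := h.expand
  have key : ∀ u : Fin 3 → ℂ, x 0 * x 1 ^ 2 - x 2 ^ 3 = 0 ∧
      u 0 * x 1 ^ 2 + 2 * x 0 * x 1 * u 1 - 3 * x 2 ^ 2 * u 2 = 0 := by
    intro u
    obtain ⟨h0, h1, -⟩ := cubic_coeff_eq_zero
      (a₀ := x 0 * x 1 ^ 2 - x 2 ^ 3)
      (a₁ := u 0 * x 1 ^ 2 + 2 * x 0 * x 1 * u 1 - 3 * x 2 ^ 2 * u 2)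
      (a₂ := 2 * u 0 * x 1 * u 1 + x 0 * u 1 ^ 2 - 3 * x 2 * u 2 ^ 2 - c * N.mulVec u 1 ^ 2)
      (a₃ := u 0 * u 1 ^ 2 - u 2 ^ 3 - (N.mulVec u 0 * N.mulVec u 1 ^ 2 - N.mulVec u 2 ^ 3))
      (fun T => by
        have := hN u T
        rw [eval_cuspidalCubic] at this
        simp only [Pi.add_apply, Pi.smul_apply, smul_eq_mul] at this
        linear_combination this)
    exact ⟨h0, h1⟩
  have h1 := (key ![1, 0, 0]).2
  have h2 := (key ![1, 0, 0]).1
  simp at h1 h2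
  simpa [h1] using h2

/-- If a cubic which is even in `X 1` has a cusp, its part of degree zero in `X 1` satisfies two of
the conditions for being a cube. -/
lemma discrim_eq_zero_of_isCuspOf {c₀ c₁ c₂ c₃ l₀ l₂ : ℂ} {q : Fin 3 → ℂ}
    (h : IsCuspOf (C c₀ * X 0 ^ 3 + C c₁ * (X 0 ^ 2 * X 2) + C c₂ * (X 0 * X 2 ^ 2)
      + C c₃ * X 2 ^ 3 + X 1 ^ 2 * (C l₀ * X 0 + C l₂ * X 2)) q) :
    l₀ * q 0 + l₂ * q 2 ≠ 0 ∧ c₁ ^ 2 = 3 * c₀ * c₂ ∧ c₂ ^ 2 = 3 * c₁ * c₃ := by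
  obtain ⟨N, c, hNdet, hc, hNq, hN⟩ := h.expand
  have key : ∀ u : Fin 3 → ℂ,
      (c₀ * q 0 ^ 3 + c₁ * q 0 ^ 2 * q 2 + c₂ * q 0 * q 2 ^ 2 + c₃ * q 2 ^ 3
        + q 1 ^ 2 * (l₀ * q 0 + l₂ * q 2) = 0) ∧
      ((3 * c₀ * q 0 + c₁ * q 2) * u 0 ^ 2 + 2 * (c₁ * q 0 + c₂ * q 2) * u 0 * u 2
        + (c₂ * q 0 + 3 * c₃ * q 2) * u 2 ^ 2 + u 1 ^ 2 * (l₀ * q 0 + l₂ * q 2)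
        + 2 * q 1 * u 1 * (l₀ * u 0 + l₂ * u 2) - c * N.mulVec u 1 ^ 2 = 0) ∧
      (c₀ * u 0 ^ 3 + c₁ * u 0 ^ 2 * u 2 + c₂ * u 0 * u 2 ^ 2 + c₃ * u 2 ^ 3
        + u 1 ^ 2 * (l₀ * u 0 + l₂ * u 2)
        - (N.mulVec u 0 * N.mulVec u 1 ^ 2 - N.mulVec u 2 ^ 3) = 0) ∧
      ((3 * c₀ * q 0 ^ 2 + 2 * c₁ * q 0 * q 2 + c₂ * q 2 ^ 2 + q 1 ^ 2 * l₀) * u 0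
        + (c₁ * q 0 ^ 2 + 2 * c₂ * q 0 * q 2 + 3 * c₃ * q 2 ^ 2 + q 1 ^ 2 * l₂) * u 2
        + 2 * q 1 * (l₀ * q 0 + l₂ * q 2) * u 1 = 0) := by
    intro u
    obtain ⟨h0, h1, h2, h3⟩ := cubic_coeff_eq_zero
      (a₀ := c₀ * q 0 ^ 3 + c₁ * q 0 ^ 2 * q 2 + c₂ * q 0 * q 2 ^ 2 + c₃ * q 2 ^ 3
        + q 1 ^ 2 * (l₀ * q 0 + l₂ * q 2))
      (a₁ := (3 * c₀ * q 0 ^ 2 + 2 * c₁ * q 0 * q 2 + c₂ * q 2 ^ 2 + q 1 ^ 2 * l₀) * u 0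
        + (c₁ * q 0 ^ 2 + 2 * c₂ * q 0 * q 2 + 3 * c₃ * q 2 ^ 2 + q 1 ^ 2 * l₂) * u 2
        + 2 * q 1 * (l₀ * q 0 + l₂ * q 2) * u 1)
      (a₂ := (3 * c₀ * q 0 + c₁ * q 2) * u 0 ^ 2 + 2 * (c₁ * q 0 + c₂ * q 2) * u 0 * u 2
        + (c₂ * q 0 + 3 * c₃ * q 2) * u 2 ^ 2 + u 1 ^ 2 * (l₀ * q 0 + l₂ * q 2)
        + 2 * q 1 * u 1 * (l₀ * u 0 + l₂ * u 2) - c * N.mulVec u 1 ^ 2)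
      (a₃ := c₀ * u 0 ^ 3 + c₁ * u 0 ^ 2 * u 2 + c₂ * u 0 * u 2 ^ 2 + c₃ * u 2 ^ 3
        + u 1 ^ 2 * (l₀ * u 0 + l₂ * u 2)
        - (N.mulVec u 0 * N.mulVec u 1 ^ 2 - N.mulVec u 2 ^ 3))
      (fun T => by
        have := hN u T
        simp only [map_add, map_mul, map_pow, eval_C, eval_X, Pi.add_apply, Pi.smul_apply,
          smul_eq_mul] at this
        linear_combination this)
    exact ⟨h0, h2, h3, h1⟩
  have hrow : ∀ u, N.mulVec u 1 = N 1 0 * u 0 + N 1 1 * u 1 + N 1 2 * u 2 := by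
    intro u; simp [Matrix.mulVec, dotProduct, Fin.sum_univ_three]
  have hrow0 : N 1 0 ≠ 0 ∨ N 1 1 ≠ 0 ∨ N 1 2 ≠ 0 := by
    by_contra! hcon
    exact hNdet (Matrix.det_eq_zero_of_row_eq_zero 1 fun j => by
      fin_cases j; exacts [hcon.1, hcon.2.1, hcon.2.2])
  have e0 := (key ![1, 0, 0]).2.1
  have e1 := (key ![0, 1, 0]).2.1
  have e2 := (key ![0, 0, 1]).2.1
  have e01 := (key ![1, 1, 0]).2.1
  have e12 := (key ![0, 1, 1]).2.1
  have e02 := (key ![1, 0, 1]).2.1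
  rw [hrow] at e0 e1 e2 e01 e12 e02
  simp at e0 e1 e2 e01 e12 e02
  -- Otherwise $N_{11}=0$, and the cubic term makes $N(0,1,0)$ proportional to $Nq$. Then $q$ is
  -- proportional to $(0,1,0)$ and the whole second row of $N$ vanishes.
  have hL : l₀ * q 0 + l₂ * q 2 ≠ 0 := by
    intro hL
    rw [hL, zero_sub, neg_eq_zero, mul_eq_zero, pow_eq_zero_iff two_ne_zero] at e1
    have hβ := e1.resolve_left hc
    have h3 := (key ![0, 1, 0]).2.2.1
    have hy1 : N.mulVec ![0, 1, 0] 1 = 0 := by rw [hrow]; simp [hβ]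
    rw [hy1] at h3
    simp at h3
    have hy : N.mulVec (c • ![0, 1, 0] - N.mulVec ![0, 1, 0] 0 • q) = 0 := by
      rw [Matrix.mulVec_sub, Matrix.mulVec_smul, Matrix.mulVec_smul, hNq]
      ext i
      fin_cases i
      · simp; ring
      · simp [hy1]
      · simp [h3]
    have hz := Matrix.eq_zero_of_mulVec_eq_zero hNdet hy
    have z0 := congrFun hz 0
    have z1 := congrFun hz 1
    have z2 := congrFun hz 2
    simp at z0 z1 z2
    have hy0 : N.mulVec ![0, 1, 0] 0 ≠ 0 := by
      intro h0; rw [h0, zero_mul, sub_zero] at z1; exact hc z1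
    have q0 := z0.resolve_left hy0
    have q2 := z2.resolve_left hy0
    rw [q0, q2] at e0 e2
    simp [hc] at e0 e2
    tauto
  have hβ : N 1 1 ≠ 0 := by
    intro hβ; rw [hβ] at e1; simp at e1; exact hL e1
  have hq1 : q 1 = 0 := by
    have := (key ![0, 1, 0]).2.2.2
    simp at this
    tauto
  rw [hq1] at e01 e12
  -- With $q_1=0$ the quadratic term is even in $u_1$, so the square of a linear form containing
  -- $u_1$ must be a multiple of $u_1^2$.
  have hα : N 1 0 = 0 := by
    have : c * N 1 0 * N 1 1 = 0 := by linear_combination (e0 + e1 - e01) / 2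
    simpa [hc, hβ] using this
  have hγ : N 1 2 = 0 := by
    have : c * N 1 2 * N 1 1 = 0 := by linear_combination (e2 + e1 - e12) / 2
    simpa [hc, hβ] using this
  rw [hα, hγ] at e02
  rw [hα] at e0
  rw [hγ] at e2
  -- The second derivatives of the binary cubic in $X_0,X_2$ vanish at $(q_0,q_2)$.
  have f0 : 3 * c₀ * q 0 + c₁ * q 2 = 0 := by linear_combination e0
  have f2 : c₂ * q 0 + 3 * c₃ * q 2 = 0 := by linear_combination e2
  have f1 : c₁ * q 0 + c₂ * q 2 = 0 := by linear_combination (e02 - e0 - e2) / 2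
  refine ⟨hL, ?_⟩
  by_cases q0 : q 0 = 0
  · have q2 : q 2 ≠ 0 := by rintro q2; rw [q0, q2] at hL; simp at hL
    rw [q0] at f0 f1 f2
    simp [q2] at f0 f1 f2
    simp [f0, f1, f2]
  · constructor
    · refine mul_left_cancel₀ q0 ?_
      linear_combination c₁ * f1 - c₂ * f0
    · refine mul_left_cancel₀ q0 ?_
      linear_combination c₂ * f2 - 3 * c₃ * f1
end SemiTorus

namespace SemiTorus
open MvPolynomial
variable {f g h A B : Form}

/-! ### Splitting into two cubics: the case of two cusps -/

lemma IsGood.eval_ne (H : IsGood f g h) {x : Fin 3 → ℂ} (hx : x ≠ 0) (hf : eval x f = 0)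
    (hg : eval x g = 0) : eval x h ≠ 0 :=
  (eval_ne_zero_of_value_ne_zero H.hh hx).mp
    (H.value_ne _ ((value_mk_eq_zero H.hf hx).mpr hf) ((value_mk_eq_zero H.hg hx).mpr hg))

lemma mulVec_ne_zero {M : Matrix (Fin 3) (Fin 3) ℂ} (hM : M.det ≠ 0) {x : Fin 3 → ℂ}
    (hx : x ≠ 0) : M.mulVec x ≠ 0 := fun h => hx (Matrix.eq_zero_of_mulVec_eq_zero hM h)

/-- A sextic which splits into two cubics has cusps only at cusps of exactly one component. -/
lemma isCuspOf_of_mul {F : Form} {P : Plane} (hP : HasType F P (.A 2)) (hA : A.IsHomogeneous 3)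
    (hB : B.IsHomogeneous 3) (hF : F = A * B) :
    (IsCuspOf A P.rep ∧ value B P ≠ 0) ∨ (IsCuspOf B P.rep ∧ value A P ≠ 0) := by
  obtain ⟨hτ, Φ, hΦ, e, he, heq⟩ := hP
  rw [isUnit_iff_constantCoeff_ne_zero] at he
  have heq' : aeval Φ A * aeval Φ B = e * (MvPowerSeries.X 0 ^ 2 + MvPowerSeries.X 1 ^ 3) := by
    rw [← map_mul, ← hF]; exact heq
  have h0 : value A P * value B P = 0 := by
    have := congrArg (MvPowerSeries.constantCoeff) heq'
    simpa [constantCoeff_aeval hΦ] using this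
  have key : ∀ {A B : Form}, A.IsHomogeneous 3 →
      aeval Φ A * aeval Φ B = e * (MvPowerSeries.X 0 ^ 2 + MvPowerSeries.X 1 ^ 3) →
      value B P ≠ 0 → IsCuspOf A P.rep := by
    intro A B hA heq' hBP
    obtain ⟨e', he', h'⟩ := exists_unit_mul_of_mul_eq
      (by rw [constantCoeff_aeval hΦ]; exact hBP) he heq'
    obtain ⟨-, M, c, hM, hc, hMc, hlin⟩ := exists_lin_eq_cuspidalCubic hΦ hA he' le_rfl
      (by norm_num) h'
    exact IsCuspOf.of_lin hM hc hMc hlin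
  by_cases hBP : value B P = 0
  · by_cases hAP : value A P = 0
    -- Two vanishing factors would need an even exponent, but $A_2$ has exponent $3$.
    · obtain ⟨i, -, hi, -⟩ := mul_eq_A (by rw [constantCoeff_aeval hΦ, hAP])
        (by rw [constantCoeff_aeval hΦ, hBP]) he (by norm_num) heq'
      omega
    · exact Or.inr ⟨key hB (by rw [mul_comm]; exact heq') hAP, hAP⟩
  · exact Or.inl ⟨key hA heq' hBP, hBP⟩

/-- The case of a common parametrization by even polynomials. -/
lemma false_of_even_param {d k e r : ℂ} {q : Fin 3 → ℂ} (hd : d ≠ 0) (hk : k ≠ 0)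
    (hf : f = C (d ^ 2 * k) * X 0 ^ 2 + C (d ^ 2 * e + 2 * d * r * k) * (X 0 * X 2)
      + C (2 * d * r * e + r ^ 2 * k) * X 2 ^ 2 + C (r ^ 2 * e) * X 1 ^ 2)
    (hg : g = C (d ^ 3) * X 0 ^ 2 + C (3 * d ^ 2 * r) * (X 0 * X 2)
      + C (3 * d * r ^ 2) * X 2 ^ 2 + C (r ^ 3) * X 1 ^ 2)
    (hh : h = - (C (k ^ 3) * X 0 ^ 2 + C (3 * k ^ 2 * e) * (X 0 * X 2)
      + C (3 * k * e ^ 2) * X 2 ^ 2 + C (e ^ 3) * X 1 ^ 2))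
    (hF : sextic f g h = cuspidalCubic * B) (hq : IsCuspOf B q) : False := by
  have hcusp0 : cuspidalCubic ≠ 0 := fun h0 => by
    have := congrArg (eval ![1, 1, 0]) h0
    rw [eval_cuspidalCubic] at this
    simp at this
  obtain ⟨m, hm⟩ : ∃ m, m = -(r * k - e * d) ^ 2 := ⟨_, rfl⟩
  -- The explicit quotient of the sextic by the cuspidal cubic; it is even in $X_1$ and contains the
  -- factor $m=-(rk-ed)^2$.
  have hB : B = C (m * (d ^ 3 * (e * d + 2 * r * k))) * X 0 ^ 3
      + C (m * (6 * d ^ 2 * r * (e * d + r * k))) * (X 0 ^ 2 * X 2)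
      + C (m * (6 * d * r ^ 2 * (2 * e * d + r * k))) * (X 0 * X 2 ^ 2)
      + C (m * (r ^ 3 * (8 * e * d + r * k))) * X 2 ^ 3
      + X 1 ^ 2 * (C (m * (r ^ 3 * (r * k + 2 * e * d))) * X 0 + C (m * (r ^ 3 * (3 * r * e))) * X 2) := by
    refine mul_left_cancel₀ hcusp0 ?_
    rw [← hF, sextic, hf, hg, hh, hm, cuspidalCubic]
    have h3 : (C 3 : Form) = 3 := rfl
    have h2 : (C 2 : Form) = 2 := rfl
    have h6 : (C 6 : Form) = 6 := rfl
    have h8 : (C 8 : Form) = 8 := rfl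
    simp only [map_mul, map_add, map_sub, map_pow, map_neg, h2, h3, h6, h8]
    ring
  rw [hB] at hq
  have hm0 : m ≠ 0 := by
    rintro rfl
    obtain ⟨N, c, hN, -, -, hA⟩ := hq
    have := hA (N⁻¹.mulVec ![1, 1, 0])
    rw [Matrix.mulVec_mulVec, Matrix.mul_nonsing_inv _ (isUnit_iff_ne_zero.mpr hN),
      Matrix.one_mulVec, eval_cuspidalCubic] at this
    simp at this
  obtain ⟨hL, h1, h2⟩ := discrim_eq_zero_of_isCuspOf hq
  have hr0 : r ≠ 0 := by
    rintro rfl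
    exact hL (by ring)
  have he : e = 0 := by
    have : m ^ 2 * 18 * d ^ 5 * r ^ 3 * k * e = 0 := by linear_combination -h1
    simpa [hm0, hd, hr0, hk] using this
  subst he
  have : m ^ 2 * 18 * d ^ 2 * r ^ 6 * k ^ 2 = 0 := by linear_combination h2
  simp [hm0, hd, hr0, hk] at this

lemma exists_mulVec_eq {M : Matrix (Fin 3) (Fin 3) ℂ} (hM : M.det ≠ 0) (x : Fin 3 → ℂ) :
    ∃ y, M.mulVec y = x :=
  ⟨M⁻¹.mulVec x, by rw [Matrix.mulVec_mulVec,
    Matrix.mul_nonsing_inv _ (isUnit_iff_ne_zero.mpr hM), Matrix.one_mulVec]⟩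

lemma IsCuspOf.exists_lin {x : Fin 3 → ℂ} (h : IsCuspOf A x) :
    ∃ (M : Matrix (Fin 3) (Fin 3) ℂ) (c : ℂ), M.det ≠ 0 ∧ c ≠ 0 ∧
      M.mulVec ![1, 0, 0] = c • x ∧ lin M A = cuspidalCubic := by
  obtain ⟨N, c, hN, hc, hx, hA⟩ := h
  have hNu := isUnit_iff_ne_zero.mpr hN
  refine ⟨N⁻¹, c⁻¹, fun h0 => ?_, inv_ne_zero hc, ?_, ?_⟩
  · have := congrArg Matrix.det (Matrix.mul_nonsing_inv _ hNu)
    rw [Matrix.det_mul, h0] at this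
    simp at this
  · have h1 := congrArg (N⁻¹).mulVec hx
    rw [Matrix.mulVec_mulVec, Matrix.nonsing_inv_mul _ hNu, Matrix.one_mulVec,
      Matrix.mulVec_smul] at h1
    rw [h1, smul_smul, inv_mul_cancel₀ hc, one_smul]
  · refine MvPolynomial.funext fun y => ?_
    rw [eval_lin, hA, Matrix.mulVec_mulVec, Matrix.mul_nonsing_inv _ hNu, Matrix.one_mulVec]

lemma lin_sextic (M : Matrix (Fin 3) (Fin 3) ℂ) :
    lin M (sextic f g h) = sextic (lin M f) (lin M g) (lin M h) := by
  simp [sextic]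

lemma eval_one_zero_zero {q : Form} (hq : q.IsHomogeneous 2) {c : Fin 7 → ℂ}
    (h : cuspParam q = sexticPoly c) : eval ![1, 0, 0] q = c 6 := by
  rw [(eq_of_cuspParam_eq hq h).2]
  simp

lemma cuspParam_ne_zero {q : Form} (hq : q.IsHomogeneous 2) (h : eval ![1, 0, 0] q ≠ 0) :
    cuspParam q ≠ 0 := by
  intro h0
  refine h (eval_one_zero_zero hq (c := 0) ?_)
  rw [h0]; simp [sexticPoly]

/-- The square and cube combinations of two quadratic polynomials, by coefficients. -/
lemma sq_mul_eq_sexticPoly (a b c a' b' c' : ℂ) :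
    (Polynomial.C a * Polynomial.X ^ 2 + Polynomial.C b * Polynomial.X + Polynomial.C c) ^ 2
      * (Polynomial.C a' * Polynomial.X ^ 2 + Polynomial.C b' * Polynomial.X + Polynomial.C c')
    = sexticPoly ![c ^ 2 * c', 2 * b * c * c' + c ^ 2 * b',
        (b ^ 2 + 2 * a * c) * c' + 2 * b * c * b' + c ^ 2 * a',
        2 * a * b * c' + (b ^ 2 + 2 * a * c) * b' + 2 * b * c * a',
        a ^ 2 * c' + 2 * a * b * b' + (b ^ 2 + 2 * a * c) * a',
        a ^ 2 * b' + 2 * a * b * a', a ^ 2 * a'] := by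
  have h2 : (Polynomial.C 2 : Polynomial ℂ) = 2 := rfl
  simp [sexticPoly, Fin.sum_univ_succ, h2]
  ring

/-- In coordinates where $A$ is the cuspidal cubic, $f$ and $g$ do not vanish at its cusp, so $D$
and $E$ have degree exactly two. The missing $t^5$ in $D^3,E^3$ makes both even, which is the case
of `false_of_even_param`. -/
theorem false_of_two_cusps (H : IsGood f g h) {x y : Fin 3 → ℂ} (hB : IsCuspOf B y)
    (hA : IsCuspOf A x) (hfx : eval x f ≠ 0) (hgx : eval x g ≠ 0)
    (hF : sextic f g h = A * B) : False := by
  obtain ⟨M, c, hM, hc, hMx, hlin⟩ := hA.exists_lin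
  obtain ⟨y, rfl⟩ := exists_mulVec_eq hM y
  have hB' := hB.comp_lin hM
  have hF' : sextic (lin M f) (lin M g) (lin M h) = cuspidalCubic * lin M B := by
    rw [← lin_sextic, hF, map_mul, hlin]
  have hf' := lin_isHomogeneous H.hf M
  have hg' := lin_isHomogeneous H.hg M
  have hh' := lin_isHomogeneous H.hh M
  have hf0 : eval ![1, 0, 0] (lin M f) ≠ 0 := by
    rw [eval_lin, hMx, eval_smul_of_isHomogeneous H.hf]
    exact mul_ne_zero (pow_ne_zero 2 hc) hfx
  have hg0 : eval ![1, 0, 0] (lin M g) ≠ 0 := by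
    rw [eval_lin, hMx, eval_smul_of_isHomogeneous H.hg]
    exact mul_ne_zero (pow_ne_zero 2 hc) hgx
  obtain ⟨D, E, hD, hE, h1, h2, h3, -⟩ := exists_cuspParam_eq hg' hh' ⟨_, hF'⟩
    (cuspParam_ne_zero hg' hg0) fun z hz hfz hgz => by
      rw [eval_lin] at *
      exact H.eval_ne (mulVec_ne_zero hM hz) hfz hgz
  obtain ⟨d, d', r, rfl⟩ := exists_eq_of_natDegree_le_two hD
  obtain ⟨k, k', e, rfl⟩ := exists_eq_of_natDegree_le_two hE
  rw [sq_mul_eq_sexticPoly] at h2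
  rw [pow_succ, sq_mul_eq_sexticPoly] at h1
  rw [pow_succ, sq_mul_eq_sexticPoly] at h3
  obtain ⟨hf5, hfe⟩ := eq_of_cuspParam_eq hf' h2
  obtain ⟨hg5, hge⟩ := eq_of_cuspParam_eq hg' h1
  obtain ⟨hh5, hhe⟩ := eq_of_cuspParam_eq (q := -lin M h) hh'.neg (by rw [map_neg, h3, neg_neg])
  have hdk := eval_one_zero_zero hf' h2
  rw [hdk] at hf0
  simp at hf0 hf5 hg5 hh5 hfe hge hhe
  obtain ⟨hd, hk⟩ := hf0
  obtain rfl : d' = 0 := by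
    have : 3 * d ^ 2 * d' = 0 := by linear_combination hg5
    simpa [hd] using this
  obtain rfl : k' = 0 := by
    have : 3 * k ^ 2 * k' = 0 := by linear_combination hh5
    simpa [hk] using this
  have hC3 : (C 3 : Form) = 3 := rfl
  have hC2 : (C 2 : Form) = 2 := rfl
  refine false_of_even_param (d := d) (k := k) (e := e) (r := r) hd hk ?_ ?_ ?_ hF' hB'
  · rw [hfe]; simp [hC2]; ring
  · rw [hge]; simp [hC2, hC3]; ring
  · rw [← neg_neg (lin M h), hhe]; simp [hC2, hC3]; ring

/-- Each outer $A_2$ is a cusp of exactly one component. A cuspidal cubic has only one cusp, so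
$P\neq Q$ puts the two cusps on different components. -/
theorem not_mul_of_two_cusps (H : IsGood f g h) {P Q : Plane} (hPQ : P ≠ Q)
    (hP : HasType (sextic f g h) P (.A 2)) (hQ : HasType (sextic f g h) Q (.A 2))
    (hfP : value f P ≠ 0) (hgP : value g P ≠ 0) (hA : A.IsHomogeneous 3) (hB : B.IsHomogeneous 3) :
    sextic f g h ≠ A * B := by
  intro hF
  wlog hAP : IsCuspOf A P.rep generalizing A B
  · refine this hB hA (by rw [hF, mul_comm]) ?_
    exact ((isCuspOf_of_mul hP hA hB hF).resolve_left fun h => hAP h.1).1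
  rcases isCuspOf_of_mul hQ hA hB hF with ⟨h1, -⟩ | ⟨h1, -⟩
  · refine hPQ ?_
    obtain ⟨M, c, hM, hc, hMx, hlin⟩ := hAP.exists_lin
    obtain ⟨y, hy⟩ := exists_mulVec_eq hM Q.rep
    rw [← hy] at h1
    have h2 := h1.comp_lin hM
    rw [hlin] at h2
    obtain ⟨y1, y2⟩ := eq_smul_of_isCuspOf_cuspidalCubic h2
    have hye : y = y 0 • ![1, 0, 0] := by
      ext i; fin_cases i <;> simp [y1, y2]
    rw [hye, Matrix.mulVec_smul, hMx, smul_smul] at hy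
    rw [← P.mk_rep, ← Q.mk_rep, eq_comm, Projectivization.mk_eq_mk_iff']
    exact ⟨_, hy⟩
  · exact false_of_two_cusps H h1 hAP hfP hgP hF
end SemiTorus

namespace SemiTorus
open MvPolynomial
variable {f g h A B : Form}

/-! ### Triple roots -/

lemma eval_derivative_eq_zero_of_pow_three_dvd {p : ℂ} {q : Polynomial ℂ}
    (h : (Polynomial.X - Polynomial.C p) ^ 3 ∣ q) :
    q.eval p = 0 ∧ q.derivative.eval p = 0 ∧ q.derivative.derivative.eval p = 0 := by
  obtain ⟨r, rfl⟩ := h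
  simp [Polynomial.derivative_mul, Polynomial.derivative_pow]

lemma isCoprime_X_sub_C_pow {p : ℂ} {q : Polynomial ℂ} (h : q.eval p ≠ 0) (n : ℕ) :
    IsCoprime ((Polynomial.X - Polynomial.C p) ^ n) q := by
  refine IsCoprime.pow_left ((Polynomial.irreducible_X_sub_C p).coprime_iff_not_dvd.mpr ?_)
  rwa [Polynomial.dvd_iff_isRoot]

/-- Here $D=t+b$ and $E=t^2+e$; the hypotheses say that neither vanishes at $p$ and that they have
no common root. The triple root is shared by both factors or belongs to one of them. -/
lemma not_triple_root_of_monic {b e p : ℂ} (hu : p + b ≠ 0) (hE : p ^ 2 + e ≠ 0)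
    (hbe : b ^ 2 + e ≠ 0) {G₁ G₂ : Polynomial ℂ}
    (h1 : G₁ = Polynomial.X ^ 2 - Polynomial.C b * Polynomial.X + Polynomial.C (2 * e))
    (h2 : G₂ = Polynomial.X ^ 4 - Polynomial.C (2 * b) * Polynomial.X ^ 3
      + Polynomial.C (e - 2 * b ^ 2) * Polynomial.X ^ 2 - Polynomial.C (4 * b * e) * Polynomial.X
      + Polynomial.C (e ^ 2 - 3 * b ^ 2 * e)) :
    ¬ (Polynomial.X - Polynomial.C p) ^ 3 ∣ G₁ * G₂ := by
  intro hdvd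
  by_cases hG1 : G₁.eval p = 0
  · by_cases hG2 : G₂.eval p = 0
    · rw [h1] at hG1
      rw [h2] at hG2
      simp at hG1 hG2
      -- In terms of $D(p)$ and $E(p)$, the two equations give $p=2b$ and then $b^2+e=0$, a common
      -- root of $D$ and $E$.
      have e1 : p * (p + b) = 2 * (p ^ 2 + e) := by linear_combination -hG1
      have e2 : (p ^ 2 + e) * (3 * (p ^ 2 + e) - (p + b) ^ 2) = 0 := by
        linear_combination hG2 / 3 - ((p ^ 2 + e + p * (p + b)) + 3 * (p ^ 2 + e)) / 3 * e1
      have e3 := (mul_eq_zero.mp e2).resolve_left hE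
      have e4 : (p + b) * (p - 2 * b) = 0 := by linear_combination 3 * e1 + 2 * e3
      have e5 := (mul_eq_zero.mp e4).resolve_left hu
      refine hbe ?_
      rw [show p = 2 * b by linear_combination e5] at e3
      linear_combination e3 / 3
    · obtain ⟨d1, d2, d3⟩ := eval_derivative_eq_zero_of_pow_three_dvd
        ((isCoprime_X_sub_C_pow hG2 3).dvd_of_dvd_mul_right hdvd)
      rw [h1] at d3
      simp at d3
  · obtain ⟨d1, d2, d3⟩ := eval_derivative_eq_zero_of_pow_three_dvd
        ((isCoprime_X_sub_C_pow hG1 3).dvd_of_dvd_mul_left hdvd)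
    rw [h2] at d1 d2 d3
    simp only [Polynomial.derivative_add,
      Polynomial.derivative_sub, Polynomial.derivative_X_pow, Polynomial.derivative_C_mul,
      Polynomial.derivative_C, Polynomial.derivative_X] at d1 d2 d3
    simp [-map_mul, -map_sub, -map_pow,
      -map_add] at d1 d2 d3
    -- The second derivative determines $e$, and the first then factors; each factor forces $p=b=0$.
    have e1 : e = 2 * b ^ 2 + 6 * b * p - 6 * p ^ 2 := by linear_combination d3 / 2
    subst e1
    have e2 : (p - 2 * b) ^ 2 * (4 * p + b) = 0 := by linear_combination -d2 / 2
    rcases mul_eq_zero.mp e2 with e2 | e2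
    · have e3 : p = 2 * b := by linear_combination pow_eq_zero_iff two_ne_zero |>.mp e2
      subst e3
      have : b = 0 := by
        have : 162 * b ^ 4 = 0 := by linear_combination d1
        simpa using this
      subst this
      simp at hu
    · have e3 : b = -4 * p := by linear_combination e2
      subst e3
      have : p = 0 := by
        have : 81 * p ^ 4 = 0 := by linear_combination -d1
        simpa using this
      subst this
      simp at hu

/-- Scaling reduces to monic $D,E$. For constant $D$ the product is a constant times $2kt^3+3et$. -/
lemma not_triple_root {a b k e p : ℂ} (hk : k ≠ 0) (hu : a * p + b ≠ 0) (hE : k * p ^ 2 + e ≠ 0)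
    (hcop : ∀ t, a * t + b = 0 → k * t ^ 2 + e ≠ 0) :
    ¬ (Polynomial.X - Polynomial.C p) ^ 3 ∣
      (Polynomial.C (a * k) * Polynomial.X ^ 2 - Polynomial.C (k * b) * Polynomial.X
        + Polynomial.C (2 * a * e))
      * ((Polynomial.C (2 * a * k) * Polynomial.X ^ 2 + Polynomial.C (k * b) * Polynomial.X
        + Polynomial.C (a * e)) ^ 2
        - Polynomial.C (3 * k) * (Polynomial.C a * Polynomial.X + Polynomial.C b) ^ 2
          * (Polynomial.C k * Polynomial.X ^ 2 + Polynomial.C e)) := by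
  intro hdvd
  by_cases ha : a = 0
  · subst ha
    have hb : b ≠ 0 := by simpa using hu
    have h1 : (Polynomial.X - Polynomial.C p) ^ 3 ∣ Polynomial.C (k ^ 2 * b ^ 3)
        * (Polynomial.C (2 * k) * Polynomial.X ^ 3 + Polynomial.C (3 * e) * Polynomial.X) := by
      convert hdvd using 1
      have h3 : (Polynomial.C 3 : Polynomial ℂ) = 3 := rfl
      have h2 : (Polynomial.C 2 : Polynomial ℂ) = 2 := rfl
      simp [h2, h3]
      ring
    have hu : IsUnit (Polynomial.C (k ^ 2 * b ^ 3)) := Polynomial.isUnit_C.mpr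
      (isUnit_iff_ne_zero.mpr (mul_ne_zero (pow_ne_zero 2 hk) (pow_ne_zero 3 hb)))
    obtain ⟨d1, d2, d3⟩ := eval_derivative_eq_zero_of_pow_three_dvd (hu.dvd_mul_left.mp h1)
    simp [hk] at d1 d2 d3
    obtain rfl : p = 0 := d3.resolve_left (by norm_num)
    have : e = 0 := by simpa using d2
    subst this
    simp at hE
  · have hb : b = a * (b / a) := by field_simp
    have he : e = k * (e / k) := by field_simp
    generalize b / a = b' at hb
    generalize e / k = e' at he
    subst hb he
    refine not_triple_root_of_monic (b := b') (e := e') (p := p) ?_ ?_ ?_ rfl rfl ?_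
    · intro h; exact hu (by linear_combination a * h)
    · intro h; exact hE (by linear_combination k * h)
    · intro h; exact hcop (-b') (by ring) (by linear_combination k * h)
    · have hunit : IsUnit (Polynomial.C (a ^ 3 * k ^ 3)) := Polynomial.isUnit_C.mpr
        (isUnit_iff_ne_zero.mpr (mul_ne_zero (pow_ne_zero 3 ha) (pow_ne_zero 3 hk)))
      refine hunit.dvd_mul_left.mp ?_
      convert hdvd using 1
      have h3 : (Polynomial.C 3 : Polynomial ℂ) = 3 := rfl
      have h2 : (Polynomial.C 2 : Polynomial ℂ) = 2 := rfl
      have h4 : (Polynomial.C 4 : Polynomial ℂ) = 4 := rfl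
      simp [h2, h3, h4]
      ring

/-! ### The other component on the cuspidal cubic -/

/-- If the cuspidal cubic is a component of `f ^ 3 + g ^ 2 * h` whose cusp is an inner singularity,
the restriction of the other component to it is explicit. -/
lemma cuspParam_cofactor {a b k e : ℂ}
    (hf : f = C (a ^ 2 * k) * (X 0 * X 2) + C (2 * a * b * k) * (X 0 * X 1)
      + C (b ^ 2 * k + a ^ 2 * e) * X 2 ^ 2 + C (2 * a * b * e) * (X 1 * X 2)
      + C (b ^ 2 * e) * X 1 ^ 2)
    (hg : g = C (a ^ 3) * (X 0 * X 1) + C (3 * a ^ 2 * b) * X 2 ^ 2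
      + C (3 * a * b ^ 2) * (X 1 * X 2) + C (b ^ 3) * X 1 ^ 2)
    (hh : h = - (C (k ^ 3) * X 0 ^ 2 + C (3 * k ^ 2 * e) * (X 0 * X 2)
      + C (3 * k * e ^ 2) * X 2 ^ 2 + C (e ^ 3) * X 1 ^ 2))
    (hF : sextic f g h = cuspidalCubic * B) :
    cuspParam B = - ((Polynomial.C a * Polynomial.X + Polynomial.C b) ^ 3
      * ((Polynomial.C (a * k) * Polynomial.X ^ 2 - Polynomial.C (k * b) * Polynomial.X
        + Polynomial.C (2 * a * e))
      * ((Polynomial.C (2 * a * k) * Polynomial.X ^ 2 + Polynomial.C (k * b) * Polynomial.X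
        + Polynomial.C (a * e)) ^ 2
        - Polynomial.C (3 * k) * (Polynomial.C a * Polynomial.X + Polynomial.C b) ^ 2
          * (Polynomial.C k * Polynomial.X ^ 2 + Polynomial.C e)))) := by
  -- After differentiating in $X_1$ and restricting, the term with $\partial B$ vanishes and
  -- $\partial_1$ of the cubic becomes $2t^3$.
  have h1 := congrArg (fun G => cuspParam (pderiv 1 G)) hF
  simp only [sextic, map_add, Derivation.leibniz, Derivation.leibniz_pow, smul_eq_mul, map_mul,
    cuspParam_cuspidalCubic, zero_mul, zero_add] at h1
  refine mul_left_cancel₀ (pow_ne_zero 3 (Polynomial.X_ne_zero (R := ℂ))) ?_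
  refine mul_left_cancel₀ (two_ne_zero (α := Polynomial ℂ)) ?_
  have e1 : cuspParam (pderiv 1 cuspidalCubic) = 2 * Polynomial.X ^ 3 := by
    simp [cuspidalCubic, cuspParam, Derivation.leibniz, Derivation.leibniz_pow, pderiv_X]
    ring
  rw [e1] at h1
  have e2 : 2 * (Polynomial.X ^ 3 * cuspParam B) = cuspParam B * (2 * Polynomial.X ^ 3) := by ring
  rw [e2, ← h1, hf, hg, hh]
  have h3 : (Polynomial.C 3 : Polynomial ℂ) = 3 := rfl
  have h2 : (Polynomial.C 2 : Polynomial ℂ) = 2 := rfl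
  have h3' : (C 3 : Form) = 3 := rfl
  have h2' : (C 2 : Form) = 2 := rfl
  have hC : ∀ c : ℂ, cuspParam (C c) = Polynomial.C c := fun c => aeval_C _ _
  simp [Derivation.leibniz, Derivation.leibniz_pow, pderiv_X, hC, h2, h3]
  simp [cuspParam]
  ring
end SemiTorus

namespace SemiTorus
open MvPolynomial
variable {f g h A B : Form}

/-! ### A splitting with an inner singularity on one component only -/

/-- The last row of $M^{-1}$ is dual to the tangent direction of $u=0$. -/
lemma exists_linForm_axis {P : Plane} {Φ : Fin 3 → Series} (hΦ : IsLocalParam P Φ) :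
    ∃ r, value (linForm r) P = 0 ∧ PowerSeries.coeff 1 (axis 1 (aeval Φ (linForm r))) = 1 := by
  obtain ⟨M, Ψ, hM, hMP, hΨ, hMv, hΦΨ⟩ := exists_isStdParam hΦ
  have key : ∀ x, eval (M.mulVec x) (linForm (M⁻¹ 2)) = x 2 := by
    intro x
    have h1 : (M⁻¹).mulVec (M.mulVec x) = x := by
      rw [Matrix.mulVec_mulVec, Matrix.nonsing_inv_mul _ (isUnit_iff_ne_zero.mpr hM),
        Matrix.one_mulVec]
    conv_rhs => rw [← h1]
    rw [eval_linForm]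
    rfl
  refine ⟨M⁻¹ 2, ?_, ?_⟩
  · rw [value, ← hMP, key]; simp
  · rw [coeff_axis_linForm, ← hMv, key]; simp

/-- At a singularity of type `A₅` the two components of `A * B` meet with multiplicity three. -/
lemma exists_mul_mem_span_pow_three {F : Form} {P : Plane} (hP : HasType F P (.A 5))
    (hA : A.IsHomogeneous 3) (hB : B.IsHomogeneous 3) (hF : F = A * B) (hAP : value A P = 0)
    (hBP : value B P = 0) : ∃ (y s : Form) (n : ℕ), y.IsHomogeneous 1 ∧ value y P = 0 ∧ s.IsHomogeneous n ∧
      value s P ≠ 0 ∧ s * B ∈ Ideal.span {A, y ^ 3} := by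
  obtain ⟨hτ, Φ, hΦ, e, he, heq⟩ := hP
  rw [isUnit_iff_constantCoeff_ne_zero] at he
  rw [hF, map_mul] at heq
  obtain ⟨i, -, hi, hA1, hB1, hA2, hB2, hA3, -⟩ := mul_eq_A
    (by rw [constantCoeff_aeval hΦ, hAP]) (by rw [constantCoeff_aeval hΦ, hBP]) he
    (N := 6) (by norm_num) heq
  obtain rfl : i = 3 := by omega
  obtain ⟨r, hrP, hr⟩ := exists_linForm_axis hΦ
  have hy : (linForm r ^ 3).IsHomogeneous 3 := (linForm_isHomogeneous r).pow 3
  have hcc : MvPowerSeries.constantCoeff (aeval Φ (linForm r)) = 0 := by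
    rw [constantCoeff_aeval hΦ, hrP]
  obtain ⟨z, hz⟩ := X_dvd_axis 1 hcc
  have hz1 : PowerSeries.constantCoeff z = 1 := by
    rw [← hr, hz]
    simp
  have h3 : axis 1 (aeval Φ (linForm r ^ 3)) = PowerSeries.X ^ 3 * z ^ 3 := by
    rw [map_pow, map_pow, hz, mul_pow]
  -- Locally $(A,y^3)=(u,v^3)$, which contains $B$.
  obtain ⟨n, s, hs, hsP, hmem⟩ := exists_mul_mem_span hΦ hA hy hB (mem_span_pair_of_jacobian
    (by norm_num) hA1 (by rw [h3]; exact dvd_mul_right _ _) (by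
      have h4 : PowerSeries.constantCoeff (normalDeriv 1 (aeval Φ (linForm r ^ 3))) = 0 := by
        rw [map_pow, normalDeriv_pow_three, map_mul, map_mul, map_pow, constantCoeff_axis, hcc]
        simp
      rw [h4, mul_zero, sub_zero, h3, coeff_X_pow_mul_self, map_pow, hz1]
      simpa using hA3) hB1)
  exact ⟨linForm r, s, n, linForm_isHomogeneous r, hrP, hs, hsP, hmem⟩

/-- An inner singularity on exactly one of two cubic components is a cusp of that component. -/
lemma IsGood.exists_lin_eq_cuspidalCubic (H : IsGood f g h) (hA : A.IsHomogeneous 3)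
    (hF : sextic f g h = A * B) {R : Plane} (hfR : value f R = 0) (hgR : value g R = 0)
    (hBR : value B R ≠ 0) : ∃ (M : Matrix (Fin 3) (Fin 3) ℂ) (c : ℂ), M.det ≠ 0 ∧ c ≠ 0 ∧
      M.mulVec ![1, 0, 0] = c • R.rep ∧ lin M A = cuspidalCubic := by
  obtain ⟨τ, Φ, e, hτ, hΦ, he, heq, hcusp, -, -⟩ := H.exists_local hfR hgR
  rw [hF, map_mul] at heq
  obtain ⟨e', he', h'⟩ := exists_unit_mul_of_mul_eq (by rw [constantCoeff_aeval hΦ]; exact hBR)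
    he heq
  match τ, hτ, hcusp, h' with
  | .A n, hτ, hcusp, h' =>
    have h1 : 1 ≤ n := hτ
    have h2 : 3 ∣ n + 1 := hcusp
    exact (SemiTorus.exists_lin_eq_cuspidalCubic hΦ hA he' (N := n + 1) (by omega) (by omega) h').2
  | .E6, _, _, h' => exact absurd h' (cubic_ne_E6 hΦ hA he')

/-- The components of a splitting sextic with an `A₅` off the base points of the pencil. -/
lemma false_of_inner_of_A5 (H : IsGood f g h) {P R : Plane} (hP : HasType (sextic f g h) P (.A 5))
    (hfP : value f P ≠ 0) (hgP : value g P ≠ 0) (hA : A.IsHomogeneous 3) (hB : B.IsHomogeneous 3)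
    (hAP : value A P = 0) (hBP : value B P = 0)
    (hF : sextic f g h = A * B) (hfR : value f R = 0) (hgR : value g R = 0)
    (hBR : value B R ≠ 0) : False := by
  obtain ⟨M, c, hM, hc, hMR, hlin⟩ := H.exists_lin_eq_cuspidalCubic hA hF hfR hgR hBR
  obtain ⟨y, s, n, hy, hyP, hs, hsP, hsB⟩ := exists_mul_mem_span_pow_three hP hA hB hF hAP hBP
  obtain ⟨x, hx⟩ := exists_mulVec_eq hM P.rep
  have hval : ∀ G : Form, value G P = eval x (lin M G) := fun G => by rw [eval_lin, hx, value]
  have hxA : eval x cuspidalCubic = 0 := by rw [← hlin, ← hval, hAP]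
  -- The point $P$ is not the cusp, because $f$ vanishes at $R$ but not at $P$.
  have hx1 : x 1 ≠ 0 := by
    intro hx1
    have hx2 : x 2 = 0 := by
      rw [eval_cuspidalCubic, hx1] at hxA
      simpa using hxA
    have hxe : x = x 0 • ![1, 0, 0] := by
      ext i; fin_cases i <;> simp [hx1, hx2]
    apply hfP
    rw [value, ← hx, hxe, Matrix.mulVec_smul, hMR, smul_smul, eval_smul_of_isHomogeneous H.hf]
    unfold value at hfR
    rw [hfR, mul_zero]
  obtain ⟨p, hp⟩ := exists_eq_of_eval_cuspidalCubic hxA hx1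
  have hval' : ∀ {G : Form} {d : ℕ}, G.IsHomogeneous d →
      value G P = x 1 ^ d * (cuspParam (lin M G)).eval p := fun {G d} hG => by
    rw [hval, hp, eval_smul_of_isHomogeneous (lin_isHomogeneous hG M), eval_cuspParam]
    simp
  have hF' : sextic (lin M f) (lin M g) (lin M h) = cuspidalCubic * lin M B := by
    rw [← lin_sextic, hF, map_mul, hlin]
  have hf' := lin_isHomogeneous H.hf M
  have hg' := lin_isHomogeneous H.hg M
  have hh' := lin_isHomogeneous H.hh M
  have hfp : (cuspParam (lin M f)).eval p ≠ 0 := by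
    intro h0; apply hfP; rw [hval' H.hf, h0, mul_zero]
  have hgp : (cuspParam (lin M g)).eval p ≠ 0 := by
    intro h0; apply hgP; rw [hval' H.hg, h0, mul_zero]
  -- Contact three of the components at $P$ is a triple root of the restriction of $B$.
  have hdvd : (Polynomial.X - Polynomial.C p) ^ 3 ∣ cuspParam (lin M B) := by
    obtain ⟨u, v, huv⟩ := Ideal.mem_span_pair.mp hsB
    have h1 := congrArg (fun G => cuspParam (lin M G)) huv
    simp only [map_add, map_mul, map_pow, hlin, cuspParam_cuspidalCubic, mul_zero, zero_add] at h1
    have h2 : Polynomial.X - Polynomial.C p ∣ cuspParam (lin M y) := by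
      rw [hval' hy, mul_eq_zero] at hyP
      rw [Polynomial.dvd_iff_isRoot]
      exact hyP.resolve_left (pow_ne_zero 1 hx1)
    refine (isCoprime_X_sub_C_pow (q := cuspParam (lin M s)) ?_ 3).dvd_of_dvd_mul_left
      (h1 ▸ (pow_dvd_pow_of_dvd h2 3).mul_left _)
    intro h0; apply hsP; rw [hval' hs, h0, mul_zero]
  obtain ⟨D, E, hD, hE, h1, h2, h3, h4⟩ := exists_cuspParam_eq hg' hh' ⟨_, hF'⟩
    (fun h0 => hgp (by rw [h0, Polynomial.eval_zero])) fun z hz hfz hgz => by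
      rw [eval_lin] at *
      exact H.eval_ne (mulVec_ne_zero hM hz) hfz hgz
  rw [h1, Polynomial.eval_pow] at hgp
  rw [h2, Polynomial.eval_mul] at hfp
  have hDp := ne_zero_pow three_ne_zero hgp
  have hEp := right_ne_zero_of_mul hfp
  have hR : ∀ {G : Form}, G.IsHomogeneous 2 → eval ![1, 0, 0] (lin M G) = c ^ 2 * value G R := by
    intro G hG
    rw [eval_lin, hMR, eval_smul_of_isHomogeneous hG, value]
  obtain ⟨d, a, b, rfl⟩ := exists_eq_of_natDegree_le_two hD
  obtain ⟨k, k', e, rfl⟩ := exists_eq_of_natDegree_le_two hE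
  rw [sq_mul_eq_sexticPoly] at h2
  rw [pow_succ, sq_mul_eq_sexticPoly] at h1
  rw [pow_succ, sq_mul_eq_sexticPoly] at h3
  obtain ⟨-, hfe⟩ := eq_of_cuspParam_eq hf' h2
  obtain ⟨-, hge⟩ := eq_of_cuspParam_eq hg' h1
  obtain ⟨hh5, hhe⟩ := eq_of_cuspParam_eq (q := -lin M h) hh'.neg (by rw [map_neg, h3, neg_neg])
  have hg6 := eval_one_zero_zero hg' h1
  have hh6 := eval_one_zero_zero (q := -lin M h) hh'.neg (by rw [map_neg, h3, neg_neg])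
  rw [hR H.hg, hgR] at hg6
  rw [map_neg, hR H.hh] at hh6
  have hhR := H.value_ne R hfR hgR
  simp at hg6 hh6 hh5 hfe hge hhe
  -- The leading coefficients of $D^3$ and $E^3$ are values at the cusp $R$, where $g=0$ and
  -- $h\neq0$.
  obtain rfl : d = 0 := by simpa using hg6
  have hk : k ≠ 0 := by
    rintro rfl
    simp [hc, hhR] at hh6
  obtain rfl : k' = 0 := by
    have : 3 * k ^ 2 * k' = 0 := by linear_combination hh5
    simpa [hk] using this
  have hC3 : (C 3 : Form) = 3 := rfl
  have hC2 : (C 2 : Form) = 2 := rfl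
  simp at hDp hEp h4
  have key := cuspParam_cofactor (a := a) (b := b) (k := k) (e := e) (by rw [hfe]; simp [hC2]; ring)
    (by rw [hge]; simp [hC2, hC3]; ring) (by rw [← neg_neg (lin M h), hhe]; simp [hC2, hC3]; ring) hF'
  rw [key, dvd_neg] at hdvd
  refine not_triple_root hk hDp hEp h4 ((isCoprime_X_sub_C_pow ?_ 3).dvd_of_dvd_mul_left hdvd)
  simpa using hDp
end SemiTorus

namespace SemiTorus
open MvPolynomial
variable {f g h A B : Form}

/-! ### A splitting with all inner singularities on both components -/

/-- A factorization excludes $E_6$; otherwise $n+1=2i=3k$. Then $A$, of order $i\ge k$, lies in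
$(g,f)=(u,v^k)$, and $(A,g)=(u,v^i)$ contains $B$, because $g$ has order at least $2k>i$. -/
lemma IsGood.local_factors (H : IsGood f g h) (hA : A.IsHomogeneous 3) (hB : B.IsHomogeneous 3)
    (hF : sextic f g h = A * B) {R : Plane} (hfR : value f R = 0) (hgR : value g R = 0)
    (hAR : value A R = 0) (hBR : value B R = 0) :
    (∃ (n : ℕ) (s : Form), s.IsHomogeneous n ∧ value s R ≠ 0 ∧ s * A ∈ Ideal.span {g, f}) ∧
    ∃ (n : ℕ) (s : Form), s.IsHomogeneous n ∧ value s R ≠ 0 ∧ s * B ∈ Ideal.span {A, g} := by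
  obtain ⟨τ, Φ, e, hτ, hΦ, he, heq, hcusp, -, hspan⟩ := H.exists_local hfR hgR
  have hAc : MvPowerSeries.constantCoeff (aeval Φ A) = 0 := by rw [constantCoeff_aeval hΦ, hAR]
  have hBc : MvPowerSeries.constantCoeff (aeval Φ B) = 0 := by rw [constantCoeff_aeval hΦ, hBR]
  have heq' := heq
  rw [hF, map_mul] at heq'
  match τ, hτ, hcusp, heq, heq', hspan with
  | .E6, _, _, _, heq', _ => exact absurd heq' (mul_ne_E6 hAc hBc he)
  | .A n, _, _, heq, heq', hspan =>
    obtain ⟨i, hi, hni, hA1, hB1, hA2, -⟩ := mul_eq_A hAc hBc he (N := n + 1) (by omega) heq'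
    obtain ⟨k, -, hnk, hg1, -, -, hg2⟩ := cube_add_sq_eq_A (a := aeval Φ g) (b := aeval Φ f)
      (ε := aeval Φ h) (e := e) (N := n + 1) (by rw [constantCoeff_aeval hΦ, hgR])
      (by rw [constantCoeff_aeval hΦ, hfR]) he
      (by rw [constantCoeff_aeval hΦ]; exact H.value_ne R hfR hgR) (by omega)
      (by
        rw [sextic, map_add, map_mul, map_pow, map_pow] at heq
        rw [mul_comm (aeval Φ h), heq]; rfl)
    refine ⟨exists_mul_mem_span hΦ H.hg H.hf hA ((hspan _).mpr ?_),
      exists_mul_mem_span hΦ hA H.hg hB (mem_span_pair_of_jacobian hi hA1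
        ((pow_dvd_pow _ (by omega)).trans hg1) ?_ hB1)⟩
    · refine (pow_dvd_pow _ ?_).trans hA1
      change (n + 1) / 3 ≤ i
      omega
    · rw [PowerSeries.X_pow_dvd_iff.mp hg1 i (by omega), mul_zero, zero_sub]
      exact neg_ne_zero.mpr (mul_ne_zero hA2 hg2)

/-- If both components of a splitting pass through all inner singularities, they are explicit in
terms of two linear forms. -/
lemma IsGood.exists_linear_of_mul (H : IsGood f g h) (hA : A.IsHomogeneous 3)
    (hB : B.IsHomogeneous 3) (hF : sextic f g h = A * B)
    (hAB : ∀ R, value f R = 0 → value g R = 0 → value A R = 0 ∧ value B R = 0) :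
    ∃ (c μ : ℂ) (n L : Form), c ≠ 0 ∧ n.IsHomogeneous 1 ∧ L.IsHomogeneous 1 ∧
      B = C c * A + n * g ∧ 4 * C c * f = L ^ 2 - C μ * g ∧
      8 * C c * (2 * C c * A + n * g) = L * (2 * L ^ 2 - 3 * C μ * g) := by
  have hCh : ∀ {G : Form} {d : ℕ} (c : ℂ), G.IsHomogeneous d → (C c * G).IsHomogeneous d :=
    fun c hG => by simpa using (isHomogeneous_C _ c).mul hG
  have hmA : A ∈ Ideal.span {g, f} := by
    refine mem_span_of_local H.hg H.hf (H.finite.subset fun R hR => ⟨hR.2, hR.1⟩)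
      fun R hgR hfR => ?_
    obtain ⟨h1, h2⟩ := hAB R hfR hgR
    exact (H.local_factors hA hB hF hfR hgR h1 h2).1
  have hfz : ∀ R, value A R = 0 → value g R = 0 → value f R = 0 := by
    intro R hAR hgR
    have := congrArg (eval R.rep) hF
    unfold value at *
    simp [sextic, hAR, hgR] at this
    exact this
  have hmB : B ∈ Ideal.span {A, g} := by
    refine mem_span_of_local hA H.hg (H.finite.subset fun R hR => ⟨hfz R hR.1 hR.2, hR.2⟩)
      fun R hAR hgR => ?_
    have hfR := hfz R hAR hgR
    obtain ⟨h1, h2⟩ := hAB R hfR hgR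
    exact (H.local_factors hA hB hF hfR hgR h1 h2).2
  obtain ⟨m, l, hm, hl, hAe⟩ := exists_isHomogeneous_of_mem_span (k := 1) (l := 1) H.hg H.hf hA
    rfl rfl hmA
  obtain ⟨c, n, hc, hn, hBe⟩ := exists_isHomogeneous_of_mem_span (k := 0) (l := 1) hA H.hg hB
    rfl rfl hmB
  obtain ⟨c, rfl⟩ := exists_eq_C_of_isHomogeneous hc
  have hfg := H.isRelPrime
  have hg0 : g ≠ 0 := ne_zero_of_isRelPrime H.hf two_ne_zero hfg
  have hC2 : (C 2 : Form) = 2 := rfl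
  have hC4 : (C 4 : Form) = 4 := rfl
  have hC8 : (C 8 : Form) = 8 := rfl
  have hc0 : c ≠ 0 := by
    rintro rfl
    refine not_isUnit_of_isHomogeneous H.hg two_ne_zero
      ((hfg.symm.pow_right (n := 3)) dvd_rfl ⟨A * n - g * h, ?_⟩)
    rw [map_zero, zero_mul, zero_add] at hBe
    rw [sextic, hBe] at hF
    linear_combination hF
  have hCc : (C c : Form) ≠ 0 := by simpa using hc0
  have hL : (C (2 * c) * l).IsHomogeneous 1 := hCh _ hl
  have hK : (C (2 * c) * m + n).IsHomogeneous 1 := (hCh _ hm).add hn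
  obtain ⟨L, hLe⟩ : ∃ L, L = C (2 * c) * l := ⟨_, rfl⟩
  obtain ⟨K, hKe⟩ : ∃ K, K = C (2 * c) * m + n := ⟨_, rfl⟩
  rw [← hLe] at hL
  rw [← hKe] at hK
  rw [map_mul, hC2] at hLe hKe
  have hW : 2 * C c * A + n * g = L * f + K * g := by
    rw [hLe, hKe]; linear_combination 2 * C c * hAe
  -- Completing the square: $(2cA+ng)^2=4cF+n^2g^2$. Reducing modulo $g$ and then to the next order
  -- yields $\mu$ and $\nu$.
  have hsq : (L * f + K * g) ^ 2 = 4 * C c * f ^ 3 + g ^ 2 * (4 * C c * h + n ^ 2) := by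
    rw [← hW]
    rw [sextic, hBe] at hF
    linear_combination -4 * C c * hF
  obtain ⟨μ, hμ⟩ := exists_eq_C_mul_of_dvd H.hg (G := L ^ 2 - 4 * C c * f)
    (by
      have := (hL.pow 2).sub (hCh (4 * c) H.hf)
      rwa [map_mul, hC4] at this)
    ((hfg.symm.pow_right (n := 2)).dvd_of_dvd_mul_left
      ⟨g * (4 * C c * h + n ^ 2) - 2 * L * K * f - K ^ 2 * g, by linear_combination hsq⟩)
  have hdvd : g ∣ C μ * f + 2 * L * K := by
    refine hfg.symm.dvd_of_dvd_mul_left ⟨4 * C c * h + n ^ 2 - K ^ 2, ?_⟩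
    refine mul_left_cancel₀ hg0 ?_
    linear_combination hsq - f ^ 2 * hμ
  obtain ⟨ν, hν⟩ := exists_eq_C_mul_of_dvd H.hg (G := C μ * f + 2 * L * K)
    (by
      have := (hCh μ H.hf).add (hCh 2 (hL.mul hK))
      rwa [hC2, ← mul_assoc] at this) hdvd
  have hprod : L * (C μ * L + 8 * C c * K) = C (4 * c * ν + μ ^ 2) * g := by
    simp only [map_add, map_mul, map_pow, hC4]
    linear_combination 4 * C c * hν + C μ * hμ
  have hrel : ∀ G : Form, (C (4 * c)⁻¹ : Form) * (4 * C c * G) = G := by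
    intro G
    rw [← mul_assoc, ← hC4, ← map_mul, ← map_mul, inv_mul_cancel₀ (by simpa using hc0), map_one,
      one_mul]
  -- Otherwise $L$ divides $g$, and then also $f$.
  have hν0 : 4 * c * ν + μ ^ 2 = 0 := by
    by_contra hne
    have hLg : L ∣ g := by
      have h1 : C (4 * c * ν + μ ^ 2)⁻¹ * (C (4 * c * ν + μ ^ 2) * g) = g := by
        rw [← mul_assoc, ← map_mul, inv_mul_cancel₀ hne, map_one, one_mul]
      rw [← h1, ← hprod]
      exact (dvd_mul_right _ _).mul_left _
    have hLf : L ∣ f := by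
      rw [← hrel f, show 4 * C c * f = L ^ 2 - C μ * g by linear_combination -hμ]
      exact (dvd_sub (dvd_pow_self _ two_ne_zero) (hLg.mul_left _)).mul_left _
    exact not_isUnit_of_isHomogeneous hL one_ne_zero (hfg hLf hLg)
  have hL0 : L ≠ 0 := by
    intro hL0
    rw [hL0] at hμ
    have h1 := (eq_zero_of_isRelPrime H.hf H.hg two_ne_zero hfg (s := 4 * c) (t := μ) (by
      rw [map_mul, hC4]; linear_combination -hμ)).1
    simp [hc0] at h1
  rw [hν0, map_zero, zero_mul, mul_eq_zero] at hprod
  have hKL := hprod.resolve_left hL0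
  refine ⟨c, μ, n, L, hc0, hn, hL, hBe, by linear_combination -hμ, ?_⟩
  rw [hW]
  linear_combination g * hKL - 2 * L * hμ

lemma eq_C_mul_X_one_of_axis {Ψ : Fin 3 → Series} (hΨ : IsStdParam Ψ) {G : Form}
    (hG : G.IsHomogeneous 1) (h : PowerSeries.X ^ 2 ∣ axis 1 (aeval Ψ G)) :
    ∃ c, G = C c * X 1 := by
  obtain ⟨r, rfl⟩ := exists_eq_linForm hG
  have h0 := PowerSeries.X_pow_dvd_iff.mp h 0 (by norm_num)
  have h1 := PowerSeries.X_pow_dvd_iff.mp h 1 (by norm_num)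
  rw [coeff_axis_linForm, eval_linForm, Fin.sum_univ_three, hΨ.snd, hΨ.snd, hΨ.snd] at h1
  rw [PowerSeries.coeff_zero_eq_constantCoeff_apply, constantCoeff_axis, aeval_linForm,
    Fin.sum_univ_three] at h0
  have hcc : ∀ (c : ℂ) (i : Fin 3), MvPowerSeries.constantCoeff (algebraMap ℂ Series c * Ψ i)
      = c * ![1, 0, 0] i := fun c i => by
    rw [map_mul, hΨ.const]; congr 1
  rw [map_add, map_add, hcc, hcc, hcc] at h0
  refine ⟨r 1, ?_⟩
  simp at h0 h1
  rw [linForm, Fin.sum_univ_three, h0, h1]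
  simp

lemma X_pow_dvd_of_mul {k : ℕ} {x y : PowerSeries ℂ} (hx : PowerSeries.constantCoeff x ≠ 0)
    (h : PowerSeries.X ^ k ∣ x * y) : PowerSeries.X ^ k ∣ y :=
  (PowerSeries.isUnit_iff_constantCoeff.mpr (isUnit_iff_ne_zero.mpr hx)).dvd_mul_left.mp h

/-- Both components have contact three with $u=0$ at $P$. By the explicit description this forces
the tangent line to divide $A$ and $B$, whereas two factors of an $A_5$ share no divisor vanishing
at $P$. -/
theorem not_mul_of_A5 (H : IsGood f g h) {P : Plane} (hP : HasType (sextic f g h) P (.A 5))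
    (hfP : value f P ≠ 0) (hgP : value g P ≠ 0) (hA : A.IsHomogeneous 3) (hB : B.IsHomogeneous 3) :
    sextic f g h ≠ A * B := by
  intro hF
  -- If only one component passed through $P$, a cubic would have an $A_5$.
  have hone : ∀ {A B : Form}, A.IsHomogeneous 3 → sextic f g h = A * B → value B P = 0 := by
    intro A B hA hF
    by_contra hBP
    obtain ⟨hτ, Φ, hΦ, e, he, heq⟩ := hP
    rw [isUnit_iff_constantCoeff_ne_zero] at he
    rw [hF, map_mul] at heq
    obtain ⟨e', he', h'⟩ := exists_unit_mul_of_mul_eq (by rw [constantCoeff_aeval hΦ]; exact hBP)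
      he heq
    have := (exists_lin_eq_cuspidalCubic hΦ hA he' (N := 6) (by norm_num) (by norm_num) h').1
    omega
  have hF' : sextic f g h = B * A := by rw [hF, mul_comm]
  have hBP := hone hA hF
  have hAP := hone hB hF'
  obtain ⟨c, μ, n, L, hc, hn, hL, hBe, hfe, hW⟩ := H.exists_linear_of_mul hA hB hF
    fun R hfR hgR => ⟨by_contra fun h => false_of_inner_of_A5 H hP hfP hgP hB hA hBP hAP hF' hfR hgR h,
      by_contra fun h => false_of_inner_of_A5 H hP hfP hgP hA hB hAP hBP hF hfR hgR h⟩
  obtain ⟨hτ, Φ, hΦ, e, he, heq⟩ := hP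
  rw [isUnit_iff_constantCoeff_ne_zero] at he
  rw [hF, map_mul] at heq
  have hAc : MvPowerSeries.constantCoeff (aeval Φ A) = 0 := by rw [constantCoeff_aeval hΦ, hAP]
  have hBc : MvPowerSeries.constantCoeff (aeval Φ B) = 0 := by rw [constantCoeff_aeval hΦ, hBP]
  obtain ⟨i, -, hi, hA1, hB1, -⟩ := mul_eq_A hAc hBc he (N := 6) (by norm_num) heq
  obtain rfl : i = 3 := by omega
  have hnd : ∀ {w : Series}, MvPowerSeries.constantCoeff w = 0 → w ∣ aeval Φ A → ¬ w ∣ aeval Φ B :=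
    fun hw => not_dvd_factors_A hAc hBc he (N := 6) (by norm_num) heq hw
  have hax : ∀ G : Form, PowerSeries.constantCoeff (axis 1 (aeval Φ G)) = value G P := fun G => by
    rw [constantCoeff_axis, constantCoeff_aeval hΦ]
  -- From $ng=B-cA$ and $g(P)\neq0$; hence the line $n=0$ has contact at least three with $u=0$.
  have hn3 : PowerSeries.X ^ 3 ∣ axis 1 (aeval Φ n) := by
    refine X_pow_dvd_of_mul (x := axis 1 (aeval Φ g)) (by rwa [hax]) ?_
    rw [← map_mul, ← map_mul, show g * n = B - C c * A by rw [hBe]; ring, map_sub, map_sub, map_mul,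
      map_mul]
    exact dvd_sub hB1 (hA1.mul_left _)
  have hW3 : PowerSeries.X ^ 3 ∣ axis 1 (aeval Φ L)
      * axis 1 (aeval Φ (2 * L ^ 2 - 3 * C μ * g)) := by
    rw [← map_mul, ← map_mul, ← hW, show 8 * C c * (2 * C c * A + n * g)
      = 8 * C c * (C c * A + B) by rw [hBe]; ring]
    have h1 : PowerSeries.X ^ 3 ∣ axis 1 (aeval Φ (C c * A + B)) := by
      rw [map_add, map_add, map_mul, map_mul]
      exact dvd_add (hA1.mul_left _) hB1
    generalize C c * A + B = G at h1
    rw [map_mul, map_mul]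
    exact h1.mul_left _
  obtain ⟨M, Ψ, hM, -, hΨ, -, hΦΨ⟩ := exists_isStdParam hΦ
  rw [hΦΨ] at hn3
  obtain ⟨ν, hν⟩ := eq_C_mul_X_one_of_axis hΨ (lin_isHomogeneous hn M)
    ((pow_dvd_pow _ (by norm_num)).trans hn3)
  have hν0 : ν ≠ 0 := by
    rintro rfl
    rw [map_zero, zero_mul] at hν
    have hn0 : n = 0 := by rw [← lin_inv_lin hM n, hν, map_zero]
    refine hnd hAc dvd_rfl ?_
    rw [hBe, hn0, zero_mul, add_zero, map_mul]
    exact dvd_mul_left _ _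
  have hΨ3 : PowerSeries.X ^ 3 ∣ axis 1 (Ψ 1) := by
    rw [hν, map_mul, aeval_X, map_mul] at hn3
    refine X_pow_dvd_of_mul ?_ hn3
    rw [constantCoeff_axis, aeval_C]
    exact fun h => hν0 (by rw [← h]; exact (MvPowerSeries.constantCoeff_C ν).symm)
  have hdvd : X 1 ∣ lin M (L * (2 * L ^ 2 - 3 * C μ * g)) := by
    rw [map_mul]
    -- The factors $L$ and $2L^2-3\mu g$ do not both vanish at $P$, since $4cf=L^2-\mu g$ and
    -- $f(P),g(P)\neq0$; the other one has order at least three.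
    by_cases hLP : value L P = 0
    · refine Dvd.dvd.mul_right ?_ _
      have h1 : PowerSeries.X ^ 3 ∣ axis 1 (aeval Φ L) := by
        rw [mul_comm] at hW3
        refine X_pow_dvd_of_mul ?_ hW3
        rw [hax]
        have h2 := congrArg (eval P.rep) hfe
        unfold value at *
        simp [hLP] at h2 ⊢
        refine ⟨fun h => ?_, hgP⟩
        rw [h] at h2
        simp [hc, hfP] at h2
      rw [hΦΨ] at h1
      obtain ⟨l, hl⟩ := eq_C_mul_X_one_of_axis hΨ (lin_isHomogeneous hL M)
        ((pow_dvd_pow _ (by norm_num)).trans h1)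
      rw [hl]
      exact dvd_mul_left _ _
    · refine Dvd.dvd.mul_left ?_ _
      have h1 := X_pow_dvd_of_mul (by rwa [hax]) hW3
      rw [hΦΨ] at h1
      refine X_one_dvd_of_axis_quadratic hΨ (lin_isHomogeneous ?_ M) h1 hΨ3
      have hCh : ∀ {G : Form} {d : ℕ} (c : ℂ), G.IsHomogeneous d → (C c * G).IsHomogeneous d :=
        fun c hG => by simpa using (isHomogeneous_C _ c).mul hG
      have := (hCh 2 (hL.pow 2)).sub (hCh (3 * μ) H.hg)
      rwa [map_mul, show (C 2 : Form) = 2 from rfl, show (C 3 : Form) = 3 from rfl] at this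
  have hng : X 1 ∣ lin M (n * g) := by
    rw [map_mul, hν]
    exact (dvd_mul_left _ _).mul_right _
  have hdA : X 1 ∣ lin M A := by
    have h1 : C (16 * c ^ 2)⁻¹ * (L * (2 * L ^ 2 - 3 * C μ * g) - 8 * C c * (n * g)) = A := by
      rw [← hW]
      have h2 : (C (16 * c ^ 2)⁻¹ : Form) * (16 * C c ^ 2) = 1 := by
        rw [← map_pow, show (16 : Form) = C 16 from rfl, ← map_mul, ← map_mul,
          inv_mul_cancel₀ (by simpa using hc), map_one]
      linear_combination A * h2
    rw [← h1, map_mul, map_sub, map_mul (lin M) (8 * C c)]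
    exact (dvd_sub hdvd (hng.mul_left _)).mul_left _
  have hdB : X 1 ∣ lin M B := by
    rw [hBe, map_add, map_mul]
    exact dvd_add (hdA.mul_left _) hng
  have hfin : ∀ {G : Form}, X 1 ∣ lin M G → Ψ 1 ∣ aeval Φ G := fun {G} hG => by
    have := map_dvd (aeval Ψ) hG
    rwa [aeval_X, ← hΦΨ] at this
  exact hnd (by rw [hΨ.const]; simp) (hfin hdA) (hfin hdB)
end SemiTorus

namespace SemiTorus
open MvPolynomial
variable {f g h : Form}

/-! ### Torus types and configurations -/

/-- The exponents are $2$, $3$ or $6$; a sixth power is rewritten as a square or a cube, and a sum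
of two squares factors over $\mathbb C$. -/
lemma isNonTorus_six {F : Form}
    (h22 : ∀ a b : Form, a.IsHomogeneous 3 → b.IsHomogeneous 3 → F ≠ a * b)
    (h23 : ∀ a b : Form, a.IsHomogeneous 3 → b.IsHomogeneous 2 → F ≠ a ^ 2 + b ^ 3)
    (h33 : ∀ a b : Form, a.IsHomogeneous 2 → b.IsHomogeneous 2 → F ≠ a ^ 3 + b ^ 3) :
    IsNonTorus 6 F := by
  have hsq : ∀ a b : Form, a.IsHomogeneous 3 → b.IsHomogeneous 3 → F ≠ a ^ 2 + b ^ 2 := by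
    intro a b ha hb hF
    have hI : (C Complex.I : Form) ^ 2 = -1 := by
      rw [← map_pow, Complex.I_sq, map_neg, map_one]
    have hIb : (C Complex.I * b).IsHomogeneous 3 := by
      simpa using (isHomogeneous_C _ Complex.I).mul hb
    exact h22 _ _ (ha.add hIb) (ha.sub hIb) (by rw [hF]; linear_combination b ^ 2 * hI)
  rintro p q ⟨hp, hq, hp6, hq6, a, b, ha, hb, hF⟩
  have hdiv : ∀ n, 2 ≤ n → n ∣ 6 → n = 2 ∨ n = 3 ∨ n = 6 := by
    intro n h2 h6
    have := Nat.le_of_dvd (by norm_num) h6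
    interval_cases n <;> omega
  rcases hdiv p hp hp6 with rfl | rfl | rfl <;> rcases hdiv q hq hq6 with rfl | rfl | rfl
  · exact hsq a b ha hb hF
  · exact h23 a b ha hb hF
  · exact hsq a (b ^ 3) ha (by simpa using hb.pow 3) (by rw [hF]; ring)
  · exact h23 b a hb ha (by rw [hF]; ring)
  · exact h33 a b ha hb hF
  · exact h33 a (b ^ 2) ha (by simpa using hb.pow 2) (by rw [hF]; ring)
  · exact hsq (a ^ 3) b (by simpa using ha.pow 3) hb (by rw [hF]; ring)
  · exact h33 (a ^ 2) b (by simpa using ha.pow 2) hb (by rw [hF]; ring)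
  · exact hsq (a ^ 3) (b ^ 3) (by simpa using ha.pow 3) (by simpa using hb.pow 3) (by rw [hF]; ring)

open scoped Classical in
/-- The inner singularities together with some outer ones of a common type. -/
lemma containsConfiguration_add {S : Multiset SimpleType} (hS : IsInnerConfiguration f g h S)
    (U : Finset Plane) (τ : SimpleType)
    (hU : ∀ P ∈ U, IsOuter f g h P ∧ HasType (sextic f g h) P τ) :
    ContainsConfiguration (sextic f g h) (S + Multiset.replicate U.card τ) := by
  obtain ⟨T, type, hT, hT', rfl⟩ := hS
  have hdisj : Disjoint T U := Finset.disjoint_left.mpr fun P hPT hPU =>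
    (hU P hPU).1.2.1 ((hT P).mp hPT).2.1
  refine ⟨T.disjUnion U hdisj, fun P => if P ∈ U then τ else type P, fun P hP => ?_, ?_⟩
  · by_cases hPU : P ∈ U
    · simp only [if_pos hPU]
      exact ⟨(hU P hPU).1.1, (hU P hPU).2⟩
    · simp only [if_neg hPU]
      have hPT : P ∈ T := (Finset.mem_disjUnion.mp hP).resolve_right hPU
      exact ⟨((hT P).mp hPT).1, hT' P hPT⟩
  · change (T.val + U.val).map _ = _
    rw [Multiset.map_add]
    congr 1
    · exact Multiset.map_congr rfl fun P hP => if_neg (Finset.disjoint_left.mp hdisj hP)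
    · exact (Multiset.map_congr rfl fun P hP => if_pos hP).trans (Multiset.map_const' _ _)
end SemiTorus

/-! ### The theorem -/

theorem theorem7
    (f₂ g₂ h₂ : SemiTorus.Form)
    (hf : f₂.IsHomogeneous 2) (hg : g₂.IsHomogeneous 2) (hh : h₂.IsHomogeneous 2)
    (hnice : SemiTorus.IsNice f₂ g₂ h₂)
    (S : Multiset SemiTorus.SimpleType)
    (hS : SemiTorus.IsInnerConfiguration f₂ g₂ h₂ S) :
    (∀ P Q : SemiTorus.Plane, P ≠ Q →
      SemiTorus.IsOuter f₂ g₂ h₂ P → SemiTorus.IsOuter f₂ g₂ h₂ Q →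
      SemiTorus.HasType (SemiTorus.sextic f₂ g₂ h₂) P (.A 2) →
      SemiTorus.HasType (SemiTorus.sextic f₂ g₂ h₂) Q (.A 2) →
      SemiTorus.value f₂ P ≠ 0 → SemiTorus.value g₂ P ≠ 0 →
      SemiTorus.value f₂ Q ≠ 0 → SemiTorus.value g₂ Q ≠ 0 →
      SemiTorus.value f₂ P * SemiTorus.value g₂ Q
        - SemiTorus.value f₂ Q * SemiTorus.value g₂ P ≠ 0 →
      SemiTorus.NoFurtherCusps f₂ g₂ h₂ {P, Q} →
      SemiTorus.IsNonTorus 6 (SemiTorus.sextic f₂ g₂ h₂) ∧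
        SemiTorus.ContainsConfiguration (SemiTorus.sextic f₂ g₂ h₂) (S + {.A 2, .A 2})) ∧
    (∀ P : SemiTorus.Plane,
      SemiTorus.IsOuter f₂ g₂ h₂ P →
      SemiTorus.HasType (SemiTorus.sextic f₂ g₂ h₂) P (.A 5) →
      SemiTorus.value f₂ P ≠ 0 → SemiTorus.value g₂ P ≠ 0 →
      ¬ SemiTorus.TangentConeIsTangentOf (SemiTorus.sextic f₂ g₂ h₂)
        (MvPolynomial.C (SemiTorus.value g₂ P) * f₂
          - MvPolynomial.C (SemiTorus.value f₂ P) * g₂) P →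
      SemiTorus.NoFurtherCusps f₂ g₂ h₂ {P} →
      SemiTorus.IsNonTorus 6 (SemiTorus.sextic f₂ g₂ h₂) ∧
        SemiTorus.ContainsConfiguration (SemiTorus.sextic f₂ g₂ h₂) (S + {.A 5})) := by
  have H := SemiTorus.IsGood.of_isInnerConfiguration hf hg hh hnice hS
  classical
  refine ⟨fun P Q hPQ hP hQ hPA hQA hfP hgP _ _ hfg hE => ⟨?_, ?_⟩,
    fun P hP hPA hfP hgP htan hE => ⟨?_, ?_⟩⟩
  · exact SemiTorus.isNonTorus_six
      (fun a b ha hb => SemiTorus.not_mul_of_two_cusps H hPQ hPA hQA hfP hgP ha hb)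
      (fun a b ha hb => SemiTorus.not_cube_add_sq_of_two_cusps H hPA hQA hfg hE ha hb)
      (fun a b ha hb => SemiTorus.not_cube_add_cube le_rfl hPA ha hb)
  · have := SemiTorus.containsConfiguration_add hS {P, Q} (.A 2) (by
      intro R hR
      rcases Finset.mem_insert.mp hR with rfl | hR
      · exact ⟨hP, hPA⟩
      · rw [Finset.mem_singleton.mp hR]; exact ⟨hQ, hQA⟩)
    rwa [Finset.card_pair hPQ] at this
  · exact SemiTorus.isNonTorus_six
      (fun a b ha hb => SemiTorus.not_mul_of_A5 H hPA hfP hgP ha hb)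
      (fun a b ha hb => SemiTorus.not_cube_add_sq_of_A5 H hPA hfP hgP htan hE ha hb)
      (fun a b ha hb => SemiTorus.not_cube_add_cube (by norm_num) hPA ha hb)
  · exact SemiTorus.containsConfiguration_add hS {P} (.A 5) (by
      intro R hR
      rw [Finset.mem_singleton.mp hR]; exact ⟨hP, hPA⟩)
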